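/- **Setting.** Let $\mathcal A$ (arms) be a compact Polish space, $\mathcal B$ a finite set, $\mathcal Y:=\mathbb R^{\mathcal B}$, $\mu(y):=\sum_{a}y_a$, and $\mathcal D:=\Delta\mathcal B\subset\mathcal Y$ the simplex of probability vectors (outcomes). Equip $\mathcal Y$ with the norm whose unit ball is the absolute convex hull of $\mathcal D$. Let $r:\mathcal A\times\mathcal D\to\mathbb R$ be continuous, and convex and 1-Lipschitz in the second argument. Let $\mathcal Z,\mathcal W$ be finite-dimensional real vector spaces, $D_Z:=\dim\mathcal Z$, $D_W:=\dim\mathcal W$, let $\mathcal H\subseteq\mathcal Z$ be compact, and let $F:\mathcal A\times\mathcal Z\times\mathcal Y\to\mathcal W$ be continuous in the first and bilinear in the last two arguments. Write $F_{x\theta}:=F(x,\theta,\cdot)$ and $K_\theta(x):=\ker F_{x\theta}$. Assume that $K_\theta(x)\cap\mathcal D\neq\varnothing$ and $F_{x\theta}$ is onto for all $x\in\mathcal A$, $\theta\in\mathcal H$, and that no $z\ne0$ in $\mathcal Z$ satisfies $F(x,z,y)=0$ for all $x,y$. *Regret.* For $\theta\in\mathcal H$, $x\in\mathcal A$ let $\kappa_\theta(x)$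 be the set of Borel probability measures on $\mathcal D$ whose mean lies in $K_\theta(x)\cap\mathcal D$, and $\mathrm{ME}_\theta(x):=\min_{\zeta\in\kappa_\theta(x)}\mathrm E_{y\sim\zeta}[r(x,y)]$. An agent policy $\varphi$ is a Borel map from finite histories $x_0y_0\dots x_{n-1}y_{n-1}$ to $\mathcal A$. A nature policy compatible with $\theta$ is a Markov kernel $\nu$ from pairs $(h,x)$ (history, current arm) to $\mathcal D$ with $\nu(h,x)\in\kappa_\theta(x)$. With $x_n=\varphi(x_0y_0\dots x_{n-1}y_{n-1})$ and $y_n\sim\nu(x_0y_0\dots x_{n-1}y_{n-1},x_n)$, $$\mathrm{ERg}_\theta(\varphi;N):=N\max_{x}\mathrm{ME}_\theta(x)-\inf_{\nu}\sum_{n<N}\mathrm E_{\varphi\nu}[r(x_n,y_n)],$$ the infimum being over the nature policies compatible with $\theta$. *Norms.* On $\mathcal W$ put $\|w\|:=\max_{x\in\mathcal A,\theta\in\mathcal H}\min_{F_{x\theta}y=w}\|y\|$. Let $\mathcal N:=\{(z,w)\in\mathcal Z\oplus\mathcal W: F(x,z,y)+\mu(y)w=0\ \forall x,y\}$, $\bar{\mathcal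 Z}:=(\mathcal Z\oplus\mathcal W)/\mathcal N$, $\bar F(x,(z,w)+\mathcal N,y):=F(x,z,y)+\mu(y)w$, and on $\bar{\mathcal Z}$ put $\|z\|:=\max_x\|\bar F(x,z,\cdot)\|$ (operator norm). $\mathcal Z$ is regarded as a subspace of $\bar{\mathcal Z}$. Let $\mathcal V(x,y):=\{z\in\bar{\mathcal Z}:\bar F(x,z,y)=0\}$, and let $d$ denote minimal distance in $\bar{\mathcal Z}$. *IUCB with parameter $\eta\ge0$.* Start with $\mathcal C:=\mathcal H$. In each cycle choose $\hat\theta\in\operatorname{argmax}_{\theta\in\mathcal C}\max_x\mathrm{ME}_\theta(x)$ and $\hat x\in\operatorname{argmax}_x\mathrm{ME}_{\hat\theta}(x)$; select $\hat x$ repeatedly, until the number $\tau\geq 1$ of rounds of the cycle and the average $\bar y$ of its outcomes satisfy $\sqrt\tau\cdot\max_{\theta\in\mathcal C}d(\theta,\mathcal V(\hat x,\bar y))\ge2(D_Z+1)\eta$; then replace $\mathcal C$ by $\{\theta\in\mathcal C: d(\theta,\mathcal V(\hat x,\bar y))\le\eta/\sqrt\tau\}$ and begin the next cycle. Ties are resolved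 by any fixed rule for which the resulting policy $\varphi^\eta_{\mathrm{IUCB}}$ is Borel; if $\mathcal C=\varnothing$, the arm is arbitrary. *Parameters.* $R:=\max_{\theta\in\mathcal H}\|\theta\|$, $C:=\max r-\min r$, and $S:=\inf_{x\in\mathcal A,\theta\in\mathcal H}\sin(K_\theta(x)\cap\mu^{-1}(1))$ where, for an affine subspace $\mathfrak B\subseteq\mu^{-1}(1)$ meeting $\mathcal D$, $\sin(\mathfrak B):=\inf_{p\in\mathfrak B\setminus\mathcal D}\frac{\min_{q\in\mathcal D}\|p-q\|}{\min_{q\in\mathfrak B\cap\mathcal D}\|p-q\|}$ if $\mathfrak B\not\subseteq\mathcal D$, and $\sin(\mathfrak B):=1$ otherwise. Assume $S>0$. Put $\gamma:=1/\ln\big((1-e^{-2})^{-1}\big)$ and $\ln^+t:=\max(0,\ln t)$, $\ln^+0:=0$. **Theorem.** (1) For every integer $N\ge1$, all $\eta\ge0$, $\delta>0$ and $\theta\in\mathcal H$, $$\begin{aligned}\mathrm{ERg}_\theta(\varphi^\eta_{\mathrm{IUCB}};N)\le{}&8\eta(S^{-1}+1)D_Z(D_Z+1)\sqrt{\gamma\ln^+\tfrac{D_ZR}{\delta}\cdot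 N}+\tfrac12C\Big(\tfrac{2e|\mathcal B|}{D_W+1}\Big)^{D_W+1}N^2(N+1)\exp\Big(-\tfrac{\eta^2}{2R^2}\Big)\\&+\gamma CD_Z^2\ln^+\tfrac{D_ZR}{\delta}+(S^{-1}+1)D_Z(36D_Z+8)N\delta\end{aligned}$$ (if $R=0$, the exponential factor is read as $1$). (2) Let $\eta:=R\sqrt{2(D_W+1)\ln\frac{CN^3|\mathcal B|}{D_W+1}}$ (and $\eta:=0$ if the logarithm is negative or $C=0$). Then for all $\theta\in\mathcal H$ and $N\geq 1$ $$\mathrm{ERg}_\theta(\varphi^\eta_{\mathrm{IUCB}};N)=\tilde O\Big(RS^{-1}D_Z^2\sqrt{D_W\ln\tfrac{e|\mathcal B|}{D_W}\cdot N}+D_Z^2C\Big),$$ where $\tilde O(f)$ means: at most $f\cdot P(\ln f)$, with a polynomial $P$ that does not depend on the bandit, on $\theta$ or on $N$ (for $D_W=0$ the square root is read as $0$, and $f\cdot P(\ln f)$ as $0$ if $f=0$). (3) For every $\varepsilon>0$, with the same $\eta$, over all bandits with $|\mathcal B|\ge(1+\varepsilon)D_W$, $$\mathrm{ERg}_\theta(\varphi^\eta_{\mathrm{IUCB}};N)=\tilde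 O\Big(RS^{-1}D_Z^2\sqrt{D_W\ln\tfrac{|\mathcal B|}{D_W}\cdot N}+D_Z^2C\Big),$$ where now the polynomial $P$ may depend on $\varepsilon$ (only). -/

import Mathlib

open MeasureTheory ProbabilityTheory

noncomputable section

namespace ImpreciseBandit

/-- The outcome space `𝒟 = ΔB`, the standard simplex in `𝒴 = ℝ^B`, as a type. -/
abbrev Outcome (B : Type*) [Fintype B] : Type _ := ↥(stdSimplex ℝ B)

/-- The functional `μ(y) = ∑ y_b` on `ℝ^B`. -/
def mu (B : Type*) [Fintype B] : (B → ℝ) →ₗ[ℝ] ℝ := ∑ b : B, LinearMap.proj b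

/-- The norm on `𝒴 = ℝ^B` whose unit ball is the absolute convex hull of `𝒟`. -/
def normY {B : Type*} [Fintype B] (y : B → ℝ) : ℝ :=
  gauge (absConvexHull ℝ (stdSimplex ℝ B)) y

/-- Minimal distance from a point to a set, w.r.t. the norm on `𝒴`. -/
def distY {B : Type*} [Fintype B] (p : B → ℝ) (s : Set (B → ℝ)) : ℝ :=
  ⨅ q : s, normY (p - (q : B → ℝ))

open Classical in
/-- The sine of an affine subspace `E` relative to `𝒟`. When `E ⊆ 𝒟` there is no point to take the
infimum over, and the sine is `1`. -/
def sine {B : Type*} [Fintype B] (E : Set (B → ℝ)) : ℝ :=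
  if E ⊆ stdSimplex ℝ B then 1
  else sInf ((fun p => distY p (stdSimplex ℝ B) / distY p (E ∩ stdSimplex ℝ B)) ''
    (E \ stdSimplex ℝ B))

/-- The data of a linear imprecise bandit over the simplex `ΔB`, with its standing assumptions:
arms `A`, parameters `Z`, linear conditions `W`. Only the values of `r` on `A × ΔB` matter. -/
structure Bandit (A B Z W : Type*) [TopologicalSpace A] [Fintype B]
    [AddCommGroup Z] [Module ℝ Z] [TopologicalSpace Z]
    [AddCommGroup W] [Module ℝ W] [TopologicalSpace W] where
  /-- `F(x, z, y)`, bilinear in `z` and `y` -/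
  F : A → Z →ₗ[ℝ] (B → ℝ) →ₗ[ℝ] W
  /-- the set of hypotheses `ℋ` -/
  H : Set Z
  /-- the reward function -/
  r : A → (B → ℝ) → ℝ
  continuous_F : ∀ z y, Continuous fun x => F x z y
  isCompact_H : IsCompact H
  continuousOn_r : ContinuousOn (fun p : A × (B → ℝ) => r p.1 p.2) (Set.univ ×ˢ stdSimplex ℝ B)
  convexOn_r : ∀ x, ConvexOn ℝ (stdSimplex ℝ B) (r x)
  lipschitz_r : ∀ x, ∀ y ∈ stdSimplex ℝ B, ∀ y' ∈ stdSimplex ℝ B,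
    |r x y - r x y'| ≤ normY (y - y')
  ker_inter_nonempty : ∀ x, ∀ θ ∈ H,
    ((LinearMap.ker (F x θ) : Set (B → ℝ)) ∩ stdSimplex ℝ B).Nonempty
  surjective_F : ∀ x, ∀ θ ∈ H, Function.Surjective (F x θ)
  /-- `𝒵 ∩ 𝒩 = 0`: no nonzero parameter vector acts trivially -/
  eq_zero_of_F : ∀ z, (∀ x y, F x z y = 0) → z = 0

/-- A (Borel measurable) agent policy: a map from finite histories to arms. -/
structure AgentPolicy (A B : Type*) [MeasurableSpace A] [Fintype B] where
  arm : ∀ n : ℕ, (Fin n → A × Outcome B) → A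
  measurable_arm : ∀ n, Measurable (arm n)

/-- A nature policy: a Markov kernel from (finite history, current arm) to outcomes. -/
structure NaturePolicy (A B : Type*) [MeasurableSpace A] [Fintype B] where
  kernel : ∀ n : ℕ, Kernel ((Fin n → A × Outcome B) × A) (Outcome B)
  isMarkovKernel : ∀ n, IsMarkovKernel (kernel n)

/-- The law of the first `n` rounds when an agent policy interacts with a nature policy:
`x_n = φ(x_0 y_0 … x_{n-1} y_{n-1})` and `y_n ∼ ν(x_0 y_0 … x_{n-1} y_{n-1} x_n)`. -/
def law {A B : Type*} [MeasurableSpace A] [Fintype B]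
    (φ : AgentPolicy A B) (ν : NaturePolicy A B) : ∀ n : ℕ, Measure (Fin n → A × Outcome B)
  | 0 => Measure.dirac Fin.elim0
  | n + 1 =>
    ((law φ ν n) ⊗ₘ ((ν.kernel n).comap (fun h => (h, φ.arm n h))
        (measurable_id.prodMk (φ.measurable_arm n)))).map
      (fun p => Fin.snoc (α := fun _ => A × Outcome B) p.1 (φ.arm n p.1, p.2))

/-- The internal state of the IUCB algorithm: confidence set, current optimistic hypothesis, number
of rounds so far in the current cycle, sum of the outcomes of these rounds. -/
structure State (B Z : Type*) where
  conf : Set Z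
  hyp : Z
  tau : ℕ
  sumY : B → ℝ

namespace Bandit

variable {A B Z W : Type*} [TopologicalSpace A] [Fintype B]
  [AddCommGroup Z] [Module ℝ Z] [TopologicalSpace Z]
  [AddCommGroup W] [Module ℝ W] [TopologicalSpace W]

/-- The subspace `K_θ(x) = ker F_{xθ}` of `𝒴`. -/
def K (b : Bandit A B Z W) (θ : Z) (x : A) : Submodule ℝ (B → ℝ) := LinearMap.ker (b.F x θ)

/-- The credal set `κ(K_θ(x))`: distributions on `ΔB` whose mean lies in `K_θ(x) ∩ ΔB`. -/
def credal (b : Bandit A B Z W) (θ : Z) (x : A) : Set (Measure (Outcome B)) :=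
  {ζ | IsProbabilityMeasure ζ ∧
    (∫ y, (y : B → ℝ) ∂ζ) ∈ (b.K θ x : Set (B → ℝ)) ∩ stdSimplex ℝ B}

/-- The lower prevision `ME_θ[r | x]`. -/
def ME (b : Bandit A B Z W) (θ : Z) (x : A) : ℝ :=
  ⨅ ζ : b.credal θ x, ∫ y, b.r x y ∂(ζ : Measure (Outcome B))

/-- The optimal value `max_x ME_θ[r | x] = ME_θ[r | x_θ^*]`. -/
def optME (b : Bandit A B Z W) (θ : Z) : ℝ := ⨆ x, b.ME θ x

/-- The nature policies compatible with the hypothesis `θ`. -/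
def compatible [MeasurableSpace A] (b : Bandit A B Z W) (θ : Z) : Set (NaturePolicy A B) :=
  {ν | ∀ n h x, ν.kernel n (h, x) ∈ b.credal θ x}

/-- The expected total reward of the first `N` rounds. -/
def expReward [MeasurableSpace A] (b : Bandit A B Z W) (φ : AgentPolicy A B)
    (ν : NaturePolicy A B) (N : ℕ) : ℝ :=
  ∑ n : Fin N, ∫ h, b.r (h n).1 (h n).2 ∂(law φ ν N)

/-- The expected regret `N · ME_θ[r | x_θ^*] - inf_ν ∑_{n<N} E[r(x_n, y_n)]`. -/
def ERg [MeasurableSpace A] (b : Bandit A B Z W) (θ : Z) (φ : AgentPolicy A B) (N : ℕ) : EReal :=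
  ((N * b.optME θ : ℝ) : EReal) - ⨅ ν ∈ b.compatible θ, ((b.expReward φ ν N : ℝ) : EReal)

/-- The norm on `𝒲`. -/
def normW (b : Bandit A B Z W) (w : W) : ℝ :=
  ⨆ p : A × b.H, ⨅ y : {y : B → ℝ // b.F p.1 p.2 y = w}, normY (y : B → ℝ)

/-- `(z, w) ↦ (y ↦ F(x, z, y) + μ(y) w)` on `𝒵 ⊕ 𝒲`. -/
def preF (b : Bandit A B Z W) (x : A) : (Z × W) →ₗ[ℝ] (B → ℝ) →ₗ[ℝ] W :=
  (b.F x).comp (LinearMap.fst ℝ Z W) +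
    (LinearMap.smulRightₗ (mu B)).comp (LinearMap.snd ℝ Z W)

/-- The null subspace `𝒩` of `𝒵 ⊕ 𝒲`. -/
def null (b : Bandit A B Z W) : Submodule ℝ (Z × W) := ⨅ x : A, LinearMap.ker (b.preF x)

/-- The extended parameter space `(𝒵 ⊕ 𝒲) / 𝒩`. -/
abbrev Zbar (b : Bandit A B Z W) : Type _ := (Z × W) ⧸ b.null

/-- The extension of `F` to `(𝒵 ⊕ 𝒲) / 𝒩`. -/
def Fbar (b : Bandit A B Z W) (x : A) : b.Zbar →ₗ[ℝ] (B → ℝ) →ₗ[ℝ] W :=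
  b.null.liftQ (b.preF x) (iInf_le _ x)

/-- The operator norm of a linear map `𝒴 → 𝒲`. -/
def opNorm (b : Bandit A B Z W) (L : (B → ℝ) →ₗ[ℝ] W) : ℝ :=
  ⨆ y : {y : B → ℝ // normY y ≤ 1}, b.normW (L y)

/-- The norm on `(𝒵 ⊕ 𝒲) / 𝒩`. -/
def normZ (b : Bandit A B Z W) (z : b.Zbar) : ℝ := ⨆ x : A, b.opNorm (b.Fbar x z)

/-- The embedding of `𝒵` into `(𝒵 ⊕ 𝒲) / 𝒩`. -/
def emb (b : Bandit A B Z W) (z : Z) : b.Zbar := Submodule.Quotient.mk (z, 0)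

/-- The subspace `𝒱(x, y)`, the kernel of `z ↦ Fbar(x, z, y)`. -/
def V (b : Bandit A B Z W) (x : A) (y : B → ℝ) : Submodule ℝ b.Zbar :=
  LinearMap.ker ((b.Fbar x).flip y)

/-- The minimal distance from `θ` to `𝒱(x, y)`. -/
def distV (b : Bandit A B Z W) (θ : Z) (x : A) (y : B → ℝ) : ℝ :=
  ⨅ z : b.V x y, b.normZ (b.emb θ - z)

/-- The parameter `R`. -/
def R (b : Bandit A B Z W) : ℝ := ⨆ θ : b.H, b.normZ (b.emb θ)

/-- The parameter `S`: the least sine of `K_θ(x) ∩ μ⁻¹(1)` relative to `𝒟`. -/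
def S (b : Bandit A B Z W) : ℝ :=
  ⨅ p : A × b.H, sine ((b.K p.2 p.1 : Set (B → ℝ)) ∩ {y | mu B y = 1})

/-- The parameter `C`: the size of the range of the reward function. -/
def C (b : Bandit A B Z W) : ℝ :=
  (⨆ p : A × Outcome B, b.r p.1 p.2) - ⨅ p : A × Outcome B, b.r p.1 p.2

/-- `sel` picks, from each nonempty compact set of hypotheses, one with the largest optimal value. -/
def IsOptimistic (b : Bandit A B Z W) (sel : Set Z → Z) : Prop :=
  ∀ s ⊆ b.H, IsCompact s → s.Nonempty → sel s ∈ s ∧ ∀ θ ∈ s, b.optME θ ≤ b.optME (sel s)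

/-- `xs θ` is an optimal arm for each hypothesis `θ`. -/
def IsOptimalArm (b : Bandit A B Z W) (xs : Z → A) : Prop :=
  ∀ θ ∈ b.H, ∀ x, b.ME θ x ≤ b.ME θ (xs θ)

open Classical in
/-- One round of IUCB: the arm `xs s.hyp` was pulled and the outcome `y` observed. The cycle goes on
while `√τ · max_{θ ∈ conf} d(θ, 𝒱(x, ȳ)) < 2 (D_Z + 1) η`; otherwise the confidence set is cut down
and a new optimistic hypothesis is chosen. -/
def step (b : Bandit A B Z W) (η : ℝ) (sel : Set Z → Z) (xs : Z → A)
    (s : State B Z) (y : B → ℝ) : State B Z :=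
  let τ : ℕ := s.tau + 1
  let sumY' : B → ℝ := s.sumY + y
  let ybar : B → ℝ := (τ : ℝ)⁻¹ • sumY'
  let x : A := xs s.hyp
  if √(τ : ℝ) * (⨆ θ : s.conf, b.distV θ x ybar) < 2 * (Module.finrank ℝ Z + 1) * η then
    { conf := s.conf, hyp := s.hyp, tau := τ, sumY := sumY' }
  else
    let conf' : Set Z := {θ ∈ s.conf | b.distV θ x ybar ≤ η / √(τ : ℝ)}
    { conf := conf', hyp := sel conf', tau := 0, sumY := 0 }

/-- The state of IUCB after observing `n` outcomes. -/
def iucbState (b : Bandit A B Z W) (η : ℝ) (sel : Set Z → Z) (xs : Z → A) :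
    ∀ n : ℕ, (Fin n → Outcome B) → State B Z
  | 0, _ => { conf := b.H, hyp := sel b.H, tau := 0, sumY := 0 }
  | n + 1, y => b.step η sel xs (b.iucbState η sel xs n (fun i => y i.castSucc)) (y (Fin.last n))

/-- `φ` is the policy implemented by IUCB with parameter `η`, for some way of resolving the ties in
the two argmax operations. -/
def IsIUCB [MeasurableSpace A] (b : Bandit A B Z W) (η : ℝ) (φ : AgentPolicy A B) : Prop :=
  ∃ (sel : Set Z → Z) (xs : Z → A), b.IsOptimistic sel ∧ b.IsOptimalArm xs ∧
    ∀ n h, φ.arm n h = xs (b.iucbState η sel xs n (fun i => (h i).2)).hyp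

/-- `D_Z = dim 𝒵`, as a real number. -/
def DZ (_b : Bandit A B Z W) : ℝ := Module.finrank ℝ Z

/-- `D_W = dim 𝒲`, as a real number. -/
def DW (_b : Bandit A B Z W) : ℝ := Module.finrank ℝ W

/-- `|B|`, as a real number. -/
def cardB (_b : Bandit A B Z W) : ℝ := Fintype.card B

/-- The choice of the parameter `η` for the horizon `N`. -/
def etaN (b : Bandit A B Z W) (N : ℕ) : ℝ :=
  b.R * √(2 * (b.DW + 1) * Real.log (b.C * N ^ 3 * b.cardB / (b.DW + 1)))

end Bandit

/-- The constant `γ = 1 / ln (1 - e⁻²)⁻¹`. -/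
def gam : ℝ := 1 / Real.log ((1 - 1 / Real.exp 2)⁻¹)

end ImpreciseBandit

end

/-! Write `D` for `dim 𝒵`. As long as the true `θ` lies in the confidence set, optimism makes the
value of the current hypothesis `θ̂` at least that of `θ`. So the regret of a cycle is at most what
its average outcome `ȳ` earns below `ME_θ̂(x̂)`, times the number of rounds. By convexity and the
Lipschitz property of `r`, this shortfall is at most the distance of `ȳ` to `K_θ̂(x̂) ∩ 𝒟`, which
the sine condition bounds by `2 (S⁻¹ + 1) d(θ̂, 𝒱(x̂, ȳ))` (`distY_K_le`, `sum_regret_le`). Before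
its last round a cycle has not met the stopping rule, so its regret up to there is of order `(S⁻¹ +
1) D η √τ`; the last round costs at most `C`. Cauchy–Schwarz turns the sum over `M` cycles into `√(M
N)`.

Cycles with `d(θ̂, 𝒱) ≤ Δ` cost only `O(Δ)` per round and are not counted. The others are counted by
a determinant potential: the largest `|det|` of a `D`-tuple of vectors that lie in the confidence
set or have norm at most `ε`. When a cycle ends, some `z` in the old set is more than `2D` times as
far from `𝒱` as every survivor. By Cramer's rule, exchanging a suitable member of any admissible
tuple for `z` at least doubles the determinant, so the potential of the new set is at most half that
of the old one (`exists_two_mul_det_le`, `DetBound.succ`). The short vectors keep the potential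
above a multiple of `ε ^ D`, whence `2 ^ M ≤ (R / ε) ^ D` (`exists_detBound`).

The true `θ` is lost only if some average deviates. `d(θ, 𝒱(x, ȳ))` is at most `R` times the
quotient norm of `F_{xθ} ȳ`. The dual ball of that norm is a polytope whose vertices are cut out by
`D_W` of `2|B|` signed constraints, so finitely many functionals control it
(`exists_normY_le_of_vertex_le`, `card_vertexIndex_le`). Along the interaction each of them gives
martingale differences bounded by `1`; Azuma–Hoeffding and a union bound over vertices and windows
of rounds bound the failure probability (`measureReal_deviation_le`,
`distV_le_of_notMem_deviation`).

The rates follow with `δ = 1 / N`: the chosen `η` makes the tail term bounded, and all logarithms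
are absorbed by `log f` (`explicit_le_rate`). -/

set_option linter.unusedSectionVars false

noncomputable section

namespace ImpreciseBandit

/-! ### The norm on `ℝ^B` -/

section NormY

variable {B : Type*} [Fintype B]

theorem mu_apply (y : B → ℝ) : mu B y = ∑ a, y a := by
  simp [mu]

theorem mu_of_mem_stdSimplex {y : B → ℝ} (hy : y ∈ stdSimplex ℝ B) : mu B y = 1 := by
  rw [mu_apply, hy.2]

theorem absConvexHull_stdSimplex_subset :
    absConvexHull ℝ (stdSimplex ℝ B) ⊆ {y | ∑ a, |y a| ≤ 1} := by
  refine absConvexHull_min ?_ ⟨?_, ?_⟩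
  · intro y hy
    simp only [Set.mem_ofPred_eq]
    rw [Finset.sum_congr rfl fun a _ => abs_of_nonneg (hy.1 a), hy.2]
  · rw [balanced_iff_smul_mem]
    intro c hc y hy
    simp only [Set.mem_ofPred_eq, Pi.smul_apply, smul_eq_mul, abs_mul, ← Finset.mul_sum] at hy ⊢
    exact mul_le_one₀ hc (Finset.sum_nonneg fun _ _ => abs_nonneg _) hy
  · intro y hy y' hy' s t hs ht hst
    simp only [Set.mem_ofPred_eq, Pi.add_apply, Pi.smul_apply, smul_eq_mul] at hy hy' ⊢
    calc ∑ a, |s * y a + t * y' a| ≤ ∑ a, (s * |y a| + t * |y' a|) := by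
          refine Finset.sum_le_sum fun a _ => (abs_add_le _ _).trans_eq ?_
          rw [abs_mul, abs_mul, abs_of_nonneg hs, abs_of_nonneg ht]
      _ = s * ∑ a, |y a| + t * ∑ a, |y' a| := by
          rw [Finset.sum_add_distrib, Finset.mul_sum, Finset.mul_sum]
      _ ≤ s * 1 + t * 1 := by gcongr
      _ = 1 := by rw [mul_one, mul_one, hst]

-- Normalised, `y` is the convex combination of the vectors `sign (y a) • e_a` with weights
-- proportional to `|y a|`. This is the half of the identification with the `ℓ¹` norm that bounds
-- the gauge from above.
open Classical Pointwise in
theorem mem_smul_absConvexHull_stdSimplex {y : B → ℝ} (hy : 0 < ∑ a, |y a|) :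
    y ∈ (∑ a, |y a|) • absConvexHull ℝ (stdSimplex ℝ B) := by
  rw [Set.mem_smul_set_iff_inv_smul_mem₀ hy.ne']
  have key : (∑ a, |y a|)⁻¹ • y =
      ∑ a, ((∑ a, |y a|)⁻¹ * |y a|) • ((SignType.sign (y a) : ℝ) • (Pi.single a 1 : B → ℝ)) := by
    ext c
    simp only [Pi.smul_apply, smul_eq_mul, Finset.sum_apply, Pi.single_apply, mul_ite, mul_one,
      mul_zero, Finset.sum_ite_eq, Finset.mem_univ, if_true, mul_assoc, abs_mul_sign]
  rw [key]
  refine (convex_absConvexHull (𝕜 := ℝ)).sum_mem (fun a _ => by positivity) ?_ fun a _ => ?_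
  · rw [← Finset.mul_sum, inv_mul_cancel₀ hy.ne']
  · refine balanced_absConvexHull.smul_mem ?_ (subset_absConvexHull (single_mem_stdSimplex ℝ a))
    rcases lt_trichotomy (y a) 0 with h | h | h <;> simp [h]

theorem normY_eq (y : B → ℝ) : normY y = ∑ a, |y a| := by
  rcases (Finset.sum_nonneg fun a (_ : a ∈ Finset.univ) => abs_nonneg (y a)).eq_or_lt with h | h
  · have : y = 0 := by
      ext a
      have := (Finset.sum_eq_zero_iff_of_nonneg fun a _ => abs_nonneg (y a)).1 h.symm a
        (Finset.mem_univ a)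
      simpa using this
    rw [this]; simp [normY, gauge_zero]
  · refine le_antisymm (gauge_le_of_mem h.le (mem_smul_absConvexHull_stdSimplex h)) ?_
    refine le_csInf ⟨_, h, mem_smul_absConvexHull_stdSimplex h⟩ ?_
    rintro t ⟨ht, z, hz, rfl⟩
    have hz := absConvexHull_stdSimplex_subset hz
    simp only [Set.mem_ofPred_eq, Pi.smul_apply, smul_eq_mul, abs_mul, ← Finset.mul_sum] at hz ⊢
    rw [abs_of_pos ht]
    exact mul_le_of_le_one_right ht.le hz

theorem normY_nonneg (y : B → ℝ) : 0 ≤ normY y := by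
  rw [normY_eq]; positivity

theorem normY_add_le (y z : B → ℝ) : normY (y + z) ≤ normY y + normY z := by
  simp only [normY_eq, ← Finset.sum_add_distrib]
  exact Finset.sum_le_sum fun a _ => abs_add_le _ _

theorem normY_smul (c : ℝ) (y : B → ℝ) : normY (c • y) = |c| * normY y := by
  simp only [normY_eq, Finset.mul_sum, Pi.smul_apply, smul_eq_mul, abs_mul]

theorem normY_neg (y : B → ℝ) : normY (-y) = normY y := by
  simp [normY_eq]

theorem normY_of_mem_stdSimplex {y : B → ℝ} (hy : y ∈ stdSimplex ℝ B) : normY y = 1 := by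
  rw [normY_eq, Finset.sum_congr rfl fun a _ => abs_of_nonneg (hy.1 a), hy.2]

theorem abs_mu_le (y : B → ℝ) : |mu B y| ≤ normY y := by
  rw [mu_apply, normY_eq]
  exact Finset.abs_sum_le_sum_abs _ _

theorem eq_zero_of_normY_eq_zero {y : B → ℝ} (h : normY y = 0) : y = 0 := by
  rw [normY_eq, Finset.sum_eq_zero_iff_of_nonneg fun a _ => abs_nonneg _] at h
  ext a; simpa using h a (Finset.mem_univ a)

/-- The norm on `ℝ^B` as a seminorm. -/
def normYSeminorm (B : Type*) [Fintype B] : Seminorm ℝ (B → ℝ) :=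
  Seminorm.of normY normY_add_le fun c y => by rw [normY_smul, Real.norm_eq_abs]

theorem bddBelow_normY {ι : Type*} (f : ι → B → ℝ) :
    BddBelow (Set.range fun i => normY (f i)) :=
  ⟨0, by rintro _ ⟨i, rfl⟩; exact normY_nonneg _⟩

theorem distY_nonneg (p : B → ℝ) (s : Set (B → ℝ)) : 0 ≤ distY p s :=
  Real.iInf_nonneg fun _ => normY_nonneg _

theorem distY_le {p q : B → ℝ} {s : Set (B → ℝ)} (hq : q ∈ s) : distY p s ≤ normY (p - q) :=
  ciInf_le (bddBelow_normY fun q : s => p - (q : B → ℝ)) ⟨q, hq⟩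

theorem distY_le_add {p q : B → ℝ} {s : Set (B → ℝ)} (hs : s.Nonempty) :
    distY p s ≤ normY (p - q) + distY q s := by
  have := hs.to_subtype
  rw [← sub_le_iff_le_add']
  refine le_ciInf fun t => ?_
  rw [sub_le_iff_le_add']
  refine (distY_le t.2).trans ?_
  rw [← sub_add_sub_cancel p q]
  exact normY_add_le _ _

theorem distY_anti {p : B → ℝ} {s t : Set (B → ℝ)} (hs : s.Nonempty) (hst : s ⊆ t) :
    distY p t ≤ distY p s := by
  have := hs.to_subtype
  exact le_ciInf fun q => distY_le (hst q.2)

theorem sine_nonneg (E : Set (B → ℝ)) : 0 ≤ sine E := by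
  unfold sine
  split_ifs
  · exact zero_le_one
  · refine Real.sInf_nonneg ?_
    rintro _ ⟨p, -, rfl⟩
    exact div_nonneg (distY_nonneg _ _) (distY_nonneg _ _)

theorem sine_le_div {E : Set (B → ℝ)} {p : B → ℝ} (hp : p ∈ E) (hp' : p ∉ stdSimplex ℝ B) :
    sine E ≤ distY p (stdSimplex ℝ B) / distY p (E ∩ stdSimplex ℝ B) := by
  have : ¬ E ⊆ stdSimplex ℝ B := fun h => hp' (h hp)
  rw [sine, if_neg this]
  refine csInf_le ⟨0, ?_⟩ ⟨p, ⟨hp, hp'⟩, rfl⟩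
  rintro _ ⟨p, -, rfl⟩
  exact div_nonneg (distY_nonneg _ _) (distY_nonneg _ _)

/-- The product form also covers points inside the simplex and a vanishing denominator, where the
quotient in `sine` says nothing. -/
theorem sine_mul_distY_le {E : Set (B → ℝ)} {p : B → ℝ} (hp : p ∈ E) :
    sine E * distY p (E ∩ stdSimplex ℝ B) ≤ distY p (stdSimplex ℝ B) := by
  by_cases hp' : p ∈ stdSimplex ℝ B
  · have h0 : distY p (E ∩ stdSimplex ℝ B) ≤ 0 := by
      have := distY_le (p := p) (show p ∈ E ∩ stdSimplex ℝ B from ⟨hp, hp'⟩)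
      simpa [normY_eq] using this
    exact (mul_nonpos_of_nonneg_of_nonpos (sine_nonneg _) h0).trans (distY_nonneg _ _)
  · rcases (distY_nonneg p (E ∩ stdSimplex ℝ B)).eq_or_lt with h | h
    · rw [← h, mul_zero]; exact distY_nonneg _ _
    · exact (le_div_iff₀ h).1 (sine_le_div hp hp')

theorem sine_le_one {E : Set (B → ℝ)} (hE : (E ∩ stdSimplex ℝ B).Nonempty) : sine E ≤ 1 := by
  by_cases h : E ⊆ stdSimplex ℝ B
  · rw [sine, if_pos h]
  · obtain ⟨p, hp, hp'⟩ := Set.not_subset.1 h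
    exact (sine_le_div hp hp').trans
      (div_le_one_of_le₀ (distY_anti hE Set.inter_subset_right) (distY_nonneg _ _))

end NormY

/-! ### Seminorms on finite-dimensional spaces -/

theorem seminorm_le_sum_coord {ι E : Type*} [Fintype ι] [AddCommGroup E] [Module ℝ E]
    (p : Seminorm ℝ E) (e : Module.Basis ι ℝ E) (z : E) :
    p z ≤ ∑ i, |e.repr z i| * p (e i) := by
  conv_lhs => rw [← e.sum_repr z]
  refine (Finset.le_sum_of_subadditive p (map_zero p).le (map_add_le_add p) _ _).trans_eq ?_
  simp [map_smul_eq_mul]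

/-- The norms of the setting are bare functions, unrelated by definition to the given topologies.
Domination by absolute values of coordinates makes them continuous, which is what the compactness
arguments need. -/
theorem continuous_seminorm {E : Type*} [AddCommGroup E] [Module ℝ E] [FiniteDimensional ℝ E]
    [TopologicalSpace E] [IsTopologicalAddGroup E] [ContinuousSMul ℝ E] [T2Space E]
    (p : Seminorm ℝ E) : Continuous p := by
  let e := Module.finBasis ℝ E
  refine Seminorm.continuous_of_continuousAt_zero ?_
  have hc : Continuous fun z : E => ∑ i, |e.repr z i| * p (e i) := by
    refine continuous_finsetSum _ fun i _ => Continuous.mul ?_ continuous_const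
    exact (LinearMap.continuous_of_finiteDimensional (e.coord i)).abs
  have h0 := hc.tendsto 0
  simp only [map_zero, Finsupp.coe_zero, Pi.zero_apply, abs_zero, zero_mul,
    Finset.sum_const_zero] at h0
  rw [ContinuousAt, map_zero]
  exact squeeze_zero (fun z => apply_nonneg p z) (seminorm_le_sum_coord p e) h0

/-! ### Quotient norms of linear maps on `ℝ^B` -/

section QuotNorm

variable {B W : Type*} [Fintype B] [AddCommGroup W] [Module ℝ W]

/-- The quotient norm on the range of a linear map `L` on `ℝ^B`. -/
def quotNorm (L : (B → ℝ) →ₗ[ℝ] W) (w : W) : ℝ :=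
  ⨅ y : {y : B → ℝ // L y = w}, normY (y : B → ℝ)

theorem quotNorm_nonneg (L : (B → ℝ) →ₗ[ℝ] W) (w : W) : 0 ≤ quotNorm L w :=
  Real.iInf_nonneg fun _ => normY_nonneg _

theorem quotNorm_le {L : (B → ℝ) →ₗ[ℝ] W} {w : W} {y : B → ℝ} (h : L y = w) :
    quotNorm L w ≤ normY y :=
  ciInf_le (bddBelow_normY fun y : {y : B → ℝ // L y = w} => (y : B → ℝ)) ⟨y, h⟩

theorem le_quotNorm {L : (B → ℝ) →ₗ[ℝ] W} (hL : Function.Surjective L) {w : W} {c : ℝ}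
    (h : ∀ y, L y = w → c ≤ normY y) : c ≤ quotNorm L w := by
  obtain ⟨y, hy⟩ := hL w
  have : Nonempty {y : B → ℝ // L y = w} := ⟨⟨y, hy⟩⟩
  exact le_ciInf fun y => h y y.2

theorem quotNorm_add_le {L : (B → ℝ) →ₗ[ℝ] W} (hL : Function.Surjective L) (w w' : W) :
    quotNorm L (w + w') ≤ quotNorm L w + quotNorm L w' := by
  obtain ⟨y, hy⟩ := hL w
  obtain ⟨y', hy'⟩ := hL w'
  have : Nonempty {y : B → ℝ // L y = w} := ⟨⟨y, hy⟩⟩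
  have : Nonempty {y : B → ℝ // L y = w'} := ⟨⟨y', hy'⟩⟩
  refine le_ciInf_add_ciInf fun y y' => ?_
  refine (quotNorm_le (y := (y : B → ℝ) + (y' : B → ℝ)) ?_).trans (normY_add_le _ _)
  rw [map_add, y.2, y'.2]

theorem quotNorm_smul_le {L : (B → ℝ) →ₗ[ℝ] W} (hL : Function.Surjective L) (c : ℝ) (w : W) :
    quotNorm L (c • w) ≤ |c| * quotNorm L w := by
  obtain ⟨y, hy⟩ := hL w
  have : Nonempty {y : B → ℝ // L y = w} := ⟨⟨y, hy⟩⟩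
  rw [quotNorm, quotNorm, Real.mul_iInf_of_nonneg (abs_nonneg c)]
  refine le_ciInf fun y => ?_
  rw [← normY_smul]
  exact quotNorm_le (by rw [map_smul, y.2])

theorem quotNorm_zero {L : (B → ℝ) →ₗ[ℝ] W} : quotNorm L 0 = 0 :=
  le_antisymm ((quotNorm_le (map_zero L)).trans_eq (by simp [normY_eq])) (quotNorm_nonneg _ _)

/-- If `M Mᵀ v = 0`, then `|Mᵀ v|² = 0`, so `v` is orthogonal to the range of `M`, which is
everything. -/
theorem isUnit_det_self_mul_transpose {m n : Type*} [Fintype m] [DecidableEq m] [Fintype n]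
    {M : Matrix m n ℝ} (hM : Function.Surjective M.mulVec) :
    IsUnit (M * M.transpose).det := by
  rw [isUnit_iff_ne_zero]
  intro h
  obtain ⟨v, hv, h0⟩ := Matrix.exists_mulVec_eq_zero_iff.2 h
  have h1 : (M.transpose.mulVec v) ⬝ᵥ (M.transpose.mulVec v) = 0 := by
    rw [Matrix.dotProduct_mulVec, ← Matrix.mulVec_transpose, Matrix.transpose_transpose,
      Matrix.mulVec_mulVec, h0, zero_dotProduct]
  have h2 := dotProduct_self_eq_zero.1 h1
  obtain ⟨y, hy⟩ := hM v
  refine hv (dotProduct_self_eq_zero.1 ?_)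
  conv_lhs => rw [← hy]
  rw [dotProduct_comm, Matrix.dotProduct_mulVec, ← Matrix.mulVec_transpose, hy, h2,
    zero_dotProduct]

end QuotNorm

namespace Bandit

variable {A B Z W : Type*} [TopologicalSpace A] [Fintype B]
  [AddCommGroup Z] [Module ℝ Z] [FiniteDimensional ℝ Z]
  [TopologicalSpace Z] [IsTopologicalAddGroup Z] [ContinuousSMul ℝ Z] [T2Space Z]
  [AddCommGroup W] [Module ℝ W] [FiniteDimensional ℝ W]
  [TopologicalSpace W] [IsTopologicalAddGroup W] [ContinuousSMul ℝ W] [T2Space W]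

/-! ### The norm on `𝒲` -/

theorem continuous_F_uncurry (b : Bandit A B Z W) (y : B → ℝ) :
    Continuous fun p : A × Z => b.F p.1 p.2 y := by
  let e := Module.finBasis ℝ Z
  have : (fun p : A × Z => b.F p.1 p.2 y) =
      fun p => ∑ i, e.coord i p.2 • b.F p.1 (e i) y := by
    ext p
    conv_lhs => rw [← e.sum_repr p.2]
    simp only [map_sum, map_smul, LinearMap.sum_apply, LinearMap.smul_apply,
      Module.Basis.coord_apply]
  rw [this]
  refine continuous_finsetSum _ fun i _ => Continuous.smul ?_ ?_
  · exact (LinearMap.continuous_of_finiteDimensional (e.coord i)).comp continuous_snd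
  · exact (b.continuous_F (e i) y).comp continuous_fst

variable [CompactSpace A]

-- The right inverse `Mᵀ (M Mᵀ)⁻¹` of `F_{xθ}` depends continuously on `(x, θ)`, so `w` has
-- preimages of bounded norm over the compact `A × ℋ`. Without this bound the supremum in `normW`
-- would be a default value.
open Classical in
theorem bddAbove_quotNorm (b : Bandit A B Z W) (w : W) :
    BddAbove (Set.range fun p : A × b.H => quotNorm (b.F p.1 p.2) w) := by
  have := isCompact_iff_compactSpace.1 b.isCompact_H
  let e := Module.finBasis ℝ W
  let M : A × b.H → Matrix (Fin (Module.finrank ℝ W)) B ℝ :=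
    fun p => LinearMap.toMatrix (Pi.basisFun ℝ B) e (b.F p.1 p.2)
  have hM : ∀ p y, (M p).mulVec y = e.repr (b.F p.1 p.2 y) := by
    intro p y
    have := LinearMap.toMatrix_mulVec_repr (Pi.basisFun ℝ B) e (b.F p.1 p.2) y
    rw [← this]
    congr 1
  have hMc : Continuous M := by
    refine continuous_matrix fun i a => ?_
    simp only [M, LinearMap.toMatrix_apply]
    refine (LinearMap.continuous_of_finiteDimensional (e.coord i)).comp ?_
    exact (b.continuous_F_uncurry _).comp
      (continuous_fst.prodMk (continuous_subtype_val.comp continuous_snd))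
  have hu : ∀ p, IsUnit (M p * (M p).transpose).det := by
    intro p
    refine isUnit_det_self_mul_transpose fun v => ?_
    obtain ⟨y, hy⟩ := b.surjective_F p.1 p.2 p.2.2 (e.equivFun.symm v)
    refine ⟨y, ?_⟩
    rw [hM, hy]
    exact e.equivFun.apply_symm_apply v
  let g : A × b.H → B → ℝ := fun p =>
    (M p).transpose.mulVec ((M p * (M p).transpose)⁻¹.mulVec (e.repr w))
  have hg : ∀ p, b.F p.1 p.2 (g p) = w := by
    intro p
    apply e.equivFun.injective
    change (e.repr (b.F p.1 p.2 (g p)) : _ → ℝ) = e.repr w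
    rw [← hM, Matrix.mulVec_mulVec, Matrix.mulVec_mulVec,
      Matrix.mul_nonsing_inv _ (hu p), Matrix.one_mulVec]
  have hgc : Continuous g := by
    refine hMc.matrix_transpose.matrix_mulVec (Continuous.matrix_mulVec ?_ continuous_const)
    have h2 : Continuous fun p => M p * (M p).transpose := hMc.matrix_mul hMc.matrix_transpose
    simp only [Matrix.inv_def, Ring.inverse_eq_inv']
    exact (h2.matrix_det.inv₀ fun p => (hu p).ne_zero).smul h2.matrix_adjugate
  have hnc : Continuous fun p => normY (g p) :=
    (continuous_seminorm (normYSeminorm B)).comp hgc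
  obtain ⟨c, hc⟩ := (isCompact_range hnc).bddAbove
  refine ⟨c, ?_⟩
  rintro _ ⟨p, rfl⟩
  exact (quotNorm_le (hg p)).trans (hc ⟨p, rfl⟩)

theorem quotNorm_le_normW (b : Bandit A B Z W) (x : A) {θ : Z} (hθ : θ ∈ b.H) (w : W) :
    quotNorm (b.F x θ) w ≤ b.normW w :=
  le_ciSup (b.bddAbove_quotNorm w) (x, ⟨θ, hθ⟩)

theorem normW_nonneg (b : Bandit A B Z W) (w : W) : 0 ≤ b.normW w :=
  Real.iSup_nonneg fun p => quotNorm_nonneg (b.F p.1 p.2) w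

theorem normW_le (b : Bandit A B Z W) {w : W} {c : ℝ} (hc : 0 ≤ c)
    (h : ∀ x, ∀ θ ∈ b.H, quotNorm (b.F x θ) w ≤ c) : b.normW w ≤ c :=
  Real.iSup_le (fun p => h p.1 p.2 p.2.2) hc

/-- The norm on `𝒲` as a seminorm. -/
def normWSeminorm (b : Bandit A B Z W) : Seminorm ℝ W :=
  Seminorm.ofSMulLE b.normW
    (le_antisymm (b.normW_le le_rfl fun _ _ _ => quotNorm_zero.le) (b.normW_nonneg 0))
    (fun w w' => b.normW_le (add_nonneg (b.normW_nonneg _) (b.normW_nonneg _)) fun x θ hθ =>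
      (quotNorm_add_le (b.surjective_F x θ hθ) w w').trans
        (add_le_add (b.quotNorm_le_normW x hθ w) (b.quotNorm_le_normW x hθ w')))
    (fun c w => b.normW_le (mul_nonneg (norm_nonneg _) (b.normW_nonneg _)) fun x θ hθ =>
      (quotNorm_smul_le (b.surjective_F x θ hθ) c w).trans
        (mul_le_mul_of_nonneg_left (b.quotNorm_le_normW x hθ w) (abs_nonneg c)))

theorem normWSeminorm_apply (b : Bandit A B Z W) (w : W) : b.normWSeminorm w = b.normW w := rfl

theorem eq_zero_of_normW_eq_zero (b : Bandit A B Z W) [Nonempty A] (hH : b.H.Nonempty) {w : W}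
    (h : b.normW w = 0) : w = 0 := by
  obtain ⟨θ, hθ⟩ := hH
  obtain ⟨x⟩ := ‹Nonempty A›
  have h0 : quotNorm (b.F x θ) w ≤ 0 := h ▸ b.quotNorm_le_normW x hθ w
  by_contra hw
  -- a bounded functional of the coordinates separates `w` from `0`
  let e := Module.finBasis ℝ W
  obtain ⟨i, hi⟩ : ∃ i, e.coord i w ≠ 0 := by
    by_contra! hcon
    exact hw (e.ext_elem fun i => by simpa using hcon i)
  classical
  let f : (B → ℝ) →ₗ[ℝ] ℝ := (e.coord i).comp (b.F x θ)
  let p : Seminorm ℝ (B → ℝ) := (normSeminorm ℝ ℝ).comp f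
  set c : ℝ := ∑ a, p (Pi.basisFun ℝ B a) with hcdef
  have hc : 0 ≤ c := Finset.sum_nonneg fun a _ => apply_nonneg p _
  have hp : ∀ y, |f y| ≤ c * normY y := by
    intro y
    refine (seminorm_le_sum_coord p (Pi.basisFun ℝ B) y).trans ?_
    rw [normY_eq, Finset.mul_sum]
    refine Finset.sum_le_sum fun a _ => ?_
    rw [mul_comm]
    refine mul_le_mul ?_ (by simp) (abs_nonneg _) hc
    exact Finset.single_le_sum (f := fun a => p (Pi.basisFun ℝ B a))
      (fun a _ => apply_nonneg p _) (Finset.mem_univ a)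
  have h1 : |e.coord i w| / (c + 1) ≤ quotNorm (b.F x θ) w := by
    refine le_quotNorm (b.surjective_F x θ hθ) fun y hy => ?_
    rw [div_le_iff₀ (by positivity)]
    have := hp y
    simp only [f, LinearMap.comp_apply, hy] at this
    nlinarith [normY_nonneg y]
  have : 0 < |e.coord i w| / (c + 1) := div_pos (abs_pos.2 hi) (by positivity)
  linarith

/-! ### The operator norm and the norm on the extended parameter space -/

open Classical in
theorem normW_apply_le_sum (b : Bandit A B Z W) (L : (B → ℝ) →ₗ[ℝ] W) {y : B → ℝ}
    (hy : normY y ≤ 1) : b.normW (L y) ≤ ∑ a, b.normW (L (Pi.single a 1)) := by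
  refine (seminorm_le_sum_coord (b.normWSeminorm.comp L) (Pi.basisFun ℝ B) y).trans ?_
  refine Finset.sum_le_sum fun a _ => ?_
  have h1 : |y a| ≤ 1 := by
    refine le_trans ?_ hy
    rw [normY_eq]
    exact Finset.single_le_sum (f := fun a => |y a|) (fun a _ => abs_nonneg _) (Finset.mem_univ a)
  simp only [Pi.basisFun_repr, Seminorm.comp_apply, Pi.basisFun_apply, normWSeminorm_apply]
  exact mul_le_of_le_one_left (b.normW_nonneg _) h1

open Classical in
theorem opNorm_le_sum (b : Bandit A B Z W) (L : (B → ℝ) →ₗ[ℝ] W) :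
    b.opNorm L ≤ ∑ a, b.normW (L (Pi.single a 1)) :=
  Real.iSup_le (fun y => b.normW_apply_le_sum L y.2)
    (Finset.sum_nonneg fun _ _ => b.normW_nonneg _)

theorem opNorm_nonneg (b : Bandit A B Z W) (L : (B → ℝ) →ₗ[ℝ] W) : 0 ≤ b.opNorm L :=
  Real.iSup_nonneg fun _ => b.normW_nonneg _

theorem normW_le_opNorm (b : Bandit A B Z W) (L : (B → ℝ) →ₗ[ℝ] W) {y : B → ℝ}
    (hy : normY y ≤ 1) : b.normW (L y) ≤ b.opNorm L := by
  classical
  refine le_ciSup (f := fun y : {y : B → ℝ // normY y ≤ 1} => b.normW (L y))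
    ⟨∑ a, b.normW (L (Pi.single a 1)), ?_⟩ ⟨y, hy⟩
  rintro _ ⟨y, rfl⟩
  exact b.normW_apply_le_sum L y.2

theorem normW_apply_le (b : Bandit A B Z W) (L : (B → ℝ) →ₗ[ℝ] W) (y : B → ℝ) :
    b.normW (L y) ≤ b.opNorm L * normY y := by
  rcases (normY_nonneg y).eq_or_lt with h | h
  · rw [eq_zero_of_normY_eq_zero h.symm, map_zero]
    exact (map_zero b.normWSeminorm).le.trans (mul_nonneg (b.opNorm_nonneg L) (normY_nonneg _))
  · have h1 := b.normW_le_opNorm L (y := (normY y)⁻¹ • y) (by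
      rw [normY_smul, abs_of_pos (inv_pos.2 h), inv_mul_cancel₀ h.ne'])
    rw [map_smul, ← normWSeminorm_apply, map_smul_eq_mul, Real.norm_eq_abs,
      abs_of_pos (inv_pos.2 h), inv_mul_le_iff₀ h, mul_comm] at h1
    exact h1

theorem opNorm_le (b : Bandit A B Z W) {L : (B → ℝ) →ₗ[ℝ] W} {c : ℝ} (hc : 0 ≤ c)
    (h : ∀ y, normY y ≤ 1 → b.normW (L y) ≤ c) : b.opNorm L ≤ c :=
  Real.iSup_le (fun y => h y y.2) hc

theorem Fbar_mk (b : Bandit A B Z W) (x : A) (z : Z) (w : W) (y : B → ℝ) :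
    b.Fbar x (Submodule.Quotient.mk (z, w)) y = b.F x z y + mu B y • w := rfl

theorem Fbar_emb (b : Bandit A B Z W) (x : A) (z : Z) : b.Fbar x (b.emb z) = b.F x z := by
  ext1 y
  rw [emb, Fbar_mk, smul_zero, add_zero]

theorem bddAbove_opNorm (b : Bandit A B Z W) (z : b.Zbar) :
    BddAbove (Set.range fun x : A => b.opNorm (b.Fbar x z)) := by
  classical
  obtain ⟨⟨z, w⟩, rfl⟩ := Submodule.Quotient.mk_surjective _ z
  have hc : Continuous fun x => ∑ a, b.normW (b.F x z (Pi.single a 1) +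
      mu B (Pi.single a 1) • w) := by
    refine continuous_finsetSum _ fun a _ => ?_
    exact (continuous_seminorm b.normWSeminorm).comp
      ((b.continuous_F z _).add continuous_const)
  obtain ⟨c, hc⟩ := (isCompact_range hc).bddAbove
  refine ⟨c, ?_⟩
  rintro _ ⟨x, rfl⟩
  exact (b.opNorm_le_sum _).trans (hc ⟨x, rfl⟩)

theorem opNorm_le_normZ (b : Bandit A B Z W) (x : A) (z : b.Zbar) :
    b.opNorm (b.Fbar x z) ≤ b.normZ z :=
  le_ciSup (b.bddAbove_opNorm z) x

theorem normZ_nonneg (b : Bandit A B Z W) (z : b.Zbar) : 0 ≤ b.normZ z :=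
  Real.iSup_nonneg fun _ => b.opNorm_nonneg _

theorem normW_Fbar_le (b : Bandit A B Z W) (x : A) (z : b.Zbar) (y : B → ℝ) :
    b.normW (b.Fbar x z y) ≤ b.normZ z * normY y :=
  (b.normW_apply_le _ y).trans
    (mul_le_mul_of_nonneg_right (b.opNorm_le_normZ x z) (normY_nonneg y))

theorem normZ_le (b : Bandit A B Z W) {z : b.Zbar} {c : ℝ} (hc : 0 ≤ c)
    (h : ∀ x y, normY y ≤ 1 → b.normW (b.Fbar x z y) ≤ c) : b.normZ z ≤ c :=
  Real.iSup_le (fun x => b.opNorm_le hc (h x)) hc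

/-- The norm on the extended parameter space as a seminorm. -/
def normZSeminorm (b : Bandit A B Z W) : Seminorm ℝ b.Zbar :=
  Seminorm.ofSMulLE b.normZ
    (le_antisymm (b.normZ_le le_rfl fun x y _ => by
      rw [map_zero, LinearMap.zero_apply]; exact (map_zero b.normWSeminorm).le)
      (b.normZ_nonneg 0))
    (fun z z' => b.normZ_le (add_nonneg (b.normZ_nonneg _) (b.normZ_nonneg _)) fun x y hy => by
      rw [map_add, LinearMap.add_apply]
      refine (map_add_le_add b.normWSeminorm _ _).trans (add_le_add ?_ ?_)
      · exact (b.normW_le_opNorm _ hy).trans (b.opNorm_le_normZ x z)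
      · exact (b.normW_le_opNorm _ hy).trans (b.opNorm_le_normZ x z'))
    (fun c z => b.normZ_le (mul_nonneg (norm_nonneg _) (b.normZ_nonneg _)) fun x y hy => by
      rw [map_smul, LinearMap.smul_apply, ← normWSeminorm_apply, map_smul_eq_mul]
      exact mul_le_mul_of_nonneg_left
        ((b.normW_le_opNorm _ hy).trans (b.opNorm_le_normZ x z)) (norm_nonneg c))

/-- The embedding of `𝒵` into the extended parameter space as a linear map. -/
def embLinear (b : Bandit A B Z W) : Z →ₗ[ℝ] b.Zbar := b.null.mkQ.comp (LinearMap.inl ℝ Z W)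

theorem embLinear_apply (b : Bandit A B Z W) (z : Z) : b.embLinear z = b.emb z := rfl

/-- The norm on `𝒵` inherited from the extended parameter space. -/
def paramNorm (b : Bandit A B Z W) : Seminorm ℝ Z := b.normZSeminorm.comp b.embLinear

theorem paramNorm_apply (b : Bandit A B Z W) (z : Z) : b.paramNorm z = b.normZ (b.emb z) := rfl

/-- Definiteness on `𝒵` is where the absence of trivially acting parameters enters; the determinant
argument needs a genuine norm, with a compact unit ball. -/
theorem eq_zero_of_paramNorm_eq_zero (b : Bandit A B Z W) [Nonempty A] (hH : b.H.Nonempty)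
    {z : Z} (h : b.paramNorm z = 0) : z = 0 := by
  refine b.eq_zero_of_F z fun x y => b.eq_zero_of_normW_eq_zero hH ?_
  refine le_antisymm ?_ (b.normW_nonneg _)
  have := b.normW_Fbar_le x (b.emb z) y
  rwa [Fbar_emb, ← paramNorm_apply, h, zero_mul] at this

theorem paramNorm_le_R (b : Bandit A B Z W) {θ : Z} (hθ : θ ∈ b.H) : b.paramNorm θ ≤ b.R := by
  refine le_ciSup (f := fun θ : b.H => b.normZ (b.emb θ)) ?_ ⟨θ, hθ⟩
  have := isCompact_iff_compactSpace.1 b.isCompact_H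
  exact (isCompact_range
    ((continuous_seminorm b.paramNorm).comp continuous_subtype_val)).bddAbove

theorem R_nonneg (b : Bandit A B Z W) : 0 ≤ b.R := Real.iSup_nonneg fun _ => b.normZ_nonneg _

theorem normW_F_le (b : Bandit A B Z W) (x : A) {θ : Z} (hθ : θ ∈ b.H) (y : B → ℝ) :
    b.normW (b.F x θ y) ≤ b.R * normY y := by
  rw [← Fbar_emb]
  exact (b.normW_Fbar_le x _ y).trans
    (mul_le_mul_of_nonneg_right (b.paramNorm_le_R hθ) (normY_nonneg y))

/-- Every preimage `y` of `w` under `F_{xθ}` satisfies `‖w‖ ≤ R ‖y‖`. Taking the least such `y`,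
whose norm is at most `‖w‖`, gives `‖w‖ ≤ R ‖w‖`. -/
theorem one_le_R (b : Bandit A B Z W) [Nonempty A] [Nontrivial W] {θ : Z} (hθ : θ ∈ b.H) :
    1 ≤ b.R := by
  obtain ⟨w, hw⟩ := exists_ne (0 : W)
  obtain ⟨x⟩ := id ‹Nonempty A›
  have hpos : 0 < b.normW w :=
    (b.normW_nonneg w).lt_of_ne fun h => hw (b.eq_zero_of_normW_eq_zero ⟨θ, hθ⟩ h.symm)
  have hR : ∀ y, b.F x θ y = w → b.normW w ≤ b.R * normY y := fun y hy => by
    rw [← hy]; exact b.normW_F_le x hθ y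
  have hR0 : 0 < b.R := by
    obtain ⟨y, hy⟩ := b.surjective_F x θ hθ w
    refine b.R_nonneg.lt_of_ne fun h => ?_
    have := hR y hy
    rw [← h, zero_mul] at this
    linarith
  have h1 : b.normW w / b.R ≤ quotNorm (b.F x θ) w :=
    le_quotNorm (b.surjective_F x θ hθ) fun y hy => (div_le_iff₀' hR0).2 (hR y hy)
  have h2 := h1.trans (b.quotNorm_le_normW x hθ w)
  rw [div_le_iff₀ hR0] at h2
  exact (le_mul_iff_one_le_right hpos).1 h2

/-! ### The distance to `𝒱(x, y)` -/

theorem mem_V (b : Bandit A B Z W) {x : A} {y : B → ℝ} {z : b.Zbar} :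
    z ∈ b.V x y ↔ b.Fbar x z y = 0 := Iff.rfl

theorem distV_nonneg (b : Bandit A B Z W) (θ : Z) (x : A) (y : B → ℝ) : 0 ≤ b.distV θ x y :=
  Real.iInf_nonneg fun _ => b.normZ_nonneg _

theorem distV_le (b : Bandit A B Z W) {θ : Z} {x : A} {y : B → ℝ} {z : b.Zbar}
    (hz : z ∈ b.V x y) : b.distV θ x y ≤ b.normZ (b.emb θ - z) :=
  ciInf_le (f := fun z : b.V x y => b.normZ (b.emb θ - z))
    ⟨0, by rintro _ ⟨z, rfl⟩; exact b.normZ_nonneg _⟩ ⟨z, hz⟩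

theorem le_distV (b : Bandit A B Z W) {θ : Z} {x : A} {y : B → ℝ} {c : ℝ}
    (h : ∀ z ∈ b.V x y, c ≤ b.normZ (b.emb θ - z)) : c ≤ b.distV θ x y :=
  le_ciInf fun z => h z z.2

theorem distV_le_paramNorm (b : Bandit A B Z W) (θ : Z) (x : A) (y : B → ℝ) :
    b.distV θ x y ≤ b.paramNorm θ :=
  (b.distV_le (Submodule.zero_mem _)).trans_eq (by rw [sub_zero, paramNorm_apply])

/-- The distance to `𝒱(x, y)` as a seminorm on `𝒵`. -/
def distVSeminorm (b : Bandit A B Z W) (x : A) (y : B → ℝ) : Seminorm ℝ Z :=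
  Seminorm.ofSMulLE (fun θ => b.distV θ x y)
    (le_antisymm ((b.distV_le_paramNorm 0 x y).trans_eq (map_zero _)) (b.distV_nonneg 0 x y))
    (fun θ θ' => le_ciInf_add_ciInf fun z z' => by
      refine (b.distV_le (add_mem z.2 z'.2)).trans ?_
      rw [← embLinear_apply, map_add, add_sub_add_comm]
      exact map_add_le_add b.normZSeminorm _ _)
    (fun c θ => by
      rw [distV, distV, Real.mul_iInf_of_nonneg (norm_nonneg c)]
      refine le_ciInf fun z => ?_
      refine (b.distV_le (Submodule.smul_mem _ c z.2)).trans_eq ?_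
      rw [← embLinear_apply, map_smul, ← smul_sub]
      exact map_smul_eq_mul b.normZSeminorm c _)

theorem distVSeminorm_apply (b : Bandit A B Z W) (x : A) (y : B → ℝ) (θ : Z) :
    b.distVSeminorm x y θ = b.distV θ x y := rfl

/-- This is what the summand `𝒲` of the extended parameter space is for: subtracting `(0, F_{xθ} y)`
moves `θ` into `𝒱(x, y)`, and the norm of that vector is at most `‖F_{xθ} y‖` because `|μ| ≤ 1` on
the unit ball. -/
theorem distV_le_normW (b : Bandit A B Z W) (θ : Z) (x : A) {y : B → ℝ} (hy : mu B y = 1) :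
    b.distV θ x y ≤ b.normW (b.F x θ y) := by
  set w := b.F x θ y with hw
  let u : b.Zbar := Submodule.Quotient.mk (0, w)
  have hmem : b.emb θ - u ∈ b.V x y := by
    rw [mem_V, map_sub, LinearMap.sub_apply, Fbar_emb, Fbar_mk, map_zero, LinearMap.zero_apply,
      zero_add, hy, one_smul, ← hw, sub_self]
  refine (b.distV_le hmem).trans ?_
  rw [sub_sub_cancel]
  refine b.normZ_le (b.normW_nonneg w) fun x' y' hy' => ?_
  rw [Fbar_mk, map_zero, LinearMap.zero_apply, zero_add, ← normWSeminorm_apply, map_smul_eq_mul]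
  exact mul_le_of_le_one_left (b.normW_nonneg w) ((abs_mu_le y').trans hy')

/-- Evaluation at `y` is a contraction in the parameter and vanishes on `𝒱(x, y)`. For `y` in the
simplex the two bounds together are an equality. -/
theorem normW_le_distV (b : Bandit A B Z W) (θ : Z) (x : A) {y : B → ℝ} (hy : normY y ≤ 1) :
    b.normW (b.F x θ y) ≤ b.distV θ x y := by
  refine b.le_distV fun z hz => ?_
  have : b.F x θ y = b.Fbar x (b.emb θ - z) y := by
    rw [map_sub, LinearMap.sub_apply, Fbar_emb, (b.mem_V).1 hz, sub_zero]
  rw [this]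
  exact (b.normW_Fbar_le x _ y).trans (mul_le_of_le_one_right (b.normZ_nonneg _) hy)

theorem S_le_sine (b : Bandit A B Z W) (x : A) {θ : Z} (hθ : θ ∈ b.H) :
    b.S ≤ sine ((b.K θ x : Set (B → ℝ)) ∩ {y | mu B y = 1}) :=
  ciInf_le (f := fun p : A × b.H => sine ((b.K p.2 p.1 : Set (B → ℝ)) ∩ {y | mu B y = 1}))
    ⟨0, by rintro _ ⟨p, rfl⟩; exact sine_nonneg _⟩ (x, ⟨θ, hθ⟩)

theorem K_inter_eq (b : Bandit A B Z W) (x : A) (θ : Z) :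
    ((b.K θ x : Set (B → ℝ)) ∩ {y | mu B y = 1}) ∩ stdSimplex ℝ B =
      (b.K θ x : Set (B → ℝ)) ∩ stdSimplex ℝ B := by
  ext y
  constructor
  · rintro ⟨⟨h, -⟩, h'⟩; exact ⟨h, h'⟩
  · rintro ⟨h, h'⟩; exact ⟨⟨h, mu_of_mem_stdSimplex h'⟩, h'⟩

theorem S_le_one (b : Bandit A B Z W) [Nonempty A] {θ : Z} (hθ : θ ∈ b.H) : b.S ≤ 1 := by
  obtain ⟨x⟩ := ‹Nonempty A›
  refine (b.S_le_sine x hθ).trans (sine_le_one ?_)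
  rw [K_inter_eq]
  exact b.ker_inter_nonempty x θ hθ

/-- The distance of an outcome to `K_θ(x) ∩ 𝒟` is controlled by the distance of `θ` to `𝒱(x, y)`. -/
theorem distY_K_le (b : Bandit A B Z W) (hS : 0 < b.S) (x : A) {θ : Z} (hθ : θ ∈ b.H)
    {y : B → ℝ} (hy : y ∈ stdSimplex ℝ B) :
    distY y ((b.K θ x : Set (B → ℝ)) ∩ stdSimplex ℝ B) ≤
      2 * (b.S⁻¹ + 1) * b.distV θ x y := by
  have hne := b.ker_inter_nonempty x θ hθ
  have hc : 0 < 2 * (b.S⁻¹ + 1) := by positivity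
  rw [← div_le_iff₀' hc]
  refine le_trans ?_ (b.normW_le_distV θ x (normY_of_mem_stdSimplex hy).le)
  refine le_trans ?_ (b.quotNorm_le_normW x hθ _)
  refine le_quotNorm (b.surjective_F x θ hθ) fun v hv => ?_
  rw [div_le_iff₀' hc]
  obtain ⟨q, hqK, hq⟩ := hne
  have hqK' : b.F x θ q = 0 := hqK
  -- `y - v` lies in the kernel but has mass `1 - μ(v)`; adding `μ(v)` times a kernel point `q` of
  -- the simplex restores mass `1`, at the price of doubling the bound on the displacement.
  set p : B → ℝ := y - v + mu B v • q with hp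
  have hpE : p ∈ (b.K θ x : Set (B → ℝ)) ∩ {y | mu B y = 1} := by
    constructor
    · change b.F x θ p = 0
      rw [hp, map_add, map_sub, map_smul, hv, hqK', sub_self, smul_zero, add_zero]
    · change mu B p = 1
      rw [hp, map_add, map_sub, map_smul, mu_of_mem_stdSimplex hy, mu_of_mem_stdSimplex hq,
        smul_eq_mul, mul_one, sub_add_cancel]
  have hyp : normY (y - p) ≤ 2 * normY v := by
    have : y - p = v + (-mu B v) • q := by rw [hp, neg_smul]; abel
    rw [this]
    refine (normY_add_le _ _).trans ?_
    rw [normY_smul, normY_of_mem_stdSimplex hq, abs_neg, mul_one, two_mul]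
    exact add_le_add_right (abs_mu_le v) _
  have h1 : b.S * distY p ((b.K θ x : Set (B → ℝ)) ∩ stdSimplex ℝ B) ≤ normY (y - p) := by
    have h2 := sine_mul_distY_le hpE
    rw [K_inter_eq] at h2
    refine (mul_le_mul_of_nonneg_right (b.S_le_sine x hθ) (distY_nonneg _ _)).trans (h2.trans ?_)
    rw [← normY_neg, neg_sub]
    exact distY_le hy
  have h3 : distY p ((b.K θ x : Set (B → ℝ)) ∩ stdSimplex ℝ B) ≤ b.S⁻¹ * normY (y - p) := by
    rw [inv_mul_eq_div, le_div_iff₀' hS]; exact h1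
  calc distY y ((b.K θ x : Set (B → ℝ)) ∩ stdSimplex ℝ B)
      ≤ normY (y - p) + b.S⁻¹ * normY (y - p) :=
        (distY_le_add (b.ker_inter_nonempty x θ hθ)).trans (add_le_add_right h3 _)
    _ = (b.S⁻¹ + 1) * normY (y - p) := by ring
    _ ≤ (b.S⁻¹ + 1) * (2 * normY v) := mul_le_mul_of_nonneg_left hyp (by positivity)
    _ = 2 * (b.S⁻¹ + 1) * normY v := by ring

end Bandit

/-! ### The determinant potential -/

section Potential

variable {ι E : Type*} [Fintype ι] [DecidableEq ι] [AddCommGroup E] [Module ℝ E]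

/-- Cramer's rule: the coefficients with respect to `t` are quotients of determinants. -/
theorem det_update_sum (e : Module.Basis ι ℝ E) (t : ι → E) (c : ι → ℝ) (i : ι) :
    e.det (Function.update t i (∑ j, c j • t j)) = c i * e.det t := by
  rw [AlternatingMap.map_update_sum, Finset.sum_eq_single i]
  · rw [AlternatingMap.map_update_smul, Function.update_eq_self, smul_eq_mul]
  · intro j _ hj
    rw [AlternatingMap.map_update_smul, AlternatingMap.map_update_self _ _ hj.symm, smul_zero]
  · simp

/-- If a seminorm is much larger at `θ` than at the members of a tuple, then replacing one of them
by `θ` at least doubles the determinant. -/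
theorem exists_two_mul_det_le [Nonempty ι] (e : Module.Basis ι ℝ E) (ρ : Seminorm ℝ E)
    (t : ι → E) (θ : E) {σ : ℝ} (ht : ∀ i, ρ (t i) ≤ σ)
    (hθ : 2 * Fintype.card ι * σ < ρ θ) :
    ∃ i, 2 * |e.det t| ≤ |e.det (Function.update t i θ)| := by
  by_cases h0 : e.det t = 0
  · obtain ⟨i⟩ := ‹Nonempty ι›
    exact ⟨i, by rw [h0, abs_zero, mul_zero]; exact abs_nonneg _⟩
  · have hb := (e.is_basis_iff_det).2 (isUnit_iff_ne_zero.2 h0)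
    let e' : Module.Basis ι ℝ E := Module.Basis.mk hb.1 hb.2.ge
    have hsum : ∑ i, e'.repr θ i • t i = θ := by
      conv_rhs => rw [← e'.sum_repr θ]
      simp [e']
    -- If no exchange doubles the determinant, all coefficients of `θ` are at most `2` in absolute
    -- value, which forces `ρ θ ≤ 2 D σ`.
    by_contra! hcon
    have hc : ∀ i, |e'.repr θ i| ≤ 2 := by
      intro i
      have h1 := hcon i
      rw [← hsum, det_update_sum, abs_mul] at h1
      exact (lt_of_mul_lt_mul_right h1 (abs_nonneg _)).le
    have h2 : ρ θ ≤ ∑ i : ι, 2 * σ := by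
      refine (seminorm_le_sum_coord ρ e' θ).trans (Finset.sum_le_sum fun i _ => ?_)
      have : e' i = t i := by simp [e']
      rw [this]
      exact mul_le_mul (hc i) (ht i) (apply_nonneg _ _) zero_le_two
    rw [Finset.sum_const, Finset.card_univ, nsmul_eq_mul] at h2
    linarith

/-- Boundedness is compactness of the unit ball of `p`; positivity comes from a rescaled basis. The
number `m` later cancels between the upper and the lower bound on the potential, so no estimate
depends on the basis. -/
theorem exists_isLUB_det (e : Module.Basis ι ℝ E) (p : Seminorm ℝ E) (hp : ∀ z, p z = 0 → z = 0) :
    ∃ m, 0 < m ∧ IsLUB {c | ∃ t : ι → E, (∀ i, p (t i) ≤ 1) ∧ c = |e.det t|} m := by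
  let N : AddGroupNorm E :=
    { toFun := p
      map_zero' := map_zero p
      add_le' := map_add_le_add p
      neg' := map_neg_eq_map p
      eq_zero_of_map_eq_zero' := hp }
  let i1 : NormedAddCommGroup E := N.toNormedAddCommGroup
  let i2 : NormedSpace ℝ E := ⟨fun c z => (map_smul_eq_mul p c z).le⟩
  have hfin : FiniteDimensional ℝ E := e.finiteDimensional_of_finite
  have hprop : ProperSpace E := FiniteDimensional.proper ℝ E
  let s : Set (ι → E) := Set.univ.pi fun _ => Metric.closedBall (0 : E) 1
  have hs : IsCompact s := isCompact_univ_pi fun _ => isCompact_closedBall 0 1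
  have hmem : ∀ t : ι → E, t ∈ s ↔ ∀ i, p (t i) ≤ 1 := by
    intro t
    simp only [s, Set.mem_univ_pi, mem_closedBall_zero_iff]
    rfl
  have hc : Continuous fun t : ι → E => |e.det t| := by
    simp only [Module.Basis.det_apply]
    refine (Continuous.matrix_det (continuous_matrix fun i j => ?_)).abs
    exact (LinearMap.continuous_of_finiteDimensional (e.coord i)).comp (continuous_apply j)
  have hset : {c | ∃ t : ι → E, (∀ i, p (t i) ≤ 1) ∧ c = |e.det t|} =
      (fun t : ι → E => |e.det t|) '' s := by
    ext c
    constructor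
    · rintro ⟨t, ht, rfl⟩; exact ⟨t, (hmem t).2 ht, rfl⟩
    · rintro ⟨t, ht, rfl⟩; exact ⟨t, (hmem t).1 ht, rfl⟩
  rw [hset]
  have hbdd : BddAbove ((fun t : ι → E => |e.det t|) '' s) := (hs.image hc).bddAbove
  have hne : ((fun t : ι → E => |e.det t|) '' s).Nonempty :=
    ⟨_, 0, (hmem 0).2 fun i => by simp, rfl⟩
  refine ⟨_, ?_, isLUB_csSup hne hbdd⟩
  let t : ι → E := fun i => (1 + p (e i))⁻¹ • e i
  have hpos : ∀ i, 0 < 1 + p (e i) := fun i => by have := apply_nonneg p (e i); linarith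
  have ht : t ∈ s := (hmem t).2 fun i => by
    rw [map_smul_eq_mul, Real.norm_eq_abs, abs_of_pos (inv_pos.2 (hpos i)),
      inv_mul_le_iff₀ (hpos i)]
    linarith
  refine lt_of_lt_of_le ?_ (le_csSup hbdd ⟨t, ht, rfl⟩)
  have : e.det t = ∏ i, (1 + p (e i))⁻¹ := by
    have h := e.det.map_smul_univ (fun i => (1 + p (e i))⁻¹) e
    rw [e.det_self, smul_eq_mul, mul_one] at h
    exact h
  simp only [this, abs_pos]
  exact Finset.prod_ne_zero_iff.2 fun i _ => (inv_pos.2 (hpos i)).ne'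

/-- All determinants of tuples from `C ∪ {p ≤ ε}` are at most `2⁻ᵏ U`. -/
def DetBound (e : Module.Basis ι ℝ E) (p : Seminorm ℝ E) (ε U : ℝ) (k : ℕ) (C : Set E) : Prop :=
  ∀ t : ι → E, (∀ i, t i ∈ C ∨ p (t i) ≤ ε) → 2 ^ k * |e.det t| ≤ U

theorem DetBound.mono {e : Module.Basis ι ℝ E} {p : Seminorm ℝ E} {ε U : ℝ} {k : ℕ}
    {C C' : Set E} (h : DetBound e p ε U k C) (hC : C' ⊆ C) : DetBound e p ε U k C' :=
  fun t ht => h t fun i => (ht i).imp (fun h => hC h) id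

/-- On an admissible tuple for `C'`, `ρ` is at most `σ`: on members of `C'` by assumption, on short
vectors because `ρ ≤ p` and `ε ≤ σ`. Exchanging one entry for the far point `θ` of `C` doubles the
determinant and gives a tuple admissible for `C`. -/
theorem DetBound.succ [Nonempty ι] {e : Module.Basis ι ℝ E} {p : Seminorm ℝ E} {ε U : ℝ} {k : ℕ}
    {C C' : Set E} (h : DetBound e p ε U k C) (hC : C' ⊆ C) {ρ : Seminorm ℝ E} (hρ : ρ ≤ p)
    {θ : E} (hθ : θ ∈ C) {σ : ℝ} (hεσ : ε ≤ σ) (hC' : ∀ z ∈ C', ρ z ≤ σ)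
    (hσθ : 2 * Fintype.card ι * σ < ρ θ) : DetBound e p ε U (k + 1) C' := by
  intro t ht
  obtain ⟨i, hi⟩ := exists_two_mul_det_le e ρ t θ
    (fun i => (ht i).elim (hC' _) fun h => (hρ _).trans (h.trans hεσ)) hσθ
  have := h (Function.update t i θ) fun j => by
    by_cases hj : j = i
    · subst hj; left; simpa using hθ
    · rw [Function.update_of_ne hj]; exact (ht j).imp (fun h => hC h) id
  calc 2 ^ (k + 1) * |e.det t| = 2 ^ k * (2 * |e.det t|) := by ring
    _ ≤ 2 ^ k * |e.det (Function.update t i θ)| := by gcongr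
    _ ≤ U := this

/-- An initial bound on determinants, together with what it says about the number of doublings. -/
theorem exists_detBound (e : Module.Basis ι ℝ E) (p : Seminorm ℝ E) (hp : ∀ z, p z = 0 → z = 0)
    {ε R : ℝ} (hε : 0 < ε) (hεR : ε ≤ R) {C : Set E} (hC : ∀ z ∈ C, p z ≤ R) :
    ∃ U, DetBound e p ε U 0 C ∧
      ∀ k C', DetBound e p ε U k C' → 2 ^ k * ε ^ Fintype.card ι ≤ R ^ Fintype.card ι := by
  obtain ⟨m, hm, hlub⟩ := exists_isLUB_det e p hp
  have hR : 0 < R := hε.trans_le hεR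
  have hsmul : ∀ (c : ℝ) (t : ι → E), 0 < c →
      |e.det fun i => c • t i| = c ^ Fintype.card ι * |e.det t| := by
    intro c t hc
    have := e.det.map_smul_univ (fun _ => c) t
    rw [this, smul_eq_mul, abs_mul, Finset.prod_const, Finset.card_univ, abs_of_pos (by positivity)]
  refine ⟨R ^ Fintype.card ι * m, fun t ht => ?_, fun k C' hk => ?_⟩
  · have h1 : ∀ i, p (R⁻¹ • t i) ≤ 1 := fun i => by
      rw [map_smul_eq_mul, Real.norm_eq_abs, abs_of_pos (inv_pos.2 hR), inv_mul_le_iff₀ hR,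
        mul_one]
      exact (ht i).elim (hC _) fun h => h.trans hεR
    have h2 := hsmul R (fun i => R⁻¹ • t i) hR
    simp only [smul_inv_smul₀ hR.ne'] at h2
    rw [pow_zero, one_mul, h2]
    exact mul_le_mul_of_nonneg_left (hlub.1 ⟨_, h1, rfl⟩) (by positivity)
  -- Unit-ball tuples scaled by `ε` are admissible whatever `C'` is, so the potential never drops
  -- below `ε ^ D * m`.
  · have h1 : m ≤ (2 ^ k * ε ^ Fintype.card ι)⁻¹ * (R ^ Fintype.card ι * m) := by
      refine hlub.2 ?_
      rintro _ ⟨t, ht, rfl⟩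
      rw [le_inv_mul_iff₀ (by positivity), mul_assoc, ← hsmul ε t hε]
      refine hk _ fun i => Or.inr ?_
      rw [map_smul_eq_mul, Real.norm_eq_abs, abs_of_pos hε]
      exact mul_le_of_le_one_right hε.le (ht i)
    rw [le_inv_mul_iff₀ (by positivity)] at h1
    exact le_of_mul_le_mul_right h1 hm

end Potential

/-! ### Vertices of the polar of a symmetric polytope -/

section Polytope

variable {B : Type*} [Fintype B] {d : ℕ}

/-- The vectors `v a` and their negatives. -/
def signed (v : B → Fin d → ℝ) (p : B × Bool) : Fin d → ℝ := if p.2 then v p.1 else -v p.1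

/-- The polar of the absolute convex hull of the vectors `v a`. -/
def polar (v : B → Fin d → ℝ) : Set (Fin d → ℝ) := {f | ∀ p, f ⬝ᵥ signed v p ≤ 1}

theorem mem_polar_iff {v : B → Fin d → ℝ} {f : Fin d → ℝ} :
    f ∈ polar v ↔ ∀ a, |f ⬝ᵥ v a| ≤ 1 := by
  constructor
  · intro h a
    have h1 := h (a, true)
    have h2 := h (a, false)
    simp only [signed, if_true, Bool.false_eq_true, if_false, dotProduct_neg] at h1 h2
    exact abs_le.2 ⟨by linarith, h1⟩
  · rintro h ⟨a, s⟩
    have := abs_le.1 (h a)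
    cases s
    · simp only [signed, Bool.false_eq_true, if_false, dotProduct_neg]; linarith
    · simpa [signed] using this.2

/-- The index set of the potential vertices of the polar. -/
abbrev VertexIndex (B : Type*) (d : ℕ) : Type _ := {I : Finset (B × Bool) // I.card = d}

/-- The matrix whose rows are the signed vectors selected by `I`. -/
def vertexMatrix (v : B → Fin d → ℝ) (I : VertexIndex B d) : Matrix (Fin d) (Fin d) ℝ :=
  fun i => signed v ((Finset.equivFinOfCardEq I.2).symm i : B × Bool)

/-- The point at which the constraints selected by `I` are active. -/
def vertex (v : B → Fin d → ℝ) (I : VertexIndex B d) : Fin d → ℝ :=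
  (vertexMatrix v I)⁻¹.mulVec 1

theorem eq_dotProduct (l : (Fin d → ℝ) →ₗ[ℝ] ℝ) (x : Fin d → ℝ) :
    l x = (fun j => l (Pi.single j 1)) ⬝ᵥ x := by
  conv_lhs => rw [LinearMap.pi_apply_eq_sum_univ l x]
  simp only [dotProduct, smul_eq_mul]
  refine Finset.sum_congr rfl fun j _ => ?_
  rw [mul_comm]
  congr 2
  ext i
  simp [Pi.single_apply, eq_comm]

/-- Since the `v a` span, each coordinate of `f` is a fixed combination of the numbers `f ⬝ᵥ v a`,
which are bounded by `1`. -/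
theorem isCompact_polar {v : B → Fin d → ℝ}
    (hv : ∀ w, ∃ y : B → ℝ, ∑ a, y a • v a = w) : IsCompact (polar v) := by
  choose α hα using fun j : Fin d => hv (Pi.single j 1)
  have hcl : IsClosed (polar v) := by
    have : polar v = ⋂ p, {f | f ⬝ᵥ signed v p ≤ 1} := by ext f; simp [polar]
    rw [this]
    refine isClosed_iInter fun p => isClosed_le ?_ continuous_const
    exact continuous_id.dotProduct continuous_const
  refine IsCompact.of_isClosed_subset
    (isCompact_univ_pi fun j => isCompact_Icc (a := -∑ a, |α j a|) (b := ∑ a, |α j a|)) hcl ?_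
  intro f hf j _
  rw [Set.mem_Icc, ← abs_le]
  have : f j = ∑ a, α j a * (f ⬝ᵥ v a) := by
    have h1 : f ⬝ᵥ (Pi.single j 1 : Fin d → ℝ) = f j := by simp
    rw [← h1, ← hα j, dotProduct_sum]
    simp
  rw [this]
  refine (Finset.abs_sum_le_sum_abs _ _).trans (Finset.sum_le_sum fun a _ => ?_)
  rw [abs_mul]
  exact mul_le_of_le_one_right (abs_nonneg _) (mem_polar_iff.1 hf a)

/-- The constraints that are active at an extreme point span the space. -/
theorem span_active_eq_top {v : B → Fin d → ℝ} {f : Fin d → ℝ}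
    (hf : f ∈ (polar v).extremePoints ℝ) :
    Submodule.span ℝ (Set.range fun p : {p // f ⬝ᵥ signed v p = 1} => signed v p) = ⊤ := by
  by_contra hne
  obtain ⟨l, hl, hker⟩ := Submodule.exists_le_ker_of_lt_top _ (lt_top_iff_ne_top.2 hne)
  set g : Fin d → ℝ := fun j => l (Pi.single j 1) with hg
  have hg0 : g ≠ 0 := fun h => hl (LinearMap.ext fun x => by
    rw [eq_dotProduct l x, ← hg, h, zero_dotProduct, LinearMap.zero_apply])
  have hact : ∀ p, f ⬝ᵥ signed v p = 1 → g ⬝ᵥ signed v p = 0 := fun p hp => by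
    rw [hg, ← eq_dotProduct]
    exact hker (Submodule.subset_span ⟨⟨p, hp⟩, rfl⟩)
  -- Moving along `g` leaves the active constraints unchanged, and the finitely many others are
  -- strict at `f`. So `f` is the midpoint of a nontrivial segment in the polar.
  have hev : ∀ᶠ ε : ℝ in nhds 0, f + ε • g ∈ polar v := by
    have : ∀ᶠ ε : ℝ in nhds 0, ∀ p, (f + ε • g) ⬝ᵥ signed v p ≤ 1 := by
      rw [Filter.eventually_all]
      intro p
      rcases (hf.1 p).eq_or_lt with h | h
      · refine Filter.Eventually.of_forall fun ε => ?_
        rw [add_dotProduct, smul_dotProduct, hact p h, h, smul_zero, add_zero]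
      · have hc : Continuous fun ε : ℝ => (f + ε • g) ⬝ᵥ signed v p :=
          (continuous_const.add (continuous_id.smul continuous_const)).dotProduct continuous_const
        have h0 : (fun ε : ℝ => (f + ε • g) ⬝ᵥ signed v p) 0 < 1 := by simpa using h
        exact (hc.continuousAt.eventually_lt continuousAt_const h0).mono fun _ h => h.le
    exact this
  have hev' : ∀ᶠ ε : ℝ in nhds 0, f + (-ε) • g ∈ polar v := by
    have := (continuous_neg (G := ℝ)).tendsto 0
    rw [neg_zero] at this
    exact this.eventually hev
  obtain ⟨ε, ⟨h1, h2⟩, hε⟩ :=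
    (((hev.and hev').filter_mono nhdsWithin_le_nhds).and
      (self_mem_nhdsWithin (s := ({0}ᶜ : Set ℝ)))).exists
  have hseg : f ∈ openSegment ℝ (f + ε • g) (f + (-ε) • g) :=
    ⟨1 / 2, 1 / 2, by norm_num, by norm_num, by norm_num, by
      ext j
      simp only [Pi.add_apply, Pi.smul_apply, smul_eq_mul]
      ring⟩
  have := hf.2 h1 h2 hseg
  simp only [add_eq_left, smul_eq_zero] at this
  exact this.elim hε hg0

/-- A basis chosen among the active signed vectors consists of `d` distinct constraints with
invertible matrix, and `f` solves the system with right-hand side `1`. -/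
theorem exists_vertex_eq {v : B → Fin d → ℝ} {f : Fin d → ℝ}
    (hf : f ∈ (polar v).extremePoints ℝ) : ∃ I, f = vertex v I := by
  classical
  obtain ⟨κ, a, ha, hspan, hli⟩ := exists_linearIndependent' ℝ
    fun p : {p // f ⬝ᵥ signed v p = 1} => signed v p
  rw [span_active_eq_top hf] at hspan
  let e := Module.Basis.mk hli hspan.ge
  have : Finite κ := Finite.of_injective a ha
  have := Fintype.ofFinite κ
  have hcard : Fintype.card κ = d := by
    rw [← Module.finrank_eq_card_basis e, Module.finrank_fin_fun]
  let I : VertexIndex B d := ⟨Finset.univ.image fun k => (a k : B × Bool), by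
    rw [Finset.card_image_of_injective _ (show Function.Injective fun k => (a k : B × Bool) from
      Subtype.val_injective.comp ha), Finset.card_univ, hcard]⟩
  have hI : ∀ p ∈ I.1, f ⬝ᵥ signed v p = 1 := by
    intro p hp
    obtain ⟨k, -, rfl⟩ := Finset.mem_image.1 hp
    exact (a k).2
  have hzero : ∀ u : Fin d → ℝ, (∀ p ∈ I.1, signed v p ⬝ᵥ u = 0) → u = 0 := by
    intro u hu
    have h1 : ∀ x ∈ Submodule.span ℝ (Set.range ((fun p : {p // f ⬝ᵥ signed v p = 1} =>
        signed v p) ∘ a)), x ⬝ᵥ u = 0 := by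
      intro x hx
      induction hx using Submodule.span_induction with
      | mem x hx =>
        obtain ⟨k, rfl⟩ := hx
        exact hu _ (Finset.mem_image.2 ⟨k, Finset.mem_univ k, rfl⟩)
      | zero => simp
      | add x y _ _ hx hy => rw [add_dotProduct, hx, hy, add_zero]
      | smul c x _ hx => rw [smul_dotProduct, hx, smul_zero]
    exact dotProduct_self_eq_zero.1 (h1 u (hspan ▸ Submodule.mem_top))
  have hdet : IsUnit (vertexMatrix v I).det := by
    rw [isUnit_iff_ne_zero]
    intro h
    obtain ⟨u, hu, h0⟩ := Matrix.exists_mulVec_eq_zero_iff.2 h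
    refine hu (hzero u fun p hp => ?_)
    have := congrFun h0 (Finset.equivFinOfCardEq I.2 ⟨p, hp⟩)
    simpa [Matrix.mulVec, vertexMatrix] using this
  have hone : (vertexMatrix v I).mulVec f = 1 := by
    ext i
    rw [Matrix.mulVec, dotProduct_comm]
    exact hI _ (Subtype.prop _)
  refine ⟨I, ?_⟩
  rw [vertex, ← hone, Matrix.mulVec_mulVec, Matrix.nonsing_inv_mul _ hdet, Matrix.one_mulVec]

/-- The maximisers of `g ↦ g ⬝ᵥ w` form a compact exposed face; an extreme point of the face is
extreme in the whole polar. -/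
theorem exists_extremePoint_le {v : B → Fin d → ℝ}
    (hv : ∀ w, ∃ y : B → ℝ, ∑ a, y a • v a = w) {f : Fin d → ℝ} (hf : f ∈ polar v)
    (w : Fin d → ℝ) : ∃ g ∈ (polar v).extremePoints ℝ, f ⬝ᵥ w ≤ g ⬝ᵥ w := by
  let l : (Fin d → ℝ) →ₗ[ℝ] ℝ :=
    { toFun := fun g => g ⬝ᵥ w
      map_add' := fun g g' => add_dotProduct g g' w
      map_smul' := fun c g => smul_dotProduct c g w }
  let L : StrongDual ℝ (Fin d → ℝ) := LinearMap.toContinuousLinearMap l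
  have hc := isCompact_polar hv
  have hexp : IsExposed ℝ (polar v) (L.toExposed (polar v)) := ContinuousLinearMap.toExposed.isExposed
  obtain ⟨g, hg, hmax⟩ := hc.exists_isMaxOn ⟨f, hf⟩ L.continuous.continuousOn
  obtain ⟨g', hg'⟩ := (hexp.isCompact hc).extremePoints_nonempty ⟨g, hg, fun h hh => hmax hh⟩
  exact ⟨g', hexp.isExtreme.extremePoints_subset_extremePoints hg', hg'.1.2 f hf⟩

/-- Hahn–Banach separates `w` from the compact image of the ball of radius `c`. If `u` is the
separating level, the functional is at most `u / c` on the `± v a`, so the factor `c / u` brings it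
into the polar. -/
theorem exists_mem_polar_of_forall_ne {v : B → Fin d → ℝ} {w : Fin d → ℝ} {c : ℝ} (hc : 0 < c)
    (h : ∀ y : B → ℝ, normY y ≤ c → ∑ a, y a • v a ≠ w) : ∃ f ∈ polar v, c < f ⬝ᵥ w := by
  classical
  let T : (B → ℝ) →ₗ[ℝ] (Fin d → ℝ) := Fintype.linearCombination ℝ v
  have hT : ∀ y, T y = ∑ a, y a • v a := fun y => Fintype.linearCombination_apply ℝ v y
  have hTc : Continuous T := LinearMap.continuous_of_finiteDimensional T
  let s : Set (B → ℝ) := {y | normY y ≤ c}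
  have hs : IsCompact s := by
    refine IsCompact.of_isClosed_subset (isCompact_univ_pi fun _ => isCompact_Icc (a := -c) (b := c))
      (isClosed_le (continuous_seminorm (normYSeminorm B)) continuous_const) ?_
    intro y hy a _
    rw [Set.mem_Icc, ← abs_le]
    refine le_trans ?_ (show normY y ≤ c from hy)
    rw [normY_eq]
    exact Finset.single_le_sum (f := fun a => |y a|) (fun a _ => abs_nonneg _) (Finset.mem_univ a)
  have hsc : Convex ℝ s := by
    have := (normYSeminorm B).convexOn.convex_le c
    simp only [Set.mem_univ, true_and] at this
    exact this
  obtain ⟨l, u, hlu, hlw⟩ := geometric_hahn_banach_closed_point (hsc.linear_image T)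
    (hs.image hTc).isClosed (x := w) (by rintro ⟨y, hy, hyw⟩; exact h y hy ((hT y).symm.trans hyw))
  have hu : 0 < u := by
    have := hlu 0 ⟨0, by simp [s, normY_eq, hc.le], map_zero T⟩
    simpa using this
  have hlv : ∀ a, |l (v a)| ≤ u / c := by
    intro a
    have key : ∀ ε : ℝ, |ε| = 1 → ε * l (v a) ≤ u / c := by
      intro ε hε
      have := hlu (T (Pi.single a (c * ε))) ⟨_, by
        change normY _ ≤ c
        rw [normY_eq, Finset.sum_eq_single a]
        · simp [abs_mul, hε, abs_of_pos hc]
        · intro a' _ ha'; simp [ha']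
        · simp, rfl⟩
      rw [hT, Finset.sum_eq_single a] at this
      · rw [le_div_iff₀ hc]
        simp only [Pi.single_eq_same, map_smul, smul_eq_mul] at this
        linarith
      · intro a' _ ha'; simp [ha']
      · simp
    refine abs_le.2 ⟨?_, ?_⟩
    · have := key (-1) (by simp); linarith
    · have := key 1 (by simp); linarith
  have hl : ∀ x, l x = (fun j => l (Pi.single j 1)) ⬝ᵥ x := fun x =>
    eq_dotProduct (l : (Fin d → ℝ) →ₗ[ℝ] ℝ) x
  refine ⟨(c / u) • fun j => l (Pi.single j 1), mem_polar_iff.2 fun a => ?_, ?_⟩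
  · rw [smul_dotProduct, ← hl, smul_eq_mul, abs_mul, abs_of_pos (div_pos hc hu)]
    calc c / u * |l (v a)| ≤ c / u * (u / c) := by gcongr; exact hlv a
      _ = 1 := by field_simp
  · rw [smul_dotProduct, ← hl, smul_eq_mul, div_mul_eq_mul_div, lt_div_iff₀ hu]
    exact mul_lt_mul_of_pos_left hlw hc

/-- Bounds on the vertex functionals bound the quotient norm. -/
theorem exists_normY_le_of_vertex_le {v : B → Fin d → ℝ}
    (hv : ∀ w, ∃ y : B → ℝ, ∑ a, y a • v a = w) {w : Fin d → ℝ} {c c' : ℝ} (hc : 0 ≤ c)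
    (hcc' : c < c') (h : ∀ I, vertex v I ∈ polar v → vertex v I ⬝ᵥ w ≤ c) :
    ∃ y : B → ℝ, normY y ≤ c' ∧ ∑ a, y a • v a = w := by
  by_contra! hcon
  obtain ⟨f, hf, hfw⟩ := exists_mem_polar_of_forall_ne (hc.trans_lt hcc') hcon
  obtain ⟨g, hg, hfg⟩ := exists_extremePoint_le hv hf w
  obtain ⟨I, rfl⟩ := exists_vertex_eq hg
  have := h I hg.1
  linarith

theorem card_vertexIndex_le (hd : d < Fintype.card B) :
    (Fintype.card (VertexIndex B d) : ℝ) ≤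
      (2 * Real.exp 1 * Fintype.card B / (d + 1)) ^ (d + 1) := by
  classical
  have h1 : Fintype.card (VertexIndex B d) = (2 * Fintype.card B).choose d := by
    rw [Fintype.card_finset_len, Fintype.card_prod, Fintype.card_bool, mul_comm]
  -- Below the middle row entry binomials increase. Passing to `d + 1` makes the final estimate
  -- meaningful for `d = 0` as well.
  have h2 : (2 * Fintype.card B).choose d ≤ (2 * Fintype.card B).choose (d + 1) :=
    Nat.choose_le_succ_of_lt_half_left (by omega)
  have h3 := Nat.choose_le_pow_div (α := ℝ) (d + 1) (2 * Fintype.card B)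
  have h4 : ((d + 1 : ℝ)) ^ (d + 1) / (d + 1).factorial ≤ Real.exp 1 ^ (d + 1) := by
    have := Real.pow_div_factorial_le_exp (x := (d + 1 : ℝ)) (by positivity) (d + 1)
    rw [← Real.exp_nat_mul]
    simpa using this
  calc (Fintype.card (VertexIndex B d) : ℝ) ≤ ((2 * Fintype.card B).choose (d + 1) : ℕ) := by
        rw [h1]; exact_mod_cast h2
    _ ≤ ((2 * Fintype.card B : ℕ) : ℝ) ^ (d + 1) / (d + 1).factorial := h3
    _ = (2 * Fintype.card B / (d + 1 : ℝ)) ^ (d + 1) *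
        ((d + 1 : ℝ) ^ (d + 1) / (d + 1).factorial) := by
        push_cast
        rw [div_pow]
        field_simp
    _ ≤ (2 * Fintype.card B / (d + 1 : ℝ)) ^ (d + 1) * Real.exp 1 ^ (d + 1) := by gcongr
    _ = _ := by rw [← mul_pow]; congr 1; ring

end Polytope

/-! ### The law of the interaction -/

section Law

variable {A B : Type*} [MeasurableSpace A] [Fintype B]

theorem measurable_snoc (φ : AgentPolicy A B) (n : ℕ) :
    Measurable fun p : (Fin n → A × Outcome B) × Outcome B =>
      (Fin.snoc (α := fun _ => A × Outcome B) p.1 (φ.arm n p.1, p.2) :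
        Fin (n + 1) → A × Outcome B) := by
  refine measurable_pi_iff.2 fun i => ?_
  induction i using Fin.lastCases with
  | last =>
    simp only [Fin.snoc_last]
    exact ((φ.measurable_arm n).comp measurable_fst).prodMk measurable_snd
  | cast i =>
    simp only [Fin.snoc_castSucc]
    exact (measurable_pi_apply i).comp measurable_fst

instance isProbabilityMeasure_law (φ : AgentPolicy A B) (ν : NaturePolicy A B) :
    ∀ n, IsProbabilityMeasure (law φ ν n)
  | 0 => by rw [law]; infer_instance
  | n + 1 => by
    have := isProbabilityMeasure_law φ ν n
    have := ν.isMarkovKernel n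
    rw [law]
    exact Measure.isProbabilityMeasure_map (measurable_snoc φ n).aemeasurable

theorem lintegral_law_succ (φ : AgentPolicy A B) (ν : NaturePolicy A B) (n : ℕ)
    {g : (Fin (n + 1) → A × Outcome B) → ENNReal} (hg : Measurable g) :
    ∫⁻ h, g h ∂(law φ ν (n + 1)) = ∫⁻ h, ∫⁻ y,
      g (Fin.snoc (α := fun _ => A × Outcome B) h (φ.arm n h, y))
        ∂(ν.kernel n (h, φ.arm n h)) ∂(law φ ν n) := by
  have := ν.isMarkovKernel n
  rw [law, lintegral_map hg (measurable_snoc φ n)]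
  exact Measure.lintegral_compProd (hg.comp (measurable_snoc φ n))

/-- Almost surely, the arms in the history are those chosen by the agent. -/
theorem ae_arm_eq [TopologicalSpace A] [PolishSpace A] [BorelSpace A]
    (φ : AgentPolicy A B) (ν : NaturePolicy A B) :
    ∀ n, ∀ᵐ h ∂(law φ ν n), ∀ i : Fin n,
      (h i).1 = φ.arm i fun j => h ⟨j, j.2.trans i.2⟩
  | 0 => Filter.Eventually.of_forall fun _ i => i.elim0
  | n + 1 => by
    have ih := ae_arm_eq φ ν n
    have := ν.isMarkovKernel n
    rw [law, ae_map_iff (measurable_snoc φ n).aemeasurable]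
    · have h1 := Measure.ae_compProd_of_ae_ae (κ := (ν.kernel n).comap (fun h => (h, φ.arm n h))
        (measurable_id.prodMk (φ.measurable_arm n))) (μ := law φ ν n)
        (p := fun p => ∀ i : Fin n, (p.1 i).1 = φ.arm i fun j => p.1 ⟨j, j.2.trans i.2⟩)
        (by
          simp only [Set.ofPred_forall]
          refine MeasurableSet.iInter fun i => measurableSet_eq_fun ?_ ?_
          · exact measurable_fst.comp ((measurable_pi_apply i).comp measurable_fst)
          · exact (φ.measurable_arm i).comp (measurable_pi_iff.2 fun j =>
              (measurable_pi_apply _).comp measurable_fst))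
        (ih.mono fun h hh => Filter.Eventually.of_forall fun _ => hh)
      filter_upwards [h1] with p hp i
      induction i using Fin.lastCases with
      | last =>
        simp only [Fin.snoc_last]
        refine congrArg _ (funext fun j => ?_)
        exact (Fin.snoc_castSucc (α := fun _ => A × Outcome B) _ p.1 j).symm
      | cast i =>
        simp only [Fin.snoc_castSucc]
        rw [hp i]
        refine congrArg _ (funext fun j => ?_)
        exact (Fin.snoc_castSucc (α := fun _ => A × Outcome B) _ p.1 ⟨j, _⟩).symm
    · simp only [Set.ofPred_forall]
      refine MeasurableSet.iInter fun i => measurableSet_eq_fun ?_ ?_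
      · exact measurable_fst.comp (measurable_pi_apply i)
      · exact (φ.measurable_arm i).comp (measurable_pi_iff.2 fun j => measurable_pi_apply _)

/-- The exponential moments of a sum of bounded martingale differences. -/
theorem lintegral_exp_sum_le (φ : AgentPolicy A B) (ν : NaturePolicy A B)
    {u : A × Outcome B → ℝ} (hu : Measurable u) (hu1 : ∀ p, |u p| ≤ 1)
    (hu0 : ∀ n h x, ∫ y, u (x, y) ∂(ν.kernel n (h, x)) = 0) (c : ℕ → ℝ) :
    ∀ n, ∫⁻ h, ENNReal.ofReal (Real.exp (∑ i : Fin n, c i * u (h i))) ∂(law φ ν n) ≤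
      ENNReal.ofReal (Real.exp (∑ i ∈ Finset.range n, c i ^ 2 / 2))
  | 0 => by simp
  | n + 1 => by
    have hm : ∀ n, Measurable fun h : Fin n → A × Outcome B =>
        ENNReal.ofReal (Real.exp (∑ i : Fin n, c i * u (h i))) := fun n =>
      (Real.measurable_exp.comp (Finset.measurable_sum _ fun i _ =>
        (hu.comp (measurable_pi_apply i)).const_mul _)).ennreal_ofReal
    rw [lintegral_law_succ φ ν n (hm (n + 1)), Finset.sum_range_succ, Real.exp_add,
      ENNReal.ofReal_mul (Real.exp_pos _).le, mul_comm]
    have hstep : ∀ h : Fin n → A × Outcome B, ∫⁻ y, ENNReal.ofReal (Real.exp (∑ i : Fin (n + 1),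
        c i * u (Fin.snoc (α := fun _ => A × Outcome B) h (φ.arm n h, y) i)))
          ∂(ν.kernel n (h, φ.arm n h)) ≤ ENNReal.ofReal (Real.exp (c n ^ 2 / 2)) *
            ENNReal.ofReal (Real.exp (∑ i : Fin n, c i * u (h i))) := by
      intro h
      have := ν.isMarkovKernel n
      have hum : Measurable fun y => u (φ.arm n h, y) := hu.comp measurable_prodMk_left
      -- Hoeffding's lemma for the last round, conditionally on the history; on `[-1, 1]` the
      -- variance proxy is `1`.
      have hsub := hasSubgaussianMGF_of_mem_Icc_of_integral_eq_zero (a := -1) (b := 1)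
        (μ := ν.kernel n (h, φ.arm n h)) hum.aemeasurable
        (Filter.Eventually.of_forall fun y => abs_le.1 (hu1 _)) (hu0 n h _)
      have hmgf := hsub.mgf_le (c n)
      simp only [Fin.sum_univ_castSucc, Fin.snoc_castSucc, Fin.snoc_last, Real.exp_add,
        ENNReal.ofReal_mul (Real.exp_pos _).le, Fin.val_castSucc, Fin.val_last]
      rw [lintegral_const_mul _ (by fun_prop), mul_comm]
      gcongr
      rw [← ofReal_integral_eq_lintegral_ofReal (hsub.integrable_exp_mul (c n))
        (Filter.Eventually.of_forall fun y => (Real.exp_pos _).le)]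
      refine ENNReal.ofReal_le_ofReal (hmgf.trans_eq ?_)
      norm_num
    refine (lintegral_mono hstep).trans ?_
    rw [lintegral_const_mul _ (hm n)]
    gcongr
    exact lintegral_exp_sum_le φ ν hu hu1 hu0 c n

/-- The sum of the values of `u` over the rounds from `n` to `m`. -/
def windowSum (u : A × Outcome B → ℝ) {N : ℕ} (n m : ℕ) (h : Fin N → A × Outcome B) : ℝ :=
  ∑ i : Fin N, if n ≤ (i : ℕ) ∧ (i : ℕ) ≤ m then u (h i) else 0

theorem measurable_windowSum {u : A × Outcome B → ℝ} (hu : Measurable u) {N : ℕ} (n m : ℕ) :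
    Measurable (windowSum u n m : (Fin N → A × Outcome B) → ℝ) := by
  refine Finset.measurable_sum _ fun i _ => ?_
  split_ifs
  · exact hu.comp (measurable_pi_apply i)
  · exact measurable_const

/-- The Azuma–Hoeffding inequality for a window of rounds. -/
theorem measure_windowSum_gt_le (φ : AgentPolicy A B) (ν : NaturePolicy A B)
    {u : A × Outcome B → ℝ} (hu : Measurable u) (hu1 : ∀ p, |u p| ≤ 1)
    (hu0 : ∀ n h x, ∫ y, u (x, y) ∂(ν.kernel n (h, x)) = 0) {N n m : ℕ} (hnm : n ≤ m)
    (hmN : m < N) {t : ℝ} (ht : 0 ≤ t) :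
    (law φ ν N).real {h | t * √(m + 1 - n : ℕ) < windowSum u n m h} ≤ Real.exp (-(t ^ 2 / 2)) := by
  set τ : ℝ := ((m + 1 - n : ℕ) : ℝ) with hτ
  have hτ0 : 0 < τ := by rw [hτ]; exact_mod_cast (by omega)
  -- The optimal Chernoff parameter: the exponential moment is `exp (t² / 2)` and the Markov
  -- threshold `exp (t²)`.
  set l : ℝ := t / √τ with hl
  have hl0 : 0 ≤ l := by positivity
  let c : ℕ → ℝ := fun i => if n ≤ i ∧ i ≤ m then l else 0
  have hM := lintegral_exp_sum_le φ ν hu hu1 hu0 c N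
  have hc2 : ∑ i ∈ Finset.range N, c i ^ 2 / 2 = t ^ 2 / 2 := by
    have h1 : ∀ i, c i ^ 2 / 2 = if n ≤ i ∧ i ≤ m then l ^ 2 / 2 else 0 := by
      intro i; simp only [c]; split_ifs <;> simp
    simp only [h1]
    rw [← Finset.sum_filter, Finset.sum_const]
    have h2 : (Finset.range N).filter (fun i => n ≤ i ∧ i ≤ m) = Finset.Icc n m := by
      ext i; simp only [Finset.mem_filter, Finset.mem_range, Finset.mem_Icc]; omega
    rw [h2, Nat.card_Icc, nsmul_eq_mul, ← hτ, hl, div_pow, Real.sq_sqrt hτ0.le]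
    field_simp
  have hcs : ∀ h : Fin N → A × Outcome B, ∑ i : Fin N, c i * u (h i) = l * windowSum u n m h := by
    intro h
    rw [windowSum, Finset.mul_sum]
    refine Finset.sum_congr rfl fun i _ => ?_
    simp only [c]; split_ifs <;> simp
  simp only [hcs, hc2] at hM
  have hmeas : Measurable fun h : Fin N → A × Outcome B =>
      ENNReal.ofReal (Real.exp (l * windowSum u n m h)) :=
    (Real.measurable_exp.comp ((measurable_windowSum hu n m).const_mul l)).ennreal_ofReal
  have hmk := mul_meas_ge_le_lintegral (μ := law φ ν N) hmeas (ENNReal.ofReal (Real.exp (t ^ 2)))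
  have hsub : {h : Fin N → A × Outcome B | t * √τ < windowSum u n m h} ⊆
      {h | ENNReal.ofReal (Real.exp (t ^ 2)) ≤ ENNReal.ofReal (Real.exp (l * windowSum u n m h))} := by
    intro h hh
    refine ENNReal.ofReal_le_ofReal (Real.exp_le_exp.2 ?_)
    calc t ^ 2 = l * (t * √τ) := by rw [hl]; field_simp
      _ ≤ l * windowSum u n m h := mul_le_mul_of_nonneg_left (le_of_lt hh) hl0
  have hfin : ENNReal.ofReal (Real.exp (t ^ 2)) *
      law φ ν N {h | t * √τ < windowSum u n m h} ≤ ENNReal.ofReal (Real.exp (t ^ 2 / 2)) :=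
    (mul_le_mul_right (measure_mono hsub) _).trans (hmk.trans hM)
  have hreal := ENNReal.toReal_mono ENNReal.ofReal_ne_top hfin
  rw [ENNReal.toReal_mul, ENNReal.toReal_ofReal (Real.exp_pos _).le,
    ENNReal.toReal_ofReal (Real.exp_pos _).le] at hreal
  rw [← le_div_iff₀' (Real.exp_pos _), ← Real.exp_sub] at hreal
  refine le_trans hreal (le_of_eq ?_)
  congr 1; ring

end Law

namespace Bandit

variable {A B Z W : Type*} [TopologicalSpace A] [CompactSpace A] [Fintype B]
  [AddCommGroup Z] [Module ℝ Z] [FiniteDimensional ℝ Z]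
  [TopologicalSpace Z] [IsTopologicalAddGroup Z] [ContinuousSMul ℝ Z] [T2Space Z]
  [AddCommGroup W] [Module ℝ W] [FiniteDimensional ℝ W]
  [TopologicalSpace W] [IsTopologicalAddGroup W] [ContinuousSMul ℝ W] [T2Space W]

/-! ### Concentration of the average outcome -/

open Classical in
/-- The coordinates of the images of the unit vectors under `F_{xθ}`. -/
def coordVec (b : Bandit A B Z W) (θ : Z) (x : A) (a : B) : Fin (Module.finrank ℝ W) → ℝ :=
  (Module.finBasis ℝ W).repr (b.F x θ (Pi.single a 1))

theorem sum_smul_coordVec (b : Bandit A B Z W) (θ : Z) (x : A) (y : B → ℝ) :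
    ∑ a, y a • b.coordVec θ x a = (Module.finBasis ℝ W).repr (b.F x θ y) := by
  classical
  have h : y = ∑ a, y a • (Pi.single a 1 : B → ℝ) := by
    ext c; simp [Finset.sum_apply, Pi.single_apply]
  conv_rhs => rw [h]
  ext i
  simp [coordVec]

theorem continuous_coordVec (b : Bandit A B Z W) (θ : Z) (a : B) :
    Continuous fun x => b.coordVec θ x a := by
  refine continuous_pi fun i => ?_
  exact (LinearMap.continuous_of_finiteDimensional ((Module.finBasis ℝ W).coord i)).comp
    (b.continuous_F θ _)

theorem exists_sum_smul_coordVec (b : Bandit A B Z W) {θ : Z} (hθ : θ ∈ b.H) (x : A)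
    (w : Fin (Module.finrank ℝ W) → ℝ) : ∃ y : B → ℝ, ∑ a, y a • b.coordVec θ x a = w := by
  obtain ⟨y, hy⟩ := b.surjective_F x θ hθ ((Module.finBasis ℝ W).equivFun.symm w)
  refine ⟨y, ?_⟩
  rw [sum_smul_coordVec, hy]
  exact (Module.finBasis ℝ W).equivFun.apply_symm_apply w

open Classical in
/-- The value at `F_{xθ}(y)` of the vertex functional with index `I` for the arm `x`. -/
def vertexFun (b : Bandit A B Z W) (θ : Z) (I : VertexIndex B (Module.finrank ℝ W))
    (p : A × Outcome B) : ℝ :=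
  if vertex (b.coordVec θ p.1) I ∈ polar (b.coordVec θ p.1) then
    ∑ a, (p.2 : B → ℝ) a * (vertex (b.coordVec θ p.1) I ⬝ᵥ b.coordVec θ p.1 a) else 0

theorem vertexFun_of_mem (b : Bandit A B Z W) {θ : Z} {I : VertexIndex B (Module.finrank ℝ W)}
    {x : A} (h : vertex (b.coordVec θ x) I ∈ polar (b.coordVec θ x)) (y : Outcome B) :
    b.vertexFun θ I (x, y) = vertex (b.coordVec θ x) I ⬝ᵥ ∑ a, (y : B → ℝ) a • b.coordVec θ x a := by
  rw [vertexFun, if_pos h, dotProduct_sum]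
  simp only [dotProduct_smul, smul_eq_mul]

theorem abs_vertexFun_le (b : Bandit A B Z W) (θ : Z) (I : VertexIndex B (Module.finrank ℝ W))
    (p : A × Outcome B) : |b.vertexFun θ I p| ≤ 1 := by
  rw [vertexFun]
  split_ifs with h
  · refine (Finset.abs_sum_le_sum_abs _ _).trans ?_
    rw [← p.2.2.2]
    refine Finset.sum_le_sum fun a _ => ?_
    have h0 : 0 ≤ (p.2 : B → ℝ) a := p.2.2.1 a
    rw [abs_mul, abs_of_nonneg h0]
    exact mul_le_of_le_one_right (p.2.2.1 a) (mem_polar_iff.1 h a)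
  · simp

theorem integrable_outcome_apply (ζ : Measure (Outcome B)) [IsProbabilityMeasure ζ] (a : B) :
    Integrable (fun y : Outcome B => (y : B → ℝ) a) ζ := by
  refine Integrable.of_bound (C := 1) ?_ (Filter.Eventually.of_forall fun y => ?_)
  · exact ((measurable_pi_apply a).comp measurable_subtype_coe).aestronglyMeasurable
  · have h0 : 0 ≤ (y : B → ℝ) a := y.2.1 a
    rw [Real.norm_eq_abs, abs_of_nonneg h0, ← y.2.2]
    exact Finset.single_le_sum (f := (y : B → ℝ)) (fun a _ => y.2.1 a) (Finset.mem_univ a)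

/-- For a fixed arm the functional is linear in `F_{xθ} y`, so only the mean of `ζ` matters, and
`F_{xθ}` kills it. The default `0` outside the polar keeps both this and the bound by `1` valid for
every arm and index. -/
theorem integral_vertexFun (b : Bandit A B Z W) (θ : Z) (I : VertexIndex B (Module.finrank ℝ W))
    (x : A) {ζ : Measure (Outcome B)} (hζ : ζ ∈ b.credal θ x) :
    ∫ y, b.vertexFun θ I (x, y) ∂ζ = 0 := by
  have := hζ.1
  by_cases h : vertex (b.coordVec θ x) I ∈ polar (b.coordVec θ x)
  · simp only [vertexFun, if_pos h]
    rw [integral_finsetSum _ fun a _ => (integrable_outcome_apply ζ a).mul_const _]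
    simp only [integral_mul_const]
    have h1 : ∀ a, ∫ y : Outcome B, (y : B → ℝ) a ∂ζ = (∫ y : Outcome B, (y : B → ℝ) ∂ζ) a :=
      fun a => (eval_integral (integrable_outcome_apply ζ) a).symm
    simp only [h1]
    have h2 := b.sum_smul_coordVec θ x (∫ y : Outcome B, (y : B → ℝ) ∂ζ)
    have h3 : b.F x θ (∫ y : Outcome B, (y : B → ℝ) ∂ζ) = 0 := hζ.2.1
    rw [h3, map_zero] at h2
    have h4 := congrArg (fun u => vertex (b.coordVec θ x) I ⬝ᵥ u) h2
    simpa [dotProduct_sum] using h4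
  · simp [vertexFun, if_neg h]

variable [MeasurableSpace A] [BorelSpace A]

/-- A selected matrix may become singular as the arm varies, so continuity can fail; writing the
inverse as `det⁻¹` times the adjugate still gives measurability. -/
theorem measurable_vertex (b : Bandit A B Z W) (θ : Z) (I : VertexIndex B (Module.finrank ℝ W)) :
    Measurable fun x => vertex (b.coordVec θ x) I := by
  have hM : Continuous fun x => vertexMatrix (b.coordVec θ x) I := by
    refine continuous_matrix fun i j => ?_
    simp only [vertexMatrix, signed]
    split_ifs
    · exact (continuous_apply j).comp (b.continuous_coordVec θ _)
    · exact ((continuous_apply j).comp (b.continuous_coordVec θ _)).neg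
  refine measurable_pi_iff.2 fun i => ?_
  simp only [vertex, Matrix.mulVec, dotProduct, Matrix.inv_def, Ring.inverse_eq_inv',
    Matrix.smul_apply, smul_eq_mul]
  refine Finset.measurable_sum _ fun j _ => Measurable.mul_const ?_ _
  exact hM.matrix_det.measurable.inv.mul (hM.matrix_adjugate.matrix_elem i j).measurable

theorem measurable_vertexFun (b : Bandit A B Z W) (θ : Z)
    (I : VertexIndex B (Module.finrank ℝ W)) : Measurable (b.vertexFun θ I) := by
  have hv := b.measurable_vertex θ I
  have hc : ∀ a, Measurable fun x => b.coordVec θ x a := fun a =>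
    (b.continuous_coordVec θ a).measurable
  have hdot : ∀ a, Measurable fun x => vertex (b.coordVec θ x) I ⬝ᵥ b.coordVec θ x a := by
    intro a
    simp only [dotProduct]
    exact Finset.measurable_sum _ fun j _ =>
      ((measurable_pi_apply j).comp hv).mul ((measurable_pi_apply j).comp (hc a))
  have hset : MeasurableSet {x | vertex (b.coordVec θ x) I ∈ polar (b.coordVec θ x)} := by
    simp only [mem_polar_iff, Set.ofPred_forall]
    exact MeasurableSet.iInter fun a => measurableSet_le (hdot a).abs measurable_const
  refine Measurable.ite (measurable_fst hset) ?_ measurable_const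
  refine Finset.measurable_sum _ fun a _ => Measurable.mul ?_ ((hdot a).comp measurable_fst)
  exact (measurable_pi_apply a).comp (measurable_subtype_coe.comp measurable_snd)

/-- The event that some average outcome is too far from its mean. -/
def deviation (b : Bandit A B Z W) (θ : Z) (η : ℝ) (N : ℕ) : Set (Fin N → A × Outcome B) :=
  ⋃ m ∈ Finset.range N, ⋃ n ∈ Finset.range (m + 1),
    ⋃ I : VertexIndex B (Module.finrank ℝ W),
      {h | η / b.R * √(m + 1 - n : ℕ) < windowSum (b.vertexFun θ I) n m h}

theorem measurableSet_deviation (b : Bandit A B Z W) (θ : Z) (η : ℝ) (N : ℕ) :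
    MeasurableSet (b.deviation θ η N) :=
  Finset.measurableSet_biUnion _ fun m _ => Finset.measurableSet_biUnion _ fun n _ =>
    MeasurableSet.iUnion fun I => measurableSet_lt measurable_const
      (measurable_windowSum (b.measurable_vertexFun θ I) n m)

/-- Cycles begin and end at random times, so the union bound runs over all `N (N + 1) / 2`
deterministic windows, and over the vertex indices. -/
theorem measureReal_deviation_le (b : Bandit A B Z W) (θ : Z) {η : ℝ} (hη : 0 ≤ η)
    (φ : AgentPolicy A B) {ν : NaturePolicy A B} (hν : ν ∈ b.compatible θ) (N : ℕ)
    (hd : Module.finrank ℝ W < Fintype.card B) :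
    (law φ ν N).real (b.deviation θ η N) ≤
      (N * (N + 1) / 2) * ((2 * Real.exp 1 * b.cardB / (b.DW + 1)) ^ (Module.finrank ℝ W + 1) *
        Real.exp (-(η ^ 2 / (2 * b.R ^ 2)))) := by
  set c : ℝ := (2 * Real.exp 1 * b.cardB / (b.DW + 1)) ^ (Module.finrank ℝ W + 1) *
        Real.exp (-(η ^ 2 / (2 * b.R ^ 2))) with hc
  have h1 : ∀ m ∈ Finset.range N, ∀ n ∈ Finset.range (m + 1),
      (law φ ν N).real (⋃ I : VertexIndex B (Module.finrank ℝ W),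
        {h | η / b.R * √(m + 1 - n : ℕ) < windowSum (b.vertexFun θ I) n m h}) ≤ c := by
    intro m hm n hn
    refine (measureReal_iUnion_fintype_le _).trans ?_
    have h2 : ∀ I : VertexIndex B (Module.finrank ℝ W), (law φ ν N).real
        {h | η / b.R * √(m + 1 - n : ℕ) < windowSum (b.vertexFun θ I) n m h} ≤
        Real.exp (-(η ^ 2 / (2 * b.R ^ 2))) := by
      intro I
      refine (measure_windowSum_gt_le φ ν (b.measurable_vertexFun θ I) (b.abs_vertexFun_le θ I)
        (fun n h x => b.integral_vertexFun θ I x (hν n h x))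
        (by have := Finset.mem_range.1 hn; omega) (Finset.mem_range.1 hm)
        (div_nonneg hη b.R_nonneg)).trans_eq ?_
      rw [div_pow, div_div, mul_comm (b.R ^ 2)]
    refine (Finset.sum_le_sum fun I _ => h2 I).trans ?_
    rw [Finset.sum_const, Finset.card_univ, nsmul_eq_mul, hc]
    exact mul_le_mul_of_nonneg_right (card_vertexIndex_le hd) (Real.exp_pos _).le
  calc (law φ ν N).real (b.deviation θ η N)
      ≤ ∑ m ∈ Finset.range N, ∑ n ∈ Finset.range (m + 1), c := by
        refine (measureReal_biUnion_finset_le _ _).trans (Finset.sum_le_sum fun m hm => ?_)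
        exact (measureReal_biUnion_finset_le _ _).trans (Finset.sum_le_sum fun n hn => h1 m hm n hn)
    _ = (N * (N + 1) / 2) * c := by
        simp only [Finset.sum_const, Finset.card_range, nsmul_eq_mul, ← Finset.sum_mul]
        congr 1
        clear h1
        induction N with
        | zero => simp
        | succ N ih => rw [Finset.sum_range_succ, ih]; push_cast; ring

theorem windowSum_le_of_notMem_deviation (b : Bandit A B Z W) {θ : Z} {η : ℝ} {N : ℕ}
    {h : Fin N → A × Outcome B} (hh : h ∉ b.deviation θ η N) {n m : ℕ} (hnm : n ≤ m) (hm : m < N)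
    (I : VertexIndex B (Module.finrank ℝ W)) :
    windowSum (b.vertexFun θ I) n m h ≤ η / b.R * √(m + 1 - n : ℕ) := by
  by_contra! hcon
  refine hh ?_
  simp only [deviation, Set.mem_iUnion]
  exact ⟨m, Finset.mem_range.2 hm, n, Finset.mem_range.2 (by omega), I, hcon⟩

/-- Without deviation, the true hypothesis stays close to `𝒱(x, y)` for the average outcome `y` of
each window in which the arm `x` is played. -/
theorem distV_le_of_notMem_deviation (b : Bandit A B Z W) (hR : 0 < b.R) {θ : Z} (hθ : θ ∈ b.H)
    {η : ℝ} (hη : 0 ≤ η) {N : ℕ} {h : Fin N → A × Outcome B} (hh : h ∉ b.deviation θ η N)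
    {n m : ℕ} (hnm : n ≤ m) (hm : m < N) {x : A}
    (hx : ∀ i : Fin N, n ≤ (i : ℕ) → (i : ℕ) ≤ m → (h i).1 = x) {y : B → ℝ}
    (hy : ((m + 1 - n : ℕ) : ℝ) • y =
      ∑ i : Fin N, if n ≤ (i : ℕ) ∧ (i : ℕ) ≤ m then ((h i).2 : B → ℝ) else 0)
    (hmu : mu B y = 1) :
    b.distV θ x y ≤ η / √(m + 1 - n : ℕ) := by
  set τ : ℝ := ((m + 1 - n : ℕ) : ℝ) with hτ
  have hτ0 : 0 < τ := by rw [hτ]; exact_mod_cast (by omega)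
  have hsq : 0 < √τ := Real.sqrt_pos.2 hτ0
  refine (b.distV_le_normW θ x hmu).trans ?_
  set c : ℝ := η / b.R / √τ with hc
  have hc0 : 0 ≤ c := by positivity
  have hvert : ∀ I, vertex (b.coordVec θ x) I ∈ polar (b.coordVec θ x) →
      vertex (b.coordVec θ x) I ⬝ᵥ ∑ a, y a • b.coordVec θ x a ≤ c := by
    intro I hI
    let l : (B → ℝ) →ₗ[ℝ] ℝ :=
      { toFun := fun y => vertex (b.coordVec θ x) I ⬝ᵥ ∑ a, y a • b.coordVec θ x a
        map_add' := fun y y' => by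
          simp only [Pi.add_apply, add_smul, Finset.sum_add_distrib, dotProduct_add]
        map_smul' := fun r y => by
          simp only [Pi.smul_apply, smul_eq_mul, mul_smul, ← Finset.smul_sum, dotProduct_smul,
            RingHom.id_apply] }
    have h1 : τ * l y = windowSum (b.vertexFun θ I) n m h := by
      rw [← smul_eq_mul, ← map_smul, hy, map_sum, windowSum]
      refine Finset.sum_congr rfl fun i _ => ?_
      split_ifs with hi
      · have hx' : h i = (x, (h i).2) := Prod.ext (hx i hi.1 hi.2) rfl
        rw [hx', b.vertexFun_of_mem hI]
        rfl
      · exact map_zero l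
    have h2 := b.windowSum_le_of_notMem_deviation hh hnm hm I
    rw [← h1, ← hτ] at h2
    change l y ≤ c
    rw [hc, le_div_iff₀ hsq]
    have h3 : l y * √τ * √τ ≤ η / b.R * √τ := by
      rw [mul_assoc, Real.mul_self_sqrt hτ0.le, mul_comm]; exact h2
    exact le_of_mul_le_mul_right h3 hsq
  -- Replacing `y` by a short preimage of the same vector gains the bound `R c'`. The separation
  -- argument needs a positive radius, hence `c' > c` first and then the limit.
  have key : ∀ c' > c, b.normW (b.F x θ y) ≤ b.R * c' := by
    intro c' hc'
    obtain ⟨v, hv, hvw⟩ := exists_normY_le_of_vertex_le (b.exists_sum_smul_coordVec hθ x) hc0 hc'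
      hvert
    rw [sum_smul_coordVec, sum_smul_coordVec] at hvw
    have : b.F x θ v = b.F x θ y := (Module.finBasis ℝ W).equivFun.injective hvw
    rw [← this]
    exact (b.normW_F_le x hθ v).trans (mul_le_mul_of_nonneg_left hv hR.le)
  have hfin : b.normW (b.F x θ y) ≤ b.R * c := by
    rw [← div_le_iff₀' hR]
    exact le_of_forall_gt_imp_ge_of_dense fun c' hc' => (div_le_iff₀' hR).2 (key c' hc')
  refine hfin.trans_eq ?_
  rw [hc]; field_simp

end Bandit

namespace Bandit

variable {A B Z W : Type*} [TopologicalSpace A] [CompactSpace A] [Fintype B]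
  [AddCommGroup Z] [Module ℝ Z] [FiniteDimensional ℝ Z]
  [TopologicalSpace Z] [IsTopologicalAddGroup Z] [ContinuousSMul ℝ Z] [T2Space Z]
  [AddCommGroup W] [Module ℝ W] [FiniteDimensional ℝ W]
  [TopologicalSpace W] [IsTopologicalAddGroup W] [ContinuousSMul ℝ W] [T2Space W]

/-! ### Rewards -/

theorem continuous_r (b : Bandit A B Z W) :
    Continuous fun p : A × Outcome B => b.r p.1 p.2 :=
  b.continuousOn_r.comp_continuous
    (continuous_fst.prodMk (continuous_subtype_val.comp continuous_snd)) fun p => ⟨trivial, p.2.2⟩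

theorem bddAbove_r (b : Bandit A B Z W) :
    BddAbove (Set.range fun p : A × Outcome B => b.r p.1 p.2) := by
  have : CompactSpace (Outcome B) := isCompact_iff_compactSpace.1 (isCompact_stdSimplex ℝ B)
  exact (isCompact_range b.continuous_r).bddAbove

theorem bddBelow_r (b : Bandit A B Z W) :
    BddBelow (Set.range fun p : A × Outcome B => b.r p.1 p.2) := by
  have : CompactSpace (Outcome B) := isCompact_iff_compactSpace.1 (isCompact_stdSimplex ℝ B)
  exact (isCompact_range b.continuous_r).bddBelow

theorem r_sub_r_le (b : Bandit A B Z W) (x x' : A) (y y' : Outcome B) :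
    b.r x y - b.r x' y' ≤ b.C :=
  sub_le_sub (le_ciSup b.bddAbove_r (x, y)) (ciInf_le b.bddBelow_r (x', y'))

/-- The Dirac measure at `q` is credible; this is the only property of the lower prevision used in
the regret estimates. -/
theorem ME_le_r (b : Bandit A B Z W) {θ : Z} {x : A} {q : B → ℝ}
    (hq : q ∈ (b.K θ x : Set (B → ℝ)) ∩ stdSimplex ℝ B) : b.ME θ x ≤ b.r x q := by
  let q' : Outcome B := ⟨q, hq.2⟩
  have hmem : Measure.dirac q' ∈ b.credal θ x := by
    refine ⟨inferInstance, ?_⟩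
    have : ∫ y : Outcome B, (y : B → ℝ) ∂(Measure.dirac q') = q := integral_dirac _ q'
    rw [this]
    exact hq
  refine (ciInf_le (f := fun ζ : b.credal θ x => ∫ y, b.r x y ∂(ζ : Measure (Outcome B)))
    ?_ ⟨_, hmem⟩).trans_eq (integral_dirac (fun y : Outcome B => b.r x y) q')
  obtain ⟨c, hc⟩ := b.bddBelow_r
  -- The `0` covers the default value of a non-integrable integral.
  refine ⟨min c 0, ?_⟩
  rintro _ ⟨ζ, rfl⟩
  have := ζ.2.1
  by_cases hi : Integrable (fun y : Outcome B => b.r x y) (ζ : Measure (Outcome B))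
  · refine (min_le_left _ _).trans ?_
    have h1 := integral_mono (integrable_const c) hi fun y => hc ⟨(x, y), rfl⟩
    simpa using h1
  · exact (min_le_right _ _).trans_eq (integral_undef hi).symm

theorem optME_eq (b : Bandit A B Z W) {xs : Z → A} (hxs : b.IsOptimalArm xs) {θ : Z}
    (hθ : θ ∈ b.H) : b.optME θ = b.ME θ (xs θ) := by
  have : Nonempty A := ⟨xs θ⟩
  exact le_antisymm (ciSup_le (hxs θ hθ))
    (le_ciSup ⟨b.ME θ (xs θ), by rintro _ ⟨x, rfl⟩; exact hxs θ hθ x⟩ (xs θ))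

theorem optME_sub_r_le (b : Bandit A B Z W) {xs : Z → A} (hxs : b.IsOptimalArm xs) {θ : Z}
    (hθ : θ ∈ b.H) (x : A) (y : Outcome B) : b.optME θ - b.r x y ≤ b.C := by
  obtain ⟨q, hq⟩ := b.ker_inter_nonempty (xs θ) θ hθ
  rw [b.optME_eq hxs hθ]
  exact (sub_le_sub_right (b.ME_le_r hq) _).trans (b.r_sub_r_le (xs θ) x ⟨q, hq.2⟩ y)

theorem C_nonneg (b : Bandit A B Z W) [Nonempty A] {θ : Z} (hθ : θ ∈ b.H) : 0 ≤ b.C := by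
  obtain ⟨x⟩ := ‹Nonempty A›
  obtain ⟨q, hq⟩ := b.ker_inter_nonempty x θ hθ
  have := b.r_sub_r_le x x ⟨q, hq.2⟩ ⟨q, hq.2⟩
  linarith

theorem inv_smul_sum_mem {ι : Type*} {s : Finset ι} (hs : s.Nonempty) (y : ι → Outcome B) :
    (s.card : ℝ)⁻¹ • ∑ i ∈ s, (y i : B → ℝ) ∈ stdSimplex ℝ B := by
  have h0 : (0 : ℝ) < s.card := by exact_mod_cast hs.card_pos
  rw [Finset.smul_sum]
  refine (convex_stdSimplex ℝ B).sum_mem (fun _ _ => by positivity) ?_ fun i _ => (y i).2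
  rw [Finset.sum_const, nsmul_eq_mul, mul_inv_cancel₀ h0.ne']

/-- The regret over rounds in which the arm optimal for an optimistic hypothesis is played. -/
theorem sum_regret_le (b : Bandit A B Z W) (hS : 0 < b.S) {θ : Z} (hθ : θ ∈ b.H) {x : A}
    {v : ℝ} (hv : v ≤ b.ME θ x) {ι : Type*} {s : Finset ι} (hs : s.Nonempty)
    (y : ι → Outcome B) :
    ∑ i ∈ s, (v - b.r x (y i)) ≤
      s.card * (2 * (b.S⁻¹ + 1) * b.distV θ x ((s.card : ℝ)⁻¹ • ∑ i ∈ s, (y i : B → ℝ))) := by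
  have h0 : (0 : ℝ) < s.card := by exact_mod_cast hs.card_pos
  set ybar : B → ℝ := (s.card : ℝ)⁻¹ • ∑ i ∈ s, (y i : B → ℝ) with hybar
  have hmem : ybar ∈ stdSimplex ℝ B := inv_smul_sum_mem hs y
  have hconv : b.r x ybar ≤ (s.card : ℝ)⁻¹ * ∑ i ∈ s, b.r x (y i) := by
    have := (b.convexOn_r x).map_sum_le (t := s) (w := fun _ => (s.card : ℝ)⁻¹)
      (p := fun i => (y i : B → ℝ)) (fun _ _ => by positivity)
      (by rw [Finset.sum_const, nsmul_eq_mul, mul_inv_cancel₀ h0.ne']) (fun i _ => (y i).2)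
    rw [← Finset.smul_sum, ← hybar] at this
    refine this.trans_eq ?_
    rw [Finset.mul_sum]
    rfl
  have hne := b.ker_inter_nonempty x θ hθ
  have hdist : v - b.r x ybar ≤ distY ybar ((b.K θ x : Set (B → ℝ)) ∩ stdSimplex ℝ B) := by
    have := hne.to_subtype
    change Nonempty ↑((b.K θ x : Set (B → ℝ)) ∩ stdSimplex ℝ B) at this
    refine le_ciInf fun q => ?_
    have h1 := b.ME_le_r q.2
    have h2 := (le_abs_self _).trans (b.lipschitz_r x q q.2.2 ybar hmem)
    rw [← normY_neg, neg_sub] at h2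
    linarith
  have h3 := hdist.trans (b.distY_K_le hS x hθ hmem)
  rw [inv_mul_eq_div, le_div_iff₀ h0] at hconv
  rw [Finset.sum_sub_distrib, Finset.sum_const, nsmul_eq_mul]
  have h4 := mul_le_mul_of_nonneg_left h3 h0.le
  linarith

/-! ### The trajectory of the algorithm -/

/-- The state of the algorithm after `n` rounds along a sequence of outcomes. -/
def stateAt (b : Bandit A B Z W) (η : ℝ) (sel : Set Z → Z) (xs : Z → A) (y : ℕ → Outcome B)
    (n : ℕ) : State B Z := b.iucbState η sel xs n fun i => y i

theorem stateAt_succ (b : Bandit A B Z W) (η : ℝ) (sel : Set Z → Z) (xs : Z → A)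
    (y : ℕ → Outcome B) (n : ℕ) :
    b.stateAt η sel xs y (n + 1) = b.step η sel xs (b.stateAt η sel xs y n) (y n) := rfl

/-- The average of the outcomes of the rounds in `[k, n)`. -/
def avg (y : ℕ → Outcome B) (k n : ℕ) : B → ℝ :=
  ((n - k : ℕ) : ℝ)⁻¹ • ∑ i ∈ Finset.Ico k n, (y i : B → ℝ)

/-- The regret of the first `n` rounds w.r.t. the value `v`. -/
def regret (b : Bandit A B Z W) (η : ℝ) (sel : Set Z → Z) (xs : Z → A) (y : ℕ → Outcome B)
    (v : ℝ) (n : ℕ) : ℝ :=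
  ∑ i ∈ Finset.range n, (v - b.r (xs (b.stateAt η sel xs y i).hyp) (y i))

/-- The bound on the regret after `M` cycles with a significant cut, at time `k`. -/
def cycleBound (b : Bandit A B Z W) (η Δ : ℝ) (M k : ℕ) : ℝ :=
  M * b.C + 4 * (b.S⁻¹ + 1) * (b.DZ + 1) * η * √(M * k) + 2 * (b.S⁻¹ + 1) * Δ * k

/-- What is known about the state of the algorithm as long as no confidence set has lost the true
hypothesis `θ`: the current cycle began in round `n - τ`, and the number `M` of past cycles with a
significant cut is controlled by the determinant potential. -/
structure Invariant (b : Bandit A B Z W) (η : ℝ) (sel : Set Z → Z) (xs : Z → A)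
    (y : ℕ → Outcome B) (θ : Z) (Δ U : ℝ) (n : ℕ) (s : State B Z) : Prop where
  conf_subset : s.conf ⊆ b.H
  isCompact_conf : IsCompact s.conf
  mem_conf : θ ∈ s.conf
  hyp_eq : s.hyp = sel s.conf
  tau_le : s.tau ≤ n
  sumY_eq : s.sumY = ∑ i ∈ Finset.Ico (n - s.tau) n, (y i : B → ℝ)
  hyp_const : ∀ i ∈ Finset.Ico (n - s.tau) n, (b.stateAt η sel xs y i).hyp = s.hyp
  width_lt : 0 < s.tau → √(s.tau : ℝ) *
    (⨆ z : s.conf, b.distV z (xs s.hyp) (avg y (n - s.tau) n)) < 2 * (b.DZ + 1) * η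
  exists_count : ∃ M : ℕ,
    DetBound (Module.finBasis ℝ Z) b.paramNorm (Δ / (2 * (b.DZ + 1))) U M s.conf ∧
    (M ≠ 0 → Δ < b.R) ∧
    b.regret η sel xs y (b.optME θ) (n - s.tau) ≤ b.cycleBound η Δ M (n - s.tau)

section Trajectory

variable {b : Bandit A B Z W} {η : ℝ} {sel : Set Z → Z} {xs : Z → A} {y : ℕ → Outcome B}
  {θ : Z} {Δ U : ℝ} {n : ℕ} {s : State B Z}

theorem bddAbove_distV (b : Bandit A B Z W) {C : Set Z} (hC : IsCompact C) (x : A) (y : B → ℝ) :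
    BddAbove (Set.range fun z : C => b.distV z x y) := by
  have := isCompact_iff_compactSpace.1 hC
  exact (isCompact_range
    ((continuous_seminorm (b.distVSeminorm x y)).comp continuous_subtype_val)).bddAbove

theorem exists_distV_eq_iSup (b : Bandit A B Z W) {C : Set Z} (hC : IsCompact C)
    (hne : C.Nonempty) (x : A) (y : B → ℝ) :
    ∃ z ∈ C, b.distV z x y = ⨆ z : C, b.distV z x y := by
  obtain ⟨z, hz, hmax⟩ := hC.exists_isMaxOn hne
    (continuous_seminorm (b.distVSeminorm x y)).continuousOn
  have := hne.to_subtype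
  refine ⟨z, hz, le_antisymm (le_ciSup (b.bddAbove_distV hC x y) ⟨z, hz⟩) ?_⟩
  exact ciSup_le fun z' => hmax z'.2

theorem Invariant.hyp_mem (h : b.Invariant η sel xs y θ Δ U n s) (hsel : b.IsOptimistic sel) :
    s.hyp ∈ s.conf := by
  rw [h.hyp_eq]
  exact (hsel s.conf h.conf_subset h.isCompact_conf ⟨θ, h.mem_conf⟩).1

theorem Invariant.optME_le (h : b.Invariant η sel xs y θ Δ U n s) (hsel : b.IsOptimistic sel)
    (hxs : b.IsOptimalArm xs) : b.optME θ ≤ b.ME s.hyp (xs s.hyp) := by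
  rw [← b.optME_eq hxs (h.conf_subset (h.hyp_mem hsel)), h.hyp_eq]
  exact (hsel s.conf h.conf_subset h.isCompact_conf ⟨θ, h.mem_conf⟩).2 θ h.mem_conf

/-- The regret over the rounds of a (possibly unfinished) cycle. -/
theorem Invariant.regret_sub_le (h : b.Invariant η sel xs y θ Δ U n s) (hS : 0 < b.S)
    (hsel : b.IsOptimistic sel) (hxs : b.IsOptimalArm xs) {k m : ℕ} (hkm : k < m)
    (hc : ∀ i ∈ Finset.Ico k m, (b.stateAt η sel xs y i).hyp = s.hyp) :
    b.regret η sel xs y (b.optME θ) m - b.regret η sel xs y (b.optME θ) k ≤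
      ((m - k : ℕ) : ℝ) * (2 * (b.S⁻¹ + 1) * b.distV s.hyp (xs s.hyp) (avg y k m)) := by
  rw [regret, regret, ← Finset.sum_Ico_eq_sub _ hkm.le]
  have h1 := b.sum_regret_le hS (h.conf_subset (h.hyp_mem hsel)) (h.optME_le hsel hxs)
    (Finset.nonempty_Ico.2 hkm) y
  rw [Nat.card_Ico] at h1
  refine le_trans (le_of_eq (Finset.sum_congr rfl fun i hi => ?_)) h1
  rw [hc i hi]

/-- Since the stopping rule has not yet fired, `d(θ̂, 𝒱)` is at most `2 (D + 1) η / √τ`; multiply by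
`τ` rounds. -/
theorem Invariant.regret_le (h : b.Invariant η sel xs y θ Δ U n s) (hS : 0 < b.S)
    (hsel : b.IsOptimistic sel) (hxs : b.IsOptimalArm xs) :
    b.regret η sel xs y (b.optME θ) n ≤ b.regret η sel xs y (b.optME θ) (n - s.tau) +
      4 * (b.S⁻¹ + 1) * (b.DZ + 1) * η * √(s.tau : ℝ) := by
  rcases Nat.eq_zero_or_pos s.tau with h0 | h0
  · simp [h0]
  · have h1 := h.regret_sub_le hS hsel hxs (k := n - s.tau) (m := n)
      (by have := h.tau_le; omega) h.hyp_const
    have h2 : n - (n - s.tau) = s.tau := by have := h.tau_le; omega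
    rw [h2] at h1
    have h3 := h.width_lt h0
    have h4 : b.distV s.hyp (xs s.hyp) (avg y (n - s.tau) n) ≤
        ⨆ z : s.conf, b.distV z (xs s.hyp) (avg y (n - s.tau) n) :=
      le_ciSup (f := fun z : s.conf => b.distV z (xs s.hyp) (avg y (n - s.tau) n))
        (b.bddAbove_distV h.isCompact_conf _ _) ⟨s.hyp, h.hyp_mem hsel⟩
    set d := b.distV s.hyp (xs s.hyp) (avg y (n - s.tau) n)
    have h5 : √(s.tau : ℝ) * d ≤ 2 * (b.DZ + 1) * η :=
      (mul_le_mul_of_nonneg_left h4 (Real.sqrt_nonneg _)).trans h3.le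
    have h6 : (s.tau : ℝ) * d ≤ √(s.tau : ℝ) * (2 * (b.DZ + 1) * η) := by
      calc (s.tau : ℝ) * d = √(s.tau : ℝ) * (√(s.tau : ℝ) * d) := by
            rw [← mul_assoc, Real.mul_self_sqrt (Nat.cast_nonneg _)]
        _ ≤ _ := mul_le_mul_of_nonneg_left h5 (Real.sqrt_nonneg _)
    have h7 : 0 ≤ 2 * (b.S⁻¹ + 1) := by positivity
    have h8 := mul_le_mul_of_nonneg_left h6 h7
    linarith

/-- Cauchy–Schwarz in incremental form: it lets `√(M k)` absorb one more cycle of length `τ`. -/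
theorem sqrt_mul_add_sqrt_le (M k τ : ℕ) :
    √((M : ℝ) * k) + √(τ : ℝ) ≤ √(((M + 1 : ℕ) : ℝ) * ((k + τ : ℕ) : ℝ)) := by
  refine Real.le_sqrt_of_sq_le ?_
  have h1 := Real.sq_sqrt (show (0 : ℝ) ≤ M * k by positivity)
  have h2 := Real.sq_sqrt (show (0 : ℝ) ≤ τ by positivity)
  have h3 : 2 * (√((M : ℝ) * k) * √(τ : ℝ)) ≤ k + M * τ := by
    have h4 : √((M : ℝ) * k) * √(τ : ℝ) = √(k : ℝ) * √((M : ℝ) * τ) := by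
      rw [← Real.sqrt_mul (by positivity), ← Real.sqrt_mul (by positivity)]
      congr 1; ring
    have h5 := Real.sq_sqrt (show (0 : ℝ) ≤ k by positivity)
    have h6 := Real.sq_sqrt (show (0 : ℝ) ≤ (M : ℝ) * τ by positivity)
    rw [h4]
    nlinarith [sq_nonneg (√(k : ℝ) - √((M : ℝ) * τ))]
  push_cast
  nlinarith

theorem inv_smul_sumY (h : b.Invariant η sel xs y θ Δ U n s) :
    ((s.tau + 1 : ℕ) : ℝ)⁻¹ • (s.sumY + (y n : B → ℝ)) = avg y (n - s.tau) (n + 1) := by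
  have h1 : n + 1 - (n - s.tau) = s.tau + 1 := by have := h.tau_le; omega
  rw [avg, h1, Finset.sum_Ico_succ_top (by omega), ← h.sumY_eq]

/-- The invariant is preserved when the current cycle goes on. -/
theorem Invariant.step_continue (h : b.Invariant η sel xs y θ Δ U n (b.stateAt η sel xs y n))
    (hs : s = b.stateAt η sel xs y n)
    (hlt : √((s.tau + 1 : ℕ) : ℝ) * (⨆ z : s.conf,
      b.distV z (xs s.hyp) (avg y (n - s.tau) (n + 1))) < 2 * (b.DZ + 1) * η) :
    b.Invariant η sel xs y θ Δ U (n + 1)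
      { conf := s.conf, hyp := s.hyp, tau := s.tau + 1, sumY := s.sumY + (y n : B → ℝ) } := by
  rw [← hs] at h
  have h1 : n + 1 - (s.tau + 1) = n - s.tau := by omega
  refine ⟨h.conf_subset, h.isCompact_conf, h.mem_conf, h.hyp_eq, ?_, ?_, ?_, ?_, ?_⟩
  · exact Nat.succ_le_succ h.tau_le
  · simp only [h1]
    rw [Finset.sum_Ico_succ_top (by omega), ← h.sumY_eq]
  · simp only [h1]
    intro i hi
    rcases Nat.lt_or_ge i n with hin | hin
    · exact h.hyp_const i (Finset.mem_Ico.2 ⟨(Finset.mem_Ico.1 hi).1, hin⟩)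
    · have : i = n := by have := (Finset.mem_Ico.1 hi).2; omega
      rw [this, hs]
  · intro _
    simp only [h1]
    exact hlt
  · simp only [h1]
    exact h.exists_count

/-- The invariant is preserved when the confidence set is cut down. -/
theorem Invariant.step_cut (h : b.Invariant η sel xs y θ Δ U n (b.stateAt η sel xs y n))
    (hs : s = b.stateAt η sel xs y n) (hS : 0 < b.S) (hη : 0 ≤ η) (hΔ : 0 ≤ Δ)
    (hD : 0 < Module.finrank ℝ Z) (hsel : b.IsOptimistic sel) (hxs : b.IsOptimalArm xs)
    (hge : 2 * (b.DZ + 1) * η ≤ √((s.tau + 1 : ℕ) : ℝ) * (⨆ z : s.conf,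
      b.distV z (xs s.hyp) (avg y (n - s.tau) (n + 1))))
    (hgood : b.distV θ (xs s.hyp) (avg y (n - s.tau) (n + 1)) ≤ η / √((s.tau + 1 : ℕ) : ℝ)) :
    b.Invariant η sel xs y θ Δ U (n + 1)
      { conf := {z ∈ s.conf | b.distV z (xs s.hyp) (avg y (n - s.tau) (n + 1)) ≤
          η / √((s.tau + 1 : ℕ) : ℝ)}
        hyp := sel {z ∈ s.conf | b.distV z (xs s.hyp) (avg y (n - s.tau) (n + 1)) ≤
          η / √((s.tau + 1 : ℕ) : ℝ)}
        tau := 0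
        sumY := 0 } := by
  rw [← hs] at h
  have hθH : θ ∈ b.H := h.conf_subset h.mem_conf
  have hne : Nonempty A := ⟨xs θ⟩
  have hDZ : (0 : ℝ) < b.DZ := by rw [DZ]; exact_mod_cast hD
  set x := xs s.hyp with hx
  set c := n - s.tau with hc
  set ybar := avg y c (n + 1) with hybar
  set conf' : Set Z := {z ∈ s.conf | b.distV z x ybar ≤ η / √((s.tau + 1 : ℕ) : ℝ)} with hconf'
  have hsub : conf' ⊆ s.conf := fun z hz => hz.1
  have htau := h.tau_le
  have hcard : n + 1 - c = s.tau + 1 := by omega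
  have hτ : 0 < √((s.tau + 1 : ℕ) : ℝ) := Real.sqrt_pos.2 (by positivity)
  have hhyp : ∀ i ∈ Finset.Ico c (n + 1), (b.stateAt η sel xs y i).hyp = s.hyp := by
    intro i hi
    rcases Nat.lt_or_ge i n with hin | hin
    · exact h.hyp_const i (Finset.mem_Ico.2 ⟨(Finset.mem_Ico.1 hi).1, hin⟩)
    · have : i = n := by have := (Finset.mem_Ico.1 hi).2; omega
      rw [this, hs]
  obtain ⟨M, hM, hMR, hreg⟩ := h.exists_count
  refine ⟨hsub.trans h.conf_subset, ?_, ⟨h.mem_conf, hgood⟩, rfl, Nat.zero_le _, by simp,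
    by simp, fun h0 => absurd h0 (lt_irrefl 0), ?_⟩
  · exact h.isCompact_conf.inter_right (isClosed_le
      (continuous_seminorm (b.distVSeminorm x ybar)) continuous_const)
  simp only [Nat.sub_zero]
  have hSpos : 0 < 2 * (b.S⁻¹ + 1) := by positivity
  have hcn : ((c : ℝ)) ≤ ((n + 1 : ℕ) : ℝ) := by exact_mod_cast (by omega)
  -- The cut is significant only if the optimistic hypothesis is farther than `Δ`. Otherwise the
  -- whole cycle is charged to the term linear in `Δ`, and the count stays.
  by_cases hsmall : b.distV s.hyp x ybar ≤ Δ
  · refine ⟨M, hM.mono hsub, hMR, ?_⟩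
    have h1 := h.regret_sub_le hS hsel hxs (k := c) (m := n + 1) (by omega) hhyp
    have h2 : ((n + 1 - c : ℕ) : ℝ) * (2 * (b.S⁻¹ + 1) * b.distV s.hyp x ybar) ≤
        ((n + 1 - c : ℕ) : ℝ) * (2 * (b.S⁻¹ + 1) * Δ) := by gcongr
    have h3 : ((n + 1 - c : ℕ) : ℝ) = ((n + 1 : ℕ) : ℝ) - c := by
      rw [Nat.cast_sub (by omega)]
    rw [h3] at h2
    rw [h3] at h1
    have h4 : 4 * (b.S⁻¹ + 1) * (b.DZ + 1) * η * √((M : ℝ) * c) ≤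
        4 * (b.S⁻¹ + 1) * (b.DZ + 1) * η * √((M : ℝ) * ((n + 1 : ℕ) : ℝ)) := by gcongr
    simp only [cycleBound] at hreg ⊢
    linarith
  · rw [not_le] at hsmall
    refine ⟨M + 1, ?_, fun _ => ?_, ?_⟩
    · obtain ⟨z, hz, hzeq⟩ := b.exists_distV_eq_iSup h.isCompact_conf ⟨θ, h.mem_conf⟩ x ybar
      have hle : b.distV s.hyp x ybar ≤ b.distV z x ybar := by
        rw [hzeq]
        exact le_ciSup (f := fun z : s.conf => b.distV z x ybar)
          (b.bddAbove_distV h.isCompact_conf _ _) ⟨s.hyp, h.hyp_mem hsel⟩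
      rw [← hzeq] at hge
      set T := b.distV z x ybar with hT
      have hTpos : 0 < T := hΔ.trans_lt (hsmall.trans_le hle)
      have : Nonempty (Fin (Module.finrank ℝ Z)) := ⟨⟨0, hD⟩⟩
      -- The stopping rule gives `η / √τ ≤ T / (2 (D + 1))` for the maximal distance `T`, so this
      -- `σ` bounds all survivors and `2 D σ < T`. Also `ε ≤ σ`, since `T > Δ`.
      refine hM.succ hsub (ρ := b.distVSeminorm x ybar)
        (fun z => b.distV_le_paramNorm z x ybar) hz (σ := T / (2 * (b.DZ + 1))) ?_ ?_ ?_
      · gcongr; exact hsmall.le.trans hle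
      · intro z' hz'
        refine hz'.2.trans ?_
        rw [div_le_div_iff₀ hτ (by positivity)]
        linarith
      · rw [Fintype.card_fin, distVSeminorm_apply, ← hT]
        change 2 * b.DZ * (T / (2 * (b.DZ + 1))) < T
        rw [mul_div_assoc', div_lt_iff₀ (by positivity)]
        nlinarith
    · exact hsmall.trans_le ((b.distV_le_paramNorm _ _ _).trans
        (b.paramNorm_le_R (h.conf_subset (h.hyp_mem hsel))))
    -- The width bound holds only up to the round before the cut; the round that triggers it costs
    -- at most `C`.
    · have h1 := h.regret_le hS hsel hxs
      have h2 : b.regret η sel xs y (b.optME θ) (n + 1) ≤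
          b.regret η sel xs y (b.optME θ) n + b.C := by
        rw [regret, Finset.sum_range_succ]
        exact add_le_add_right (b.optME_sub_r_le hxs hθH _ _) _
      have h3 := sqrt_mul_add_sqrt_le M c s.tau
      have h4 : c + s.tau = n := by omega
      rw [h4] at h3
      have h5 : √(((M + 1 : ℕ) : ℝ) * (n : ℝ)) ≤ √(((M + 1 : ℕ) : ℝ) * ((n + 1 : ℕ) : ℝ)) := by
        gcongr; simp
      have h6 : 0 ≤ 4 * (b.S⁻¹ + 1) * (b.DZ + 1) * η := by positivity
      have h7 := mul_le_mul_of_nonneg_left (h3.trans h5) h6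
      have h8 : 2 * (b.S⁻¹ + 1) * Δ * c ≤ 2 * (b.S⁻¹ + 1) * Δ * ((n + 1 : ℕ) : ℝ) := by gcongr
      simp only [cycleBound] at hreg ⊢
      rw [← hc] at h1
      push_cast at h7 h8 ⊢
      linarith

/-- The average outcomes of constant-arm windows before round `N` do not rule out `θ`. -/
def Consistent (b : Bandit A B Z W) (η : ℝ) (sel : Set Z → Z) (xs : Z → A) (y : ℕ → Outcome B)
    (θ : Z) (N : ℕ) : Prop :=
  ∀ k n x, k ≤ n → n < N →
    (∀ i, k ≤ i → i ≤ n → xs (b.stateAt η sel xs y i).hyp = x) →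
    b.distV θ x (avg y k (n + 1)) ≤ η / √(n + 1 - k : ℕ)

theorem invariant_stateAt (hS : 0 < b.S) (hη : 0 ≤ η) (hΔ : 0 ≤ Δ) (hD : 0 < Module.finrank ℝ Z)
    (hsel : b.IsOptimistic sel) (hxs : b.IsOptimalArm xs) (hθ : θ ∈ b.H)
    (hU : DetBound (Module.finBasis ℝ Z) b.paramNorm (Δ / (2 * (b.DZ + 1))) U 0 b.H) {N : ℕ}
    (hgood : b.Consistent η sel xs y θ N) :
    ∀ n, n ≤ N → b.Invariant η sel xs y θ Δ U n (b.stateAt η sel xs y n)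
  | 0, _ => by
    refine ⟨subset_rfl, b.isCompact_H, hθ, rfl, le_rfl, ?_, ?_, ?_, 0, hU, ?_, ?_⟩
    · simp [stateAt, iucbState]
    · simp
    · intro h; exact absurd h (lt_irrefl 0)
    · simp
    · simp [regret, cycleBound]
  | n + 1, hn => by
    have h := invariant_stateAt hS hη hΔ hD hsel hxs hθ hU hgood n (by omega)
    rw [stateAt_succ]
    obtain ⟨s, hs⟩ : ∃ s, s = b.stateAt η sel xs y n := ⟨_, rfl⟩
    have h' := h
    rw [← hs] at h' ⊢
    have havg := inv_smul_sumY h'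
    simp only [step]
    rw [havg]
    split_ifs with hif
    · exact h.step_continue hs hif
    · refine h.step_cut hs hS hη hΔ hD hsel hxs (not_lt.1 hif) ?_
      have h1 := hgood (n - s.tau) n (xs s.hyp) (by omega) (by omega) fun i hki hin => by
        rcases Nat.lt_or_ge i n with hlt | hge
        · rw [h'.hyp_const i (Finset.mem_Ico.2 ⟨hki, hlt⟩)]
        · have : i = n := by omega
          rw [this, hs]
      have h2 : n + 1 - (n - s.tau) = s.tau + 1 := by have := h'.tau_le; omega
      rwa [h2] at h1

/-- The regret along a trajectory that is consistent with the true hypothesis. -/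
theorem exists_regret_le (hS : 0 < b.S) (hη : 0 ≤ η) (hΔ : 0 < Δ) (hD : 0 < Module.finrank ℝ Z)
    (hsel : b.IsOptimistic sel) (hxs : b.IsOptimalArm xs) (hθ : θ ∈ b.H) {N : ℕ}
    (hgood : b.Consistent η sel xs y θ N) :
    b.regret η sel xs y (b.optME θ) N ≤ 2 * (b.S⁻¹ + 1) * Δ * N ∨
    ∃ M : ℕ, Δ < b.R ∧
      2 ^ M * (Δ / (2 * (b.DZ + 1))) ^ Module.finrank ℝ Z ≤ b.R ^ Module.finrank ℝ Z ∧
      b.regret η sel xs y (b.optME θ) N ≤ M * b.C +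
        4 * (b.S⁻¹ + 1) * (b.DZ + 1) * η * √(((M + 1 : ℕ) : ℝ) * N) +
        2 * (b.S⁻¹ + 1) * Δ * N := by
  have : Nonempty A := ⟨xs θ⟩
  have hDZ : (0 : ℝ) < b.DZ := by rw [DZ]; exact_mod_cast hD
  have hSpos : 0 < b.S⁻¹ := by positivity
  -- a potential that is valid whether or not `Δ` is below `R`
  obtain ⟨U, hU, hcount⟩ := exists_detBound (Module.finBasis ℝ Z) b.paramNorm
    (fun z hz => b.eq_zero_of_paramNorm_eq_zero ⟨θ, hθ⟩ hz)
    (ε := Δ / (2 * (b.DZ + 1))) (R := max b.R (Δ / (2 * (b.DZ + 1)))) (by positivity)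
    (le_max_right _ _) (C := b.H) (fun z hz => (b.paramNorm_le_R hz).trans (le_max_left _ _))
  have hinv := invariant_stateAt hS hη hΔ.le hD hsel hxs hθ hU hgood N le_rfl
  obtain ⟨s, hs⟩ : ∃ s, s = b.stateAt η sel xs y N := ⟨_, rfl⟩
  rw [← hs] at hinv
  obtain ⟨M, hM, hMR, hreg⟩ := hinv.exists_count
  have htau := hinv.tau_le
  have hk : (((N - s.tau : ℕ)) : ℝ) = N - s.tau := by rw [Nat.cast_sub htau]
  -- If `Δ ≥ R`, no cut is ever significant and even the unfinished cycle costs at most `O(Δ)` per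
  -- round. The `η` term must be avoided there, since `log⁺` may vanish.
  by_cases hR : Δ < b.R
  · right
    refine ⟨M, hR, ?_, ?_⟩
    · have h1 := hcount M s.conf hM
      rw [Fintype.card_fin, max_eq_left] at h1
      · exact h1
      · refine le_trans ?_ hR.le
        exact div_le_self hΔ.le (by linarith)
    · have h1 := hinv.regret_le hS hsel hxs
      have h3 := sqrt_mul_add_sqrt_le M (N - s.tau) s.tau
      rw [Nat.sub_add_cancel htau] at h3
      have h6 : 0 ≤ 4 * (b.S⁻¹ + 1) * (b.DZ + 1) * η := by positivity
      have h7 := mul_le_mul_of_nonneg_left h3 h6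
      have h8 : 2 * (b.S⁻¹ + 1) * Δ * ((N - s.tau : ℕ) : ℝ) ≤ 2 * (b.S⁻¹ + 1) * Δ * N := by
        gcongr; omega
      simp only [cycleBound] at hreg
      linarith
  · left
    have hM0 : M = 0 := by by_contra h; exact hR (hMR h)
    subst hM0
    simp only [cycleBound, Nat.cast_zero, zero_mul, Real.sqrt_zero, mul_zero, zero_add] at hreg
    rcases Nat.eq_zero_or_pos s.tau with h0 | h0
    · rw [h0, Nat.sub_zero] at hreg; exact hreg
    · have h1 := hinv.regret_sub_le hS hsel hxs (k := N - s.tau) (m := N) (by omega)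
        hinv.hyp_const
      rw [Nat.sub_sub_self htau] at h1
      have h2 : b.distV s.hyp (xs s.hyp) (avg y (N - s.tau) N) ≤ Δ :=
        (b.distV_le_paramNorm _ _ _).trans ((b.paramNorm_le_R
          (hinv.conf_subset (hinv.hyp_mem hsel))).trans (not_lt.1 hR))
      have h3 : (s.tau : ℝ) * (2 * (b.S⁻¹ + 1) *
          b.distV s.hyp (xs s.hyp) (avg y (N - s.tau) N)) ≤
          (s.tau : ℝ) * (2 * (b.S⁻¹ + 1) * Δ) := by gcongr
      rw [hk] at hreg
      linarith

end Trajectory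

end Bandit

/-! ### The constant `γ` and the number of significant cuts -/

theorem log_inv_pos : 0 < Real.log ((1 - 1 / Real.exp 2)⁻¹) := by
  have h1 : 1 / Real.exp 2 < 1 := by
    rw [div_lt_one (Real.exp_pos _)]
    exact Real.one_lt_exp_iff.2 two_pos
  have h2 : 0 < 1 / Real.exp 2 := by positivity
  exact Real.log_pos ((one_lt_inv₀ (by linarith)).2 (by linarith))

theorem one_le_gam_mul_log_two : 1 ≤ gam * Real.log 2 := by
  have h1 : 1 / Real.exp 2 ≤ 1 / 2 := by
    refine one_div_le_one_div_of_le two_pos ?_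
    have := Real.add_one_le_exp 2
    linarith
  have h2 : Real.log ((1 - 1 / Real.exp 2)⁻¹) ≤ Real.log 2 := by
    refine Real.log_le_log (inv_pos.2 (by linarith)) ?_
    rw [inv_le_comm₀ (by linarith) two_pos]
    linarith
  rw [gam, one_div_mul_eq_div, le_div_iff₀ log_inv_pos, one_mul]
  exact h2

theorem gam_pos : 0 < gam := one_div_pos.2 log_inv_pos

theorem one_le_gam : 1 ≤ gam := by
  have h1 := one_le_gam_mul_log_two
  have h2 : Real.log 2 ≤ 1 := Real.log_two_lt_d9.le.trans (by norm_num)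
  nlinarith [gam_pos]

/-- The number of cycles that the determinant potential allows. -/
theorem count_le {D M : ℕ} (hD : 0 < D) {R δ : ℝ} (hδ : 0 < δ)
    (hR : (D : ℝ) * (18 * D + 4) * δ < R)
    (hM : 2 ^ M * ((D : ℝ) * (18 * D + 4) * δ / (2 * (D + 1))) ^ D ≤ R ^ D) :
    (M : ℝ) ≤ gam * D ^ 2 * Real.posLog (D * R / δ) ∧
      1 ≤ gam * D ^ 2 * Real.posLog (D * R / δ) := by
  have hD1 : (1 : ℝ) ≤ D := by exact_mod_cast hD
  -- With `Δ = D (18 D + 4) δ`, the radius `ε` of the short vectors is at least `δ`, so `2 ^ M ≤ (R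
  -- / δ) ^ D`.
  have hδε : δ ≤ (D : ℝ) * (18 * D + 4) * δ / (2 * (D + 1)) := by
    rw [le_div_iff₀ (by positivity)]
    nlinarith [mul_pos hδ (by positivity : (0 : ℝ) < D), mul_nonneg hδ.le (sub_nonneg.2 hD1),
      mul_nonneg (mul_nonneg hδ.le (sub_nonneg.2 hD1)) (by positivity : (0 : ℝ) ≤ D)]
  -- `22` is the factor at `D = 1`; it makes `R / δ` exceed `e`, so the logarithm is at least `1`.
  have h22 : 22 * δ ≤ (D : ℝ) * (18 * D + 4) * δ := by
    have : (22 : ℝ) ≤ D * (18 * D + 4) := by nlinarith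
    gcongr
  have hRδ : 22 < R / δ := by rw [lt_div_iff₀ hδ]; linarith
  have hR0 : 0 < R := by linarith
  have hle : R / δ ≤ D * R / δ := by
    gcongr
    exact le_mul_of_one_le_left hR0.le hD1
  have hlog : Real.log (R / δ) ≤ Real.posLog (D * R / δ) :=
    (Real.log_le_log (by positivity) hle).trans (le_max_right _ _)
  have hlog1 : 1 ≤ Real.log (R / δ) := by
    rw [Real.le_log_iff_exp_le (by positivity)]
    have := Real.exp_one_lt_d9
    linarith
  have hpow : (2 : ℝ) ^ M ≤ (R / δ) ^ D := by
    rw [div_pow, le_div_iff₀ (by positivity)]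
    refine le_trans ?_ hM
    gcongr
  have hlogpow := Real.log_le_log (by positivity) hpow
  rw [Real.log_pow, Real.log_pow] at hlogpow
  set p := Real.posLog (D * R / δ)
  have hp : 1 ≤ p := hlog1.trans hlog
  have hg := gam_pos
  have h3 : (D : ℝ) * Real.log (R / δ) ≤ (D : ℝ) ^ 2 * p := by
    rw [sq, mul_assoc]
    refine mul_le_mul_of_nonneg_left ?_ (by positivity)
    exact hlog.trans (le_mul_of_one_le_left (by linarith) hD1)
  constructor
  · calc (M : ℝ) ≤ M * (gam * Real.log 2) :=
          le_mul_of_one_le_right (by positivity) one_le_gam_mul_log_two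
      _ = gam * (M * Real.log 2) := by ring
      _ ≤ gam * ((D : ℝ) ^ 2 * p) := by
          refine mul_le_mul_of_nonneg_left (hlogpow.trans h3) hg.le
      _ = gam * D ^ 2 * p := by ring
  · have : 1 ≤ gam * (D : ℝ) ^ 2 := one_le_mul_of_one_le_of_one_le one_le_gam (one_le_pow₀ hD1)
    exact one_le_mul_of_one_le_of_one_le this hp

namespace Bandit

variable {A B Z W : Type*} [TopologicalSpace A] [CompactSpace A] [Fintype B]
  [AddCommGroup Z] [Module ℝ Z] [FiniteDimensional ℝ Z]
  [TopologicalSpace Z] [IsTopologicalAddGroup Z] [ContinuousSMul ℝ Z] [T2Space Z]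
  [AddCommGroup W] [Module ℝ W] [FiniteDimensional ℝ W]
  [TopologicalSpace W] [IsTopologicalAddGroup W] [ContinuousSMul ℝ W] [T2Space W]

/-! ### Dimensions -/

theorem finrank_W_lt_card (b : Bandit A B Z W) [Nonempty A] {θ : Z} (hθ : θ ∈ b.H) :
    Module.finrank ℝ W < Fintype.card B := by
  obtain ⟨x⟩ := ‹Nonempty A›
  obtain ⟨q, hqK, hq⟩ := b.ker_inter_nonempty x θ hθ
  have h1 := LinearMap.finrank_range_add_finrank_ker (b.F x θ)
  rw [LinearMap.range_eq_top.2 (b.surjective_F x θ hθ), finrank_top,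
    Module.finrank_fintype_fun_eq_card] at h1
  have h2 : 0 < Module.finrank ℝ (LinearMap.ker (b.F x θ)) := by
    rw [Module.finrank_pos_iff_exists_ne_zero]
    refine ⟨⟨q, hqK⟩, fun h => ?_⟩
    have hq0 : q = 0 := congrArg Subtype.val h
    have := hq.2
    simp [hq0] at this
  omega

/-- If `𝒲` were zero, every parameter would act trivially. So `dim 𝒵 > 0` brings `R ≥ 1` with it,
and the case `dim 𝒵 = 0` has no regret at all. -/
theorem nontrivial_W (b : Bandit A B Z W) (hD : 0 < Module.finrank ℝ Z) : Nontrivial W := by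
  by_contra h
  rw [not_nontrivial_iff_subsingleton] at h
  obtain ⟨z, hz⟩ := Module.finrank_pos_iff_exists_ne_zero.1 hD
  exact hz (b.eq_zero_of_F z fun _ _ => Subsingleton.elim _ _)

/-! ### Expected regret -/

variable [MeasurableSpace A]

theorem ERg_le (b : Bandit A B Z W) {θ : Z} {φ : AgentPolicy A B} {N : ℕ} {G : ℝ}
    (h : ∀ ν ∈ b.compatible θ, N * b.optME θ - b.expReward φ ν N ≤ G) : b.ERg θ φ N ≤ (G : EReal) := by
  have h1 : ((N * b.optME θ - G : ℝ) : EReal) ≤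
      ⨅ ν ∈ b.compatible θ, ((b.expReward φ ν N : ℝ) : EReal) :=
    le_iInf₂ fun ν hν => EReal.coe_le_coe_iff.2 (by have := h ν hν; linarith)
  refine (EReal.sub_le_sub le_rfl h1).trans_eq ?_
  rw [← EReal.coe_sub, sub_sub_cancel]

variable [PolishSpace A] [BorelSpace A]

theorem measurable_r (b : Bandit A B Z W) : Measurable fun p : A × Outcome B => b.r p.1 p.2 :=
  b.continuous_r.measurable

/-- A pathwise bound outside an event gives a bound in expectation. -/
theorem regret_le_of_forall_notMem (b : Bandit A B Z W) {xs : Z → A} (hxs : b.IsOptimalArm xs)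
    {θ : Z} (hθ : θ ∈ b.H) (φ : AgentPolicy A B) (ν : NaturePolicy A B) {N : ℕ}
    {E : Set (Fin N → A × Outcome B)} (hE : MeasurableSet E) {G : ℝ} (hG : 0 ≤ G)
    (h : ∀ h ∉ E, (∀ i : Fin N, (h i).1 = φ.arm i fun j => h ⟨j, j.2.trans i.2⟩) →
      ∑ i : Fin N, (b.optME θ - b.r (h i).1 (h i).2) ≤ G) :
    N * b.optME θ - b.expReward φ ν N ≤ G + N * b.C * (law φ ν N).real E := by
  have : Nonempty A := ⟨xs θ⟩
  have hC := b.C_nonneg hθ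
  obtain ⟨u, hu⟩ := b.bddAbove_r
  obtain ⟨l, hl⟩ := b.bddBelow_r
  have hint : ∀ i : Fin N, Integrable (fun h : Fin N → A × Outcome B => b.r (h i).1 (h i).2)
      (law φ ν N) := fun i => by
    refine Integrable.of_mem_Icc l u (b.measurable_r.comp (measurable_pi_apply i)).aemeasurable ?_
    exact Filter.Eventually.of_forall fun h => ⟨hl ⟨h i, rfl⟩, hu ⟨h i, rfl⟩⟩
  have hint' : ∀ i : Fin N, Integrable (fun h : Fin N → A × Outcome B =>
      b.optME θ - b.r (h i).1 (h i).2) (law φ ν N) := fun i => (integrable_const _).sub (hint i)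
  have hEq : N * b.optME θ - b.expReward φ ν N =
      ∫ h, ∑ i : Fin N, (b.optME θ - b.r (h i).1 (h i).2) ∂(law φ ν N) := by
    rw [integral_finsetSum _ fun i _ => hint' i]
    have : ∀ i : Fin N, ∫ h, (b.optME θ - b.r (h i).1 (h i).2) ∂(law φ ν N) =
        b.optME θ - ∫ h, b.r (h i).1 (h i).2 ∂(law φ ν N) := fun i => by
      rw [integral_sub (integrable_const _) (hint i)]
      simp
    simp only [this]
    rw [Finset.sum_sub_distrib, expReward]
    simp
  rw [hEq]
  have hindic : Integrable (E.indicator fun _ => (N : ℝ) * b.C) (law φ ν N) :=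
    (integrable_const _).indicator hE
  calc ∫ h, ∑ i : Fin N, (b.optME θ - b.r (h i).1 (h i).2) ∂(law φ ν N)
      ≤ ∫ h, (G + E.indicator (fun _ => (N : ℝ) * b.C) h) ∂(law φ ν N) := by
        refine integral_mono_ae (integrable_finsetSum _ fun i _ => hint' i)
          ((integrable_const G).add hindic) ?_
        filter_upwards [ae_arm_eq φ ν N] with p hp
        by_cases hpE : p ∈ E
        · simp only [Set.indicator_of_mem hpE]
          have h1 : ∑ i : Fin N, (b.optME θ - b.r (p i).1 (p i).2) ≤ ∑ i : Fin N, b.C :=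
            Finset.sum_le_sum fun i _ => b.optME_sub_r_le hxs hθ _ _
          rw [Finset.sum_const, Finset.card_univ, Fintype.card_fin, nsmul_eq_mul] at h1
          linarith
        · simp only [Set.indicator_of_notMem hpE, add_zero]
          exact h p hpE hp
    _ = G + N * b.C * (law φ ν N).real E := by
        rw [integral_add (integrable_const G) hindic, integral_indicator_const _ hE]
        simp [mul_comm]

/-- The outcomes of a history, continued arbitrarily. -/
def outcomes {N : ℕ} (hN : 0 < N) (h : Fin N → A × Outcome B) (i : ℕ) : Outcome B :=
  if hi : i < N then (h ⟨i, hi⟩).2 else (h ⟨0, hN⟩).2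

theorem outcomes_of_lt {N : ℕ} (hN : 0 < N) (h : Fin N → A × Outcome B) (i : Fin N) :
    outcomes hN h i = (h i).2 := by
  simp [outcomes]

theorem arm_eq_stateAt (b : Bandit A B Z W) {η : ℝ} {sel : Set Z → Z} {xs : Z → A}
    {φ : AgentPolicy A B}
    (hφ : ∀ n h, φ.arm n h = xs (b.iucbState η sel xs n fun i => (h i).2).hyp)
    {N : ℕ} (hN : 0 < N) {h : Fin N → A × Outcome B}
    (hh : ∀ i : Fin N, (h i).1 = φ.arm i fun j => h ⟨j, j.2.trans i.2⟩) (i : Fin N) :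
    (h i).1 = xs (b.stateAt η sel xs (outcomes hN h) i).hyp := by
  rw [hh i, hφ, stateAt]
  congr 3
  funext j
  exact (outcomes_of_lt hN h ⟨j, j.2.trans i.2⟩).symm

theorem sum_eq_regret (b : Bandit A B Z W) {η : ℝ} {sel : Set Z → Z} {xs : Z → A} {N : ℕ}
    (hN : 0 < N) {h : Fin N → A × Outcome B}
    (hh : ∀ i : Fin N, (h i).1 = xs (b.stateAt η sel xs (outcomes hN h) i).hyp) (v : ℝ) :
    ∑ i : Fin N, (v - b.r (h i).1 (h i).2) = b.regret η sel xs (outcomes hN h) v N := by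
  rw [regret, ← Fin.sum_univ_eq_sum_range
    (fun i => v - b.r (xs (b.stateAt η sel xs (outcomes hN h) i).hyp) (outcomes hN h i))]
  refine Finset.sum_congr rfl fun i _ => ?_
  rw [hh i, outcomes_of_lt]

theorem consistent_of_notMem_deviation (b : Bandit A B Z W) (hR : 0 < b.R) {θ : Z} (hθ : θ ∈ b.H)
    {η : ℝ} (hη : 0 ≤ η) {sel : Set Z → Z} {xs : Z → A} {N : ℕ} (hN : 0 < N)
    {h : Fin N → A × Outcome B}
    (hh : ∀ i : Fin N, (h i).1 = xs (b.stateAt η sel xs (outcomes hN h) i).hyp)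
    (hdev : h ∉ b.deviation θ η N) : b.Consistent η sel xs (outcomes hN h) θ N := by
  intro k n x hkn hn hx
  have hne : (Finset.Ico k (n + 1)).Nonempty := Finset.nonempty_Ico.2 (by omega)
  refine b.distV_le_of_notMem_deviation hR hθ hη hdev hkn hn
    (fun i hki hin => (hh i).trans (hx i hki hin)) ?_ ?_
  · have h0 : ((n + 1 - k : ℕ) : ℝ) ≠ 0 := Nat.cast_ne_zero.2 (by omega)
    rw [avg, smul_inv_smul₀ h0]
    have h1 : ∀ i : Fin N, (if k ≤ (i : ℕ) ∧ (i : ℕ) ≤ n then ((h i).2 : B → ℝ) else 0) =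
        if k ≤ (i : ℕ) ∧ (i : ℕ) ≤ n then (outcomes hN h i : B → ℝ) else 0 := fun i => by
      rw [outcomes_of_lt]
    simp only [h1]
    rw [Fin.sum_univ_eq_sum_range
      (fun i => if k ≤ i ∧ i ≤ n then (outcomes hN h i : B → ℝ) else 0) N, ← Finset.sum_filter]
    refine Finset.sum_congr ?_ fun _ _ => rfl
    ext i
    simp only [Finset.mem_Ico, Finset.mem_filter, Finset.mem_range]
    omega
  · refine mu_of_mem_stdSimplex ?_
    have := inv_smul_sum_mem hne (outcomes hN h)
    rwa [Nat.card_Ico] at this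

/-- The regret vanishes if there is only one hypothesis vector. -/
theorem regret_nonpos_of_finrank_eq_zero (b : Bandit A B Z W) {η : ℝ} {φ : AgentPolicy A B}
    (hφ : b.IsIUCB η φ) {θ : Z} (hθ : θ ∈ b.H) (hD : Module.finrank ℝ Z = 0)
    (ν : NaturePolicy A B) {N : ℕ} :
    N * b.optME θ - b.expReward φ ν N ≤ 0 := by
  obtain ⟨sel, xs, hsel, hxs, hφ⟩ := hφ
  have hZ : Subsingleton Z := Module.finrank_zero_iff.1 hD
  have h := b.regret_le_of_forall_notMem (N := N) hxs hθ φ ν MeasurableSet.empty le_rfl fun h _ hh => by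
    refine Finset.sum_nonpos fun i _ => ?_
    have hx : (h i).1 = xs θ := by rw [hh i, hφ]; exact congrArg xs (Subsingleton.elim _ _)
    rw [sub_nonpos, hx, b.optME_eq hxs hθ]
    refine b.ME_le_r ⟨?_, (h i).2.2⟩
    change b.F _ θ _ = 0
    rw [Subsingleton.elim θ 0, map_zero, LinearMap.zero_apply]
  simpa using h

theorem regret_le_mul_C (b : Bandit A B Z W) {η : ℝ} {φ : AgentPolicy A B}
    (hφ : b.IsIUCB η φ) {θ : Z} (hθ : θ ∈ b.H) (ν : NaturePolicy A B) (N : ℕ) :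
    N * b.optME θ - b.expReward φ ν N ≤ N * b.C := by
  obtain ⟨sel, xs, hsel, hxs, hφ⟩ := hφ
  have h := b.regret_le_of_forall_notMem (N := N) hxs hθ φ ν MeasurableSet.univ le_rfl
    fun h hh => absurd (Set.mem_univ h) hh
  simpa using h

/-- The explicit regret bound. -/
theorem ERg_le_explicit (b : Bandit A B Z W) (hS : 0 < b.S) {η : ℝ} (hη : 0 ≤ η)
    {φ : AgentPolicy A B} (hφ : b.IsIUCB η φ) {N : ℕ} (hN : 0 < N) {δ : ℝ} (hδ : 0 < δ)
    {θ : Z} (hθ : θ ∈ b.H) :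
    b.ERg θ φ N ≤
      ((8 * η * (b.S⁻¹ + 1) * b.DZ * (b.DZ + 1) * √(gam * Real.posLog (b.DZ * b.R / δ) * N)
        + 1 / 2 * b.C * (2 * Real.exp 1 * b.cardB / (b.DW + 1)) ^ (Module.finrank ℝ W + 1)
          * N ^ 2 * (N + 1) * Real.exp (-(η ^ 2 / (2 * b.R ^ 2)))
        + gam * b.C * b.DZ ^ 2 * Real.posLog (b.DZ * b.R / δ)
        + (b.S⁻¹ + 1) * b.DZ * (36 * b.DZ + 8) * N * δ : ℝ) : EReal) := by
  have hA : Nonempty A := ⟨φ.arm 0 Fin.elim0⟩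
  have hC := b.C_nonneg hθ
  have hgam := gam_pos
  have hDZ0 : 0 ≤ b.DZ := Nat.cast_nonneg _
  have hDW0 : 0 ≤ b.DW := Nat.cast_nonneg _
  have hcB0 : 0 ≤ b.cardB := Nat.cast_nonneg _
  have hSi : 0 < b.S⁻¹ := inv_pos.2 hS
  have hp0 : 0 ≤ Real.posLog (b.DZ * b.R / δ) := Real.posLog_nonneg
  set p := Real.posLog (b.DZ * b.R / δ) with hp
  refine b.ERg_le fun ν hν => ?_
  rcases Nat.eq_zero_or_pos (Module.finrank ℝ Z) with hD | hD
  · refine (b.regret_nonpos_of_finrank_eq_zero hφ hθ hD ν).trans ?_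
    positivity
  have hW := b.nontrivial_W hD
  have hR := b.one_le_R hθ
  have hR0 : 0 < b.R := by linarith
  obtain ⟨sel, xs, hsel, hxs, hφ⟩ := hφ
  set G : ℝ := 8 * η * (b.S⁻¹ + 1) * b.DZ * (b.DZ + 1) * √(gam * p * N) +
    gam * b.C * b.DZ ^ 2 * p + (b.S⁻¹ + 1) * b.DZ * (36 * b.DZ + 8) * N * δ with hGdef
  have hG : 0 ≤ G := by positivity
  have hmain := b.regret_le_of_forall_notMem hxs hθ φ ν (b.measurableSet_deviation θ η N) hG
    fun h hdev harm => by
      have hh := b.arm_eq_stateAt hφ hN harm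
      rw [b.sum_eq_regret hN hh]
      have hcons := b.consistent_of_notMem_deviation hR0 hθ hη hN hh hdev
      have hDZpos : 0 < b.DZ := by rw [DZ]; exact_mod_cast hD
      have hlast : 2 * (b.S⁻¹ + 1) * (b.DZ * (18 * b.DZ + 4) * δ) * N =
          (b.S⁻¹ + 1) * b.DZ * (36 * b.DZ + 8) * N * δ := by ring
      rcases exists_regret_le (Δ := b.DZ * (18 * b.DZ + 4) * δ) hS hη (by positivity) hD hsel hxs
        hθ hcons with h1 | ⟨M, hMR, hM, h1⟩
      · refine h1.trans ?_
        rw [hlast, hGdef]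
        have : 0 ≤ 8 * η * (b.S⁻¹ + 1) * b.DZ * (b.DZ + 1) * √(gam * p * N) +
          gam * b.C * b.DZ ^ 2 * p := by positivity
        linarith
      · refine h1.trans ?_
        obtain ⟨hM1, hM2⟩ := count_le hD hδ hMR hM
        change (M : ℝ) ≤ gam * b.DZ ^ 2 * p at hM1
        change 1 ≤ gam * b.DZ ^ 2 * p at hM2
        -- The `+ 1` stands for the unfinished cycle and is absorbed because `γ D² p ≥ 1`.
        have hsq : √(((M + 1 : ℕ) : ℝ) * N) ≤ 2 * b.DZ * √(gam * p * N) := by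
          rw [Real.sqrt_le_left (by positivity), mul_pow, Real.sq_sqrt (by positivity)]
          push_cast
          have h3 : (M + 1 : ℝ) * N ≤ (4 * (gam * b.DZ ^ 2 * p)) * N := by
            gcongr; linarith
          nlinarith
        have h4 : 4 * (b.S⁻¹ + 1) * (b.DZ + 1) * η * √(((M + 1 : ℕ) : ℝ) * N) ≤
            4 * (b.S⁻¹ + 1) * (b.DZ + 1) * η * (2 * b.DZ * √(gam * p * N)) := by gcongr
        have h5 : (M : ℝ) * b.C ≤ gam * b.DZ ^ 2 * p * b.C := by gcongr
        rw [hlast, hGdef]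
        nlinarith
  refine hmain.trans ?_
  have hprob := b.measureReal_deviation_le θ hη φ hν N (b.finrank_W_lt_card hθ)
  have h6 := mul_le_mul_of_nonneg_left hprob (by positivity : 0 ≤ (N : ℝ) * b.C)
  refine (add_le_add_right h6 G).trans (le_of_eq ?_)
  rw [hGdef]
  ring

end Bandit

/-! ### The asymptotic rate -/

/-- The polynomial in the rate. -/
def ratePoly : Polynomial ℝ :=
  Polynomial.C 132 + Polynomial.C (4 * gam) * Polynomial.X +
    Polynomial.C (512 * gam) * ((Polynomial.C 7 * Polynomial.X + 1) * Polynomial.X)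

theorem eval_ratePoly (l : ℝ) :
    ratePoly.eval l = 132 + 4 * gam * l + 512 * gam * ((7 * l + 1) * l) := by
  simp [ratePoly]

theorem eval_ratePoly_mono {l l' : ℝ} (hl : 0 ≤ l) (hll' : l ≤ l') :
    ratePoly.eval l ≤ ratePoly.eval l' := by
  rw [eval_ratePoly, eval_ratePoly]
  have := gam_pos
  have : 0 ≤ l' := hl.trans hll'
  gcongr

theorem le_eval_ratePoly {l : ℝ} (hl : 0 ≤ l) : 132 ≤ ratePoly.eval l := by
  rw [eval_ratePoly]
  have := gam_pos
  have : 0 ≤ 4 * gam * l + 512 * gam * ((7 * l + 1) * l) := by positivity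
  linarith

section Rate

variable {D R σ C β : ℝ} {w N : ℕ}

theorem one_le_log_exp_mul_div (hw : 1 ≤ w) (hβ : (w : ℝ) + 1 ≤ β) :
    1 ≤ Real.log (Real.exp 1 * β / w) := by
  have hw0 : (0 : ℝ) < w := by exact_mod_cast hw
  have hβ0 : 0 < β := by linarith
  rw [Real.le_log_iff_exp_le (by positivity), le_div_iff₀ hw0]
  gcongr
  linarith

theorem sqrt_le_sqrt_rate (hw : 1 ≤ w) (hβ : (w : ℝ) + 1 ≤ β) :
    √(N : ℝ) ≤ √(w * Real.log (Real.exp 1 * β / w) * N) := by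
  have h1 := one_le_log_exp_mul_div hw hβ
  have hw1 : (1 : ℝ) ≤ w := by exact_mod_cast hw
  refine Real.sqrt_le_sqrt (le_mul_of_one_le_left (Nat.cast_nonneg _) ?_)
  exact one_le_mul_of_one_le_of_one_le hw1 h1

theorem sqrt_le_add_one {a : ℝ} (ha : 0 ≤ a) : √a ≤ a + 1 := by
  rw [Real.sqrt_le_left (by linarith)]
  nlinarith

/-- The tail term for the stated choice of the parameter. -/
theorem tail_term_le (hR : 1 ≤ R) (hβ : (w : ℝ) + 1 ≤ β) (hN : 1 ≤ N)
    (hC : 2 * Real.exp 1 ≤ C * N ^ 3) :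
    1 / 2 * C * (2 * Real.exp 1 * β / (w + 1)) ^ (w + 1) * N ^ 2 * (N + 1) *
      Real.exp (-((R * √(2 * (w + 1) * Real.log (C * N ^ 3 * β / (w + 1)))) ^ 2 / (2 * R ^ 2))) ≤
      2 * Real.exp 1 := by
  have he := Real.exp_one_gt_d9
  have hN1 : (1 : ℝ) ≤ N := by exact_mod_cast hN
  have hN0 : (0 : ℝ) < N := by linarith
  have hw0 : (0 : ℝ) < (w : ℝ) + 1 := by positivity
  have hβ0 : 0 < β := by linarith
  have hCN : 0 < C * N ^ 3 := by linarith
  have hC0 : 0 < C := by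
    by_contra! h
    have := mul_nonpos_of_nonpos_of_nonneg h (by positivity : (0 : ℝ) ≤ (N : ℝ) ^ 3)
    linarith
  set X := C * N ^ 3 * β / (w + 1) with hX
  have hX1 : 1 ≤ X := by
    rw [hX, le_div_iff₀ hw0]
    nlinarith
  have hX0 : 0 < X := by linarith
  -- The choice of `η` makes the exponential cancel the vertex count, up to the power `w + 1` of `2
  -- e / (C N³)`; that ratio is at most `1`, so one factor of it suffices.
  have hexp : Real.exp (-((R * √(2 * (w + 1) * Real.log X)) ^ 2 / (2 * R ^ 2))) =
      (X ^ (w + 1))⁻¹ := by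
    rw [mul_pow, Real.sq_sqrt (mul_nonneg (by positivity) (Real.log_nonneg hX1))]
    have : R ^ 2 * (2 * (w + 1) * Real.log X) / (2 * R ^ 2) = ((w + 1 : ℕ) : ℝ) * Real.log X := by
      push_cast
      have : R ≠ 0 := by linarith
      field_simp
    rw [this, Real.exp_neg, ← Real.log_pow, Real.exp_log (by positivity)]
  rw [hexp]
  have hquot : (2 * Real.exp 1 * β / (w + 1)) ^ (w + 1) * (X ^ (w + 1))⁻¹ =
      (2 * Real.exp 1 / (C * N ^ 3)) ^ (w + 1) := by
    rw [← div_eq_mul_inv, ← div_pow]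
    congr 1
    rw [hX]
    field_simp
  have hratio : (2 * Real.exp 1 / (C * N ^ 3)) ^ (w + 1) ≤ 2 * Real.exp 1 / (C * N ^ 3) := by
    have h1 : 2 * Real.exp 1 / (C * N ^ 3) ≤ 1 := (div_le_one hCN).2 hC
    exact pow_le_of_le_one (by positivity) h1 (by omega)
  calc 1 / 2 * C * (2 * Real.exp 1 * β / (w + 1)) ^ (w + 1) * N ^ 2 * (N + 1) * (X ^ (w + 1))⁻¹
      = 1 / 2 * C * N ^ 2 * (N + 1) *
        ((2 * Real.exp 1 * β / (w + 1)) ^ (w + 1) * (X ^ (w + 1))⁻¹) := by ring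
    _ ≤ 1 / 2 * C * N ^ 2 * (N + N) * (2 * Real.exp 1 / (C * N ^ 3)) := by
        rw [hquot]; gcongr
    _ = 2 * Real.exp 1 := by field_simp; ring

/-- The explicit bound with `δ = 1 / N` and the stated choice of `η`, in terms of the rate. -/
theorem explicit_le_rate (hD : 1 ≤ D) (hR : 1 ≤ R) (hσ : 1 ≤ σ) (hw : 1 ≤ w)
    (hβ : (w : ℝ) + 1 ≤ β) (hN : 1 ≤ N) (hC : 2 * Real.exp 1 ≤ C * N ^ 3) {f η : ℝ}
    (hf : f = R * σ * D ^ 2 * √(w * Real.log (Real.exp 1 * β / w) * N) + D ^ 2 * C)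
    (hη : η = R * √(2 * (w + 1) * Real.log (C * N ^ 3 * β / (w + 1)))) :
    8 * η * (σ + 1) * D * (D + 1) * √(gam * Real.posLog (D * R / (N : ℝ)⁻¹) * N) +
      1 / 2 * C * (2 * Real.exp 1 * β / (w + 1)) ^ (w + 1) * N ^ 2 * (N + 1) *
        Real.exp (-(η ^ 2 / (2 * R ^ 2))) +
      gam * C * D ^ 2 * Real.posLog (D * R / (N : ℝ)⁻¹) +
      (σ + 1) * D * (36 * D + 8) * N * (N : ℝ)⁻¹ ≤ f * ratePoly.eval (Real.log f) := by
  have he := Real.exp_one_gt_d9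
  have he' := Real.exp_one_lt_d9
  have hg := gam_pos
  have hN1 : (1 : ℝ) ≤ N := by exact_mod_cast hN
  have hN0 : (0 : ℝ) < N := by linarith
  have hw1 : (1 : ℝ) ≤ w := by exact_mod_cast hw
  have hβ0 : 0 < β := by linarith
  have hCN : 0 < C * N ^ 3 := by linarith
  have hC0 : 0 < C := by
    by_contra! h
    have := mul_nonpos_of_nonpos_of_nonneg h (by positivity : (0 : ℝ) ≤ (N : ℝ) ^ 3)
    linarith
  set Λ := Real.log (Real.exp 1 * β / w) with hΛ
  have hΛ1 : 1 ≤ Λ := one_le_log_exp_mul_div hw hβ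
  set q := √(w * Λ * N) with hq
  have hqN : √(N : ℝ) ≤ q := sqrt_le_sqrt_rate hw hβ
  have hq1 : 1 ≤ q := (Real.one_le_sqrt.2 hN1).trans hqN
  have hD2 : 1 ≤ D ^ 2 := one_le_pow₀ hD
  have hDD : D ≤ D ^ 2 := by nlinarith
  have hRσ : 1 ≤ R * σ := one_le_mul_of_one_le_of_one_le hR hσ
  have hfC : D ^ 2 * C ≤ f := by rw [hf]; have : 0 ≤ R * σ * D ^ 2 * q := by positivity
                                 linarith
  have hfQ : R * σ * D ^ 2 * q ≤ f := by rw [hf]; have : 0 ≤ D ^ 2 * C := by positivity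
                                         linarith
  have hfRD : R * σ * D ^ 2 ≤ f := le_trans (le_mul_of_one_le_right (by positivity) hq1) hfQ
  have hfR : R ≤ f := by
    refine le_trans ?_ hfRD
    rw [mul_assoc]
    exact le_mul_of_one_le_right (by linarith) (one_le_mul_of_one_le_of_one_le hσ hD2)
  have hfD : D ≤ f := hDD.trans ((le_mul_of_one_le_left (by positivity) hRσ).trans hfRD)
  have hfσ : σ * D ^ 2 ≤ f := by
    refine le_trans ?_ hfRD
    rw [mul_assoc]
    exact le_mul_of_one_le_left (by positivity) hR
  have hfN : √(N : ℝ) ≤ f := hqN.trans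
    ((le_mul_of_one_le_left (by positivity) (one_le_mul_of_one_le_of_one_le hRσ hD2)).trans hfQ)
  have hfC' : C ≤ f := (le_mul_of_one_le_left hC0.le hD2).trans hfC
  have hf1 : 1 ≤ f := hR.trans hfR
  have hf0 : 0 < f := by linarith
  set l := Real.log f with hl
  have hl0 : 0 ≤ l := Real.log_nonneg hf1
  have hlD : Real.log D ≤ l := Real.log_le_log (by linarith) hfD
  have hlR : Real.log R ≤ l := Real.log_le_log (by linarith) hfR
  have hlC : Real.log C ≤ l := Real.log_le_log hC0 hfC'
  have hlN : Real.log N ≤ 2 * l := by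
    have : (N : ℝ) ≤ f ^ 2 := by
      rw [← Real.sq_sqrt hN0.le]
      gcongr
    have h1 := Real.log_le_log hN0 this
    rw [Real.log_pow] at h1
    exact_mod_cast h1
  -- One `l` each for `D` and `R`, two for `N`, because `f` dominates only `√N`.
  have hp : Real.posLog (D * R / (N : ℝ)⁻¹) ≤ 4 * l := by
    rw [div_inv_eq_mul, Real.posLog_eq_log]
    · rw [Real.log_mul (by positivity) hN0.ne', Real.log_mul (by linarith) (by linarith)]
      linarith
    · have h1 : 1 ≤ D * R * N := one_le_mul_of_one_le_of_one_le
        (one_le_mul_of_one_le_of_one_le hD hR) hN1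
      rw [abs_of_pos (by linarith)]
      exact h1
  have hp0 : 0 ≤ Real.posLog (D * R / (N : ℝ)⁻¹) := Real.posLog_nonneg
  set p := Real.posLog (D * R / (N : ℝ)⁻¹) with hpdef
  -- the tail term
  have h2 := tail_term_le (w := w) hR hβ hN hC
  rw [← hη] at h2
  have h2' : 2 * Real.exp 1 ≤ 6 * f := by linarith
  -- the third term
  have h3 : gam * C * D ^ 2 * p ≤ 4 * gam * l * f := by
    calc gam * C * D ^ 2 * p = gam * (D ^ 2 * C) * p := by ring
      _ ≤ gam * f * (4 * l) := by gcongr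
      _ = 4 * gam * l * f := by ring
  -- the last term
  have h4 : (σ + 1) * D * (36 * D + 8) * N * (N : ℝ)⁻¹ ≤ 88 * f := by
    rw [mul_assoc, mul_inv_cancel₀ hN0.ne', mul_one]
    calc (σ + 1) * D * (36 * D + 8) ≤ (σ + σ) * D * (36 * D + 8 * D) := by gcongr; linarith
      _ = 88 * (σ * D ^ 2) := by ring
      _ ≤ 88 * f := by gcongr
  -- the first term
  have hlogX : Real.log (C * N ^ 3 * β / (w + 1)) ≤ Λ * (7 * l + 1) := by
    have h5 : Real.log (C * N ^ 3 * β / (w + 1)) =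
        Real.log C + 3 * Real.log N + Real.log (β / (w + 1)) := by
      rw [mul_div_assoc, Real.log_mul hCN.ne' (by positivity), Real.log_mul hC0.ne' (by positivity),
        Real.log_pow]
      norm_num
    have h6 : Real.log (β / (w + 1)) ≤ Λ := by
      refine Real.log_le_log (by positivity) ?_
      gcongr
      · exact le_mul_of_one_le_left hβ0.le (by linarith)
      · linarith
    have h7 : 7 * l ≤ Λ * (7 * l) := le_mul_of_one_le_left (by linarith) hΛ1
    rw [h5, mul_add, mul_one]
    linarith
  have hη' : η ≤ R * √(4 * (w * Λ) * (7 * l + 1)) := by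
    rw [hη]
    gcongr ?_ * √?_
    calc 2 * ((w : ℝ) + 1) * Real.log (C * N ^ 3 * β / (w + 1))
        ≤ 2 * ((w : ℝ) + 1) * (Λ * (7 * l + 1)) := by gcongr
      _ ≤ 2 * ((w : ℝ) + w) * (Λ * (7 * l + 1)) := by gcongr
      _ = 4 * (w * Λ) * (7 * l + 1) := by ring
  have hη0 : 0 ≤ η := by rw [hη]; positivity
  have h1 : 8 * η * (σ + 1) * D * (D + 1) * √(gam * p * N) ≤
      32 * f * (16 * gam * ((7 * l + 1) * l) + 1) := by
    have h5 : √(gam * p * N) ≤ √(gam * (4 * l) * N) := by gcongr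
    have h6 : √(4 * (w * Λ) * (7 * l + 1)) * √(gam * (4 * l) * N) =
        q * √(16 * gam * ((7 * l + 1) * l)) := by
      rw [hq, ← Real.sqrt_mul (by positivity), ← Real.sqrt_mul (by positivity)]
      congr 1; ring
    have h7 : √(16 * gam * ((7 * l + 1) * l)) ≤ 16 * gam * ((7 * l + 1) * l) + 1 :=
      sqrt_le_add_one (by positivity)
    calc 8 * η * (σ + 1) * D * (D + 1) * √(gam * p * N)
        ≤ 8 * (R * √(4 * (w * Λ) * (7 * l + 1))) * (σ + σ) * D * (D + D) *
            √(gam * (4 * l) * N) := by gcongr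
      _ = 32 * (R * σ * D ^ 2) * (√(4 * (w * Λ) * (7 * l + 1)) * √(gam * (4 * l) * N)) := by ring
      _ = 32 * (R * σ * D ^ 2 * q) * √(16 * gam * ((7 * l + 1) * l)) := by rw [h6]; ring
      _ ≤ 32 * f * (16 * gam * ((7 * l + 1) * l) + 1) := by gcongr
  rw [eval_ratePoly]
  linarith

end Rate

namespace Bandit

variable {A B Z W : Type*} [TopologicalSpace A] [CompactSpace A] [PolishSpace A]
  [MeasurableSpace A] [BorelSpace A] [Fintype B]
  [AddCommGroup Z] [Module ℝ Z] [FiniteDimensional ℝ Z]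
  [TopologicalSpace Z] [IsTopologicalAddGroup Z] [ContinuousSMul ℝ Z] [T2Space Z]
  [AddCommGroup W] [Module ℝ W] [FiniteDimensional ℝ W]
  [TopologicalSpace W] [IsTopologicalAddGroup W] [ContinuousSMul ℝ W] [T2Space W]

/-- Ensures `log f ≥ 0`, the range in which `ratePoly` is monotone and at least `132`. -/
theorem one_le_rate (b : Bandit A B Z W) [Nonempty A] (hS : 0 < b.S) {θ : Z} (hθ : θ ∈ b.H)
    (hD : 0 < Module.finrank ℝ Z) {N : ℕ} (hN : 0 < N) :
    1 ≤ b.R * b.S⁻¹ * b.DZ ^ 2 *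
      √(b.DW * Real.log (Real.exp 1 * b.cardB / b.DW) * N) + b.DZ ^ 2 * b.C := by
  have hW := b.nontrivial_W hD
  have hw : 1 ≤ Module.finrank ℝ W := Module.finrank_pos
  have hβ : ((Module.finrank ℝ W : ℕ) : ℝ) + 1 ≤ b.cardB := by
    rw [cardB]; exact_mod_cast b.finrank_W_lt_card hθ
  have h1 : 1 ≤ √(b.DW * Real.log (Real.exp 1 * b.cardB / b.DW) * N) :=
    (Real.one_le_sqrt.2 (by exact_mod_cast hN)).trans (sqrt_le_sqrt_rate hw hβ)
  have hDZ : 1 ≤ b.DZ := by rw [DZ]; exact_mod_cast hD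
  have h2 : 1 ≤ b.R * b.S⁻¹ * b.DZ ^ 2 :=
    one_le_mul_of_one_le_of_one_le (one_le_mul_of_one_le_of_one_le (b.one_le_R hθ)
      ((one_le_inv₀ hS).2 (b.S_le_one hθ))) (one_le_pow₀ hDZ)
  have h3 := b.C_nonneg hθ
  have h4 := one_le_mul_of_one_le_of_one_le h2 h1
  have h5 : 0 ≤ b.DZ ^ 2 * b.C := by positivity
  linarith

theorem etaN_nonneg (b : Bandit A B Z W) (N : ℕ) : 0 ≤ b.etaN N :=
  mul_nonneg b.R_nonneg (Real.sqrt_nonneg _)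

theorem ERg_le_zero_of_finrank_eq_zero (b : Bandit A B Z W) {η : ℝ} {φ : AgentPolicy A B}
    (hφ : b.IsIUCB η φ) {θ : Z} (hθ : θ ∈ b.H) (hD : Module.finrank ℝ Z = 0) (N : ℕ) :
    b.ERg θ φ N ≤ ((0 : ℝ) : EReal) :=
  b.ERg_le fun ν _ => b.regret_nonpos_of_finrank_eq_zero hφ hθ hD ν

theorem ERg_le_rate_of_finrank_pos (b : Bandit A B Z W) (hS : 0 < b.S) {N : ℕ} (hN : 0 < N)
    {φ : AgentPolicy A B} (hφ : b.IsIUCB (b.etaN N) φ) {θ : Z} (hθ : θ ∈ b.H)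
    (hD : 0 < Module.finrank ℝ Z) {f : ℝ}
    (hf : f = b.R * b.S⁻¹ * b.DZ ^ 2 *
      √(b.DW * Real.log (Real.exp 1 * b.cardB / b.DW) * N) + b.DZ ^ 2 * b.C) :
    b.ERg θ φ N ≤ ((f * ratePoly.eval (Real.log f) : ℝ) : EReal) := by
  have hA : Nonempty A := ⟨φ.arm 0 Fin.elim0⟩
  have hf1 : 1 ≤ f := hf ▸ b.one_le_rate hS hθ hD hN
  have hC0 := b.C_nonneg hθ
  by_cases hC : 2 * Real.exp 1 ≤ b.C * N ^ 3
  · have hW := b.nontrivial_W hD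
    have hβ : ((Module.finrank ℝ W : ℕ) : ℝ) + 1 ≤ b.cardB := by
      rw [cardB]; exact_mod_cast b.finrank_W_lt_card hθ
    refine (b.ERg_le_explicit hS (b.etaN_nonneg N) hφ hN
      (inv_pos.2 (by exact_mod_cast hN : (0 : ℝ) < N)) hθ).trans ?_
    refine EReal.coe_le_coe_iff.2 ?_
    exact explicit_le_rate (by rw [DZ]; exact_mod_cast hD) (b.one_le_R hθ)
      ((one_le_inv₀ hS).2 (b.S_le_one hθ)) Module.finrank_pos hβ hN hC hf rfl
  -- For `C N³ < 2 e` the trivial bound `N C` is already below a constant, whatever `η` is.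
  · refine b.ERg_le fun ν _ => (b.regret_le_mul_C hφ hθ ν N).trans ?_
    have hN1 : (1 : ℝ) ≤ N := by exact_mod_cast hN
    have h1 : (N : ℝ) * b.C ≤ b.C * N ^ 3 := by
      rw [mul_comm]
      exact mul_le_mul_of_nonneg_left (le_self_pow₀ hN1 (by norm_num)) hC0
    have h2 := le_eval_ratePoly (Real.log_nonneg hf1)
    have h3 := Real.exp_one_lt_d9
    nlinarith

/-- The rate in terms of `ln (e |B| / D_W)`. -/
theorem ERg_le_rate (b : Bandit A B Z W) (hS : 0 < b.S) {N : ℕ} (hN : 0 < N)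
    {φ : AgentPolicy A B} (hφ : b.IsIUCB (b.etaN N) φ) {θ : Z} (hθ : θ ∈ b.H) {f : ℝ}
    (hf : f = b.R * b.S⁻¹ * b.DZ ^ 2 *
      √(b.DW * Real.log (Real.exp 1 * b.cardB / b.DW) * N) + b.DZ ^ 2 * b.C) :
    b.ERg θ φ N ≤ ((f * ratePoly.eval (Real.log f) : ℝ) : EReal) := by
  rcases Nat.eq_zero_or_pos (Module.finrank ℝ Z) with hD | hD
  · have hf0 : f = 0 := by rw [hf, DZ, hD]; simp
    rw [hf0, zero_mul]
    exact b.ERg_le_zero_of_finrank_eq_zero hφ hθ hD N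
  · exact b.ERg_le_rate_of_finrank_pos hS hN hφ hθ hD hf

/-- The rate in terms of `ln (|B| / D_W)`. -/
theorem ERg_le_rate_of_le_cardB (b : Bandit A B Z W) {ε : ℝ} (hε : 0 < ε)
    (hB : (1 + ε) * b.DW ≤ b.cardB) (hS : 0 < b.S) {N : ℕ} (hN : 0 < N)
    {φ : AgentPolicy A B} (hφ : b.IsIUCB (b.etaN N) φ) {θ : Z} (hθ : θ ∈ b.H) {f k : ℝ}
    (hk : k = √(1 + (Real.log (1 + ε))⁻¹))
    (hf : f = b.R * b.S⁻¹ * b.DZ ^ 2 *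
      √(b.DW * Real.log (b.cardB / b.DW) * N) + b.DZ ^ 2 * b.C) :
    b.ERg θ φ N ≤ ((f * (Polynomial.C k *
      ratePoly.comp (Polynomial.X + Polynomial.C (Real.log k))).eval (Real.log f) : ℝ) : EReal) := by
  rcases Nat.eq_zero_or_pos (Module.finrank ℝ Z) with hD | hD
  · have hf0 : f = 0 := by rw [hf, DZ, hD]; simp
    rw [hf0, zero_mul]
    exact b.ERg_le_zero_of_finrank_eq_zero hφ hθ hD N
  have hA : Nonempty A := ⟨φ.arm 0 Fin.elim0⟩
  have hW := b.nontrivial_W hD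
  have hDW : 0 < b.DW := by rw [DW]; exact_mod_cast Module.finrank_pos
  have hC0 := b.C_nonneg hθ
  have hR0 := b.R_nonneg
  have hS0 : 0 < b.S⁻¹ := inv_pos.2 hS
  have hlε : 0 < Real.log (1 + ε) := Real.log_pos (by linarith)
  have hB0 : 0 < b.cardB := lt_of_lt_of_le (by positivity) hB
  have hΛ : Real.log (1 + ε) ≤ Real.log (b.cardB / b.DW) :=
    Real.log_le_log (by linarith) ((le_div_iff₀ hDW).2 hB)
  set Λ := Real.log (b.cardB / b.DW) with hΛdef
  have hΛ0 : 0 < Λ := hlε.trans_le hΛ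
  have hΛe : Real.log (Real.exp 1 * b.cardB / b.DW) = 1 + Λ := by
    rw [mul_div_assoc, Real.log_mul (Real.exp_pos 1).ne' (by positivity), Real.log_exp]
  have hk1 : 1 ≤ k := by
    rw [hk]
    refine Real.one_le_sqrt.2 ?_
    have : 0 < (Real.log (1 + ε))⁻¹ := inv_pos.2 hlε
    linarith
  -- Since `Λ` is bounded below by `log (1 + ε)`, the extra `1` from `log e` costs a factor `k²`. So
  -- the two rates differ by at most the factor `k`, and the polynomial is shifted by `log k`.
  have hΛk : 1 + Λ ≤ (1 + (Real.log (1 + ε))⁻¹) * Λ := by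
    have : 1 ≤ (Real.log (1 + ε))⁻¹ * Λ := by
      rw [inv_mul_eq_div, le_div_iff₀ hlε, one_mul]; exact hΛ
    linarith
  set f' := b.R * b.S⁻¹ * b.DZ ^ 2 *
    √(b.DW * Real.log (Real.exp 1 * b.cardB / b.DW) * N) + b.DZ ^ 2 * b.C with hf'
  have hfe_ge : 1 ≤ f' := b.one_le_rate hS hθ hD hN
  have hsq : √(b.DW * Real.log (Real.exp 1 * b.cardB / b.DW) * N) ≤ k * √(b.DW * Λ * N) := by
    rw [hΛe, hk, ← Real.sqrt_mul (by positivity)]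
    refine Real.sqrt_le_sqrt ?_
    calc b.DW * (1 + Λ) * N ≤ b.DW * ((1 + (Real.log (1 + ε))⁻¹) * Λ) * N := by gcongr
      _ = _ := by ring
  have hff' : f' ≤ k * f := by
    rw [hf', hf, mul_add]
    refine add_le_add ?_ (le_mul_of_one_le_left (by positivity) hk1)
    calc b.R * b.S⁻¹ * b.DZ ^ 2 * √(b.DW * Real.log (Real.exp 1 * b.cardB / b.DW) * N)
        ≤ b.R * b.S⁻¹ * b.DZ ^ 2 * (k * √(b.DW * Λ * N)) := by gcongr
      _ = _ := by ring
  have hf0 : 0 < f := by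
    by_contra! h
    nlinarith
  have hlog : Real.log f' ≤ Real.log f + Real.log k := by
    rw [add_comm, ← Real.log_mul (by linarith) hf0.ne']
    exact Real.log_le_log (by linarith) hff'
  refine (b.ERg_le_rate_of_finrank_pos hS hN hφ hθ hD hf').trans (EReal.coe_le_coe_iff.2 ?_)
  have hl0 := Real.log_nonneg hfe_ge
  have hmono := eval_ratePoly_mono hl0 hlog
  have h132 := le_eval_ratePoly hl0
  simp only [Polynomial.eval_mul, Polynomial.eval_C, Polynomial.eval_comp, Polynomial.eval_add,
    Polynomial.eval_X]
  calc f' * ratePoly.eval (Real.log f')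
      ≤ k * f * ratePoly.eval (Real.log f + Real.log k) := by
        refine mul_le_mul hff' hmono (by linarith) (by positivity)
    _ = f * (k * ratePoly.eval (Real.log f + Real.log k)) := by ring

end Bandit

end ImpreciseBandit

end

/-! ### The theorem -/

theorem theorem2 :
    -- the explicit bound
    (∀ {A B Z W : Type*} [TopologicalSpace A] [CompactSpace A] [PolishSpace A]
        [MeasurableSpace A] [BorelSpace A] [Fintype B]
        [AddCommGroup Z] [Module ℝ Z] [FiniteDimensional ℝ Z]
        [TopologicalSpace Z] [IsTopologicalAddGroup Z] [ContinuousSMul ℝ Z] [T2Space Z]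
        [AddCommGroup W] [Module ℝ W] [FiniteDimensional ℝ W]
        [TopologicalSpace W] [IsTopologicalAddGroup W] [ContinuousSMul ℝ W] [T2Space W]
        (b : ImpreciseBandit.Bandit A B Z W) (_hS : 0 < b.S)
        (η : ℝ) (_hη : 0 ≤ η) (φ : ImpreciseBandit.AgentPolicy A B) (_hφ : b.IsIUCB η φ)
        (N : ℕ) (_hN : 0 < N) (δ : ℝ) (_hδ : 0 < δ) (θ : Z) (_hθ : θ ∈ b.H),
        b.ERg θ φ N ≤
          ((8 * η * (b.S⁻¹ + 1) * b.DZ * (b.DZ + 1)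
                * √(ImpreciseBandit.gam * Real.posLog (b.DZ * b.R / δ) * N)
              + 1 / 2 * b.C
                * (2 * Real.exp 1 * b.cardB / (b.DW + 1)) ^ (Module.finrank ℝ W + 1)
                * N ^ 2 * (N + 1) * Real.exp (-(η ^ 2 / (2 * b.R ^ 2)))
              + ImpreciseBandit.gam * b.C * b.DZ ^ 2 * Real.posLog (b.DZ * b.R / δ)
              + (b.S⁻¹ + 1) * b.DZ * (36 * b.DZ + 8) * N * δ : ℝ) : EReal)) ∧
    -- the rate for the stated choice of `η`, uniformly over all bandits
    (∃ P : Polynomial ℝ,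
      ∀ {A B Z W : Type*} [TopologicalSpace A] [CompactSpace A] [PolishSpace A]
        [MeasurableSpace A] [BorelSpace A] [Fintype B]
        [AddCommGroup Z] [Module ℝ Z] [FiniteDimensional ℝ Z]
        [TopologicalSpace Z] [IsTopologicalAddGroup Z] [ContinuousSMul ℝ Z] [T2Space Z]
        [AddCommGroup W] [Module ℝ W] [FiniteDimensional ℝ W]
        [TopologicalSpace W] [IsTopologicalAddGroup W] [ContinuousSMul ℝ W] [T2Space W]
        (b : ImpreciseBandit.Bandit A B Z W) (_hS : 0 < b.S) (N : ℕ) (_hN : 0 < N)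
        (φ : ImpreciseBandit.AgentPolicy A B) (_hφ : b.IsIUCB (b.etaN N) φ)
        (θ : Z) (_hθ : θ ∈ b.H) (f : ℝ)
        (_hf : f = b.R * b.S⁻¹ * b.DZ ^ 2
            * √(b.DW * Real.log (Real.exp 1 * b.cardB / b.DW) * N) + b.DZ ^ 2 * b.C),
        b.ERg θ φ N ≤ ((f * P.eval (Real.log f) : ℝ) : EReal)) ∧
    -- the rate with `ln (|B| / D_W)`, uniformly over all bandits with `|B| / D_W` away from `1`
    (∀ ε : ℝ, 0 < ε → ∃ P : Polynomial ℝ,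
      ∀ {A B Z W : Type*} [TopologicalSpace A] [CompactSpace A] [PolishSpace A]
        [MeasurableSpace A] [BorelSpace A] [Fintype B]
        [AddCommGroup Z] [Module ℝ Z] [FiniteDimensional ℝ Z]
        [TopologicalSpace Z] [IsTopologicalAddGroup Z] [ContinuousSMul ℝ Z] [T2Space Z]
        [AddCommGroup W] [Module ℝ W] [FiniteDimensional ℝ W]
        [TopologicalSpace W] [IsTopologicalAddGroup W] [ContinuousSMul ℝ W] [T2Space W]
        (b : ImpreciseBandit.Bandit A B Z W) (_hB : (1 + ε) * b.DW ≤ b.cardB)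
        (_hS : 0 < b.S) (N : ℕ) (_hN : 0 < N)
        (φ : ImpreciseBandit.AgentPolicy A B) (_hφ : b.IsIUCB (b.etaN N) φ)
        (θ : Z) (_hθ : θ ∈ b.H) (f : ℝ)
        (_hf : f = b.R * b.S⁻¹ * b.DZ ^ 2
            * √(b.DW * Real.log (b.cardB / b.DW) * N) + b.DZ ^ 2 * b.C),
        b.ERg θ φ N ≤ ((f * P.eval (Real.log f) : ℝ) : EReal)) := by
  refine ⟨fun b hS η hη φ hφ N hN δ hδ θ hθ => b.ERg_le_explicit hS hη hφ hN hδ hθ,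
    ⟨ImpreciseBandit.ratePoly, fun b hS N hN φ hφ θ hθ f hf => b.ERg_le_rate hS hN hφ hθ hf⟩,
    fun ε hε => ⟨_, fun b hB hS N hN φ hφ θ hθ f hf =>
      b.ERg_le_rate_of_le_cardB hε hB hS hN hφ hθ rfl hf⟩⟩
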